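/- **Setting.** Multi-indices are $\gamma\in\mathbb N^d$, with $|\gamma|=\sum_i\gamma_i$, $x^\gamma=\prod_i x_i^{\gamma_i}$ and unit multi-indices $e_i$; $|\cdot|$ is the Euclidean norm of a vector and the Frobenius norm of a matrix; $I_R=[-R,R]^d$. Let $h>0$ be a step size with $nh=T$. The data are: a drift $b_h:\mathbb R^d\to\mathbb R^d$ and a diffusion $\sigma_h:\mathbb R^d\to\mathbb R^{d\times m}$; a random vector $u_0\in\mathbb R^d$; i.i.d. standard Gaussian vectors $z_0,z_1,\dots\in\mathbb R^m$, independent of $u_0$; polynomials $p_b=\sum_{|\alpha|\le S}b_\alpha x^\alpha$ ($\mathbb R^d$-valued) and $p_\sigma$ ($\mathbb R^{d\times m}$-valued) with $\deg p_b\le S$, $2\deg p_\sigma\le S$, $p_\sigma p_\sigma^{T}=\sum_{|\alpha|\le S}\sigma_\alpha x^\alpha$; and a truncation function $\chi_R\in C_c^\infty(\mathbb R^d;\mathbb R^d)$ with $\chi_R(x)=x$ on $I_{R/3}$, $\chi_R=0$ off $I_R$, and every component $1$-Lipschitz. *Reference scheme.* $v^{R,S}_0=\chi_R(u_0)$, $v^{R,S}_{k+1}=\chi_R\big(v^{R,S}_k+p_b(v^{R,S}_k)h+p_\sigma(v^{R,S}_k)z_k\sqrt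 h\big)$, with moments $m^{R,S}_{k,\gamma}=\mathbb E[(v^{R,S}_k)^\gamma]$. *mRPC.* Let $J=2L+S$. Start from $m^{\rm RPC}_{0,\gamma}=\mathbb E[u_0^\gamma]$, $|\gamma|\le J$. At step $k$, let $T_{k,\alpha}$ ($|\alpha|\le L$) be obtained by Gram–Schmidt (monomials in graded lexicographic order) from the bilinear form $\langle x^\alpha,x^\beta\rangle=m^{\rm RPC}_{k,\alpha+\beta}$, and let $\Gamma_{k,\alpha\beta\eta}$ be the value at $T_{k,\alpha}T_{k,\beta}T_{k,\eta}$ of the linear functional $x^\gamma\mapsto m^{\rm RPC}_{k,\gamma}$. Fix a rule writing each $\gamma$ with $|\gamma|\le 2L+2S$ as $\gamma_1+\gamma_2+\gamma_3+\gamma_4$ with $|\gamma_1|,|\gamma_2|\le L$, $|\gamma_3|,|\gamma_4|\le S$, and $\gamma_4=0$ if $|\gamma|\le J$. Denote by $c_\alpha(\kappa)=\langle x^{\kappa},T_{k,\alpha}\rangle$ the expansion coefficients of $x^\kappa$. Set $$\mathcal E[x^\gamma]=\sum_{|\alpha|,|\beta|\le L,\,|\eta|\le S}c_\alpha(\gamma_1)c_\beta(\gamma_2)c_\eta(\gamma_3)\Gamma_{k,\alpha\beta\eta}\quad(|\gamma|\le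 J),\qquad \mathcal E[x^\gamma]=\sum_{|\eta|\le L}q_\eta(\gamma_3,\gamma_1)\,q_\eta(\gamma_4,\gamma_2)\quad(J<|\gamma|\le 2L+2S),$$ where $q_\eta(\kappa,\kappa')=\sum_{|\alpha|\le S,|\beta|\le L}c_\alpha(\kappa)c_\beta(\kappa')\Gamma_{k,\alpha\beta\eta}$, and extend $\mathcal E$ linearly to polynomials. Then for $|\gamma|\le J$ $$m^{\rm RPC}_{k+1,\gamma}=m^{\rm RPC}_{k,\gamma}+h\sum_{i}\gamma_i\,\mathcal E\big[x^{\gamma-e_i}p_b^{(i)}\big]+h\sum_{j}\sum_{i\le l}\frac{\gamma_i(\gamma_l-\delta_{il})}{1+\delta_{il}}\,\mathcal E\big[x^{\gamma-e_i-e_l}p_\sigma^{(i,j)}p_\sigma^{(l,j)}\big],$$ terms with zero coefficient being omitted. For $J<|\gamma|\le2L+2S$ write $m^{\rm RPC}_{k,\gamma}:=\mathcal E[x^\gamma]$ (computed at step $k$). **Assumptions**, with constants $K,T,\delta_0,C,r,C_{b,\sigma}>0$, $\lambda_1\ge\lambda_2>0$, $\eta\in(1,2)$ and real $R^*,M_0,C_\delta$,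 where $L=\lfloor\lambda_1R^\eta\rfloor$, $S=\lfloor\lambda_2R^\eta\rfloor$: 1. $|b_h(x)|\le K(|x|+1)$, $|\sigma_h(x)|<K$, and $b_h,\sigma_h$ are $K$-Lipschitz on $\mathbb R^d$; $|b_h-p_b|\le CR^rS^{-r}$ and $|\sigma_h-p_\sigma|\le CR^rS^{-r}$ on $I_R$; and, if $R>R^*$, $\sum_{|\alpha|\le S}\big(|b_\alpha|+\tfrac12|\sigma_\alpha|\big)(2L+2S)^{|\alpha|}\le C_{b,\sigma}R^\eta$. 2. $\mathbb E\exp(\delta_0|u_0|^2)\le M_0<\infty$. 3. For all $0\le k\le n$, the matrix $(m^{\rm RPC}_{k,\alpha+\beta})_{|\alpha|,|\beta|\le L}$ is positive definite, and $|m^{\rm RPC}_{k,\gamma}|\le C_\delta\sqrt{|\gamma|!}$ for all $|\gamma|\le 2L+2S$. **Theorem.** There is $\delta_*>0$, depending only on $K,T,\delta_0$, such that for every $\delta\in(0,\delta_*]$ and every $N\ge0$ there exist $C_N>0$ and $h_N\in(0,1)$, depending only on $N,\delta,d$ and the constants in the assumptions (not on $m$, $h$ or the data), such that for all $h\in(0,h_N)$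 with $T/h=n\in\mathbb N$ and $R=\delta^{-1/2}(-2\log h)^{1/2}$, whenever Assumptions 1–3 hold, $$\sup_{0\le k\le n}\ \sum_{|\gamma|\le J}\frac{\big|m^{R,S}_{k,\gamma}-m^{\rm RPC}_{k,\gamma}\big|}{|\gamma|!}\ \le\ C_N(-\log h)^{-N}.$$ -/

import Mathlib

open MeasureTheory ProbabilityTheory
open scoped BigOperators

noncomputable section

namespace MRPC

/-- The state space `ℝ^d` with its Euclidean norm. -/
abbrev Vec (d : ℕ) := EuclideanSpace ℝ (Fin d)

/-- Multi-indices in `ℕ^d`; the total order `|γ|` is `γ.degree`. -/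
abbrev Idx (d : ℕ) := Fin d →₀ ℕ

/-- The finite set of multi-indices of total order at most `n`. -/
def idxLE (d n : ℕ) : Finset (Idx d) := (Finsupp.finite_of_degree_le n).toFinset

theorem mem_idxLE {d n : ℕ} {γ : Idx d} : γ ∈ idxLE d n ↔ γ.degree ≤ n := by
  simp [idxLE]

/-- The monomial `x^γ`. -/
def mono {d : ℕ} (γ : Idx d) (x : Vec d) : ℝ := ∏ i, x i ^ γ i

/-- The cube `I_R = [-R, R]^d`. -/
def cube (d : ℕ) (R : ℝ) : Set (Vec d) := {x | ∀ i, |x i| ≤ R}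

/-- Frobenius norm of a real matrix. -/
def frob {p q : ℕ} (A : Matrix (Fin p) (Fin q) ℝ) : ℝ := √(∑ i, ∑ j, A i j ^ 2)

/-! ### Coefficients and assumptions on them -/

/-- Value of a vector of polynomials. -/
def evalVec {d : ℕ} (p : Fin d → MvPolynomial (Fin d) ℝ) (x : Vec d) : Vec d :=
  WithLp.toLp 2 fun i => MvPolynomial.eval (fun l => x l) (p i)

/-- Value of a matrix of polynomials. -/
def evalMat {d m : ℕ} (p : Matrix (Fin d) (Fin m) (MvPolynomial (Fin d) ℝ)) (x : Vec d) :
    Matrix (Fin d) (Fin m) ℝ :=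
  Matrix.of fun i j => MvPolynomial.eval (fun l => x l) (p i j)

/-- The weighted coefficient sum `∑_{|α| ≤ S} |b_α| w^{|α|}` of `p_b = ∑ b_α x^α`, `b_α ∈ ℝ^d`. -/
def driftSum {d : ℕ} (S : ℕ) (w : ℝ) (pb : Fin d → MvPolynomial (Fin d) ℝ) : ℝ :=
  ∑ α ∈ idxLE d S, ‖(WithLp.toLp 2 fun i => (pb i).coeff α : Vec d)‖ * w ^ α.degree

/-- The weighted coefficient sum `∑_{|α| ≤ S} |σ_α| w^{|α|}` of
`p_σ p_σᵀ = ∑ σ_α x^α`, `σ_α ∈ ℝ^{d × d}`. -/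
def diffusionSum {d m : ℕ} (S : ℕ) (w : ℝ)
    (pσ : Matrix (Fin d) (Fin m) (MvPolynomial (Fin d) ℝ)) : ℝ :=
  ∑ α ∈ idxLE d S,
    frob (Matrix.of fun i l => MvPolynomial.coeff α ((pσ * pσ.transpose) i l)) * w ^ α.degree

/-- Assumption on the numerical drift `b` and the numerical diffusion `σ` (at a given step size) and
on the polynomials approximating them on `I_R`:
linear growth, boundedness, Lipschitz continuity; polynomial approximation on `I_R` with error at
most `C R^r S^{-r}`; for `R > Rs`, the bound `M_b + M_σ / 2 ≤ Cbσ R^η`. -/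
structure DriftDiffusion (K C r η Cbσ Rs R : ℝ) (L S : ℕ) {d m : ℕ}
    (b : Vec d → Vec d) (σ : Vec d → Matrix (Fin d) (Fin m) ℝ)
    (pb : Fin d → MvPolynomial (Fin d) ℝ)
    (pσ : Matrix (Fin d) (Fin m) (MvPolynomial (Fin d) ℝ)) : Prop where
  growth : ∀ x, ‖b x‖ ≤ K * (‖x‖ + 1)
  bounded : ∀ x, frob (σ x) < K
  lip_drift : ∀ x y, ‖b x - b y‖ ≤ K * ‖x - y‖
  lip_diffusion : ∀ x y, frob (σ x - σ y) ≤ K * ‖x - y‖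
  degree_drift : ∀ i, (pb i).totalDegree ≤ S
  degree_diffusion : ∀ i j, 2 * (pσ i j).totalDegree ≤ S
  approx_drift : ∀ x ∈ cube d R, (S : ℝ) ^ r * ‖b x - evalVec pb x‖ ≤ C * R ^ r
  approx_diffusion : ∀ x ∈ cube d R, (S : ℝ) ^ r * frob (σ x - evalMat pσ x) ≤ C * R ^ r
  coeff_bound : Rs < R →
    driftSum S (2 * L + 2 * S) pb + 1 / 2 * diffusionSum S (2 * L + 2 * S) pσ ≤ Cbσ * R ^ η

/-- Assumption on the initial condition: `E exp(δ₀ |u₀|²) ≤ M₀ < ∞`. -/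
structure InitialCondition (δ₀ M₀ : ℝ) {d : ℕ} {Ω : Type*} [MeasurableSpace Ω] (P : Measure Ω)
    (u₀ : Ω → Vec d) : Prop where
  measurable : Measurable u₀
  integrable : Integrable (fun ω => Real.exp (δ₀ * ‖u₀ ω‖ ^ 2)) P
  bound : ∫ ω, Real.exp (δ₀ * ‖u₀ ω‖ ^ 2) ∂P ≤ M₀

/-- `z_0, z_1, …` are independent standard Gaussian vectors in `ℝ^m`, independent of `u₀`. -/
structure GaussianNoise {d m : ℕ} {Ω : Type*} [MeasurableSpace Ω] (P : Measure Ω)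
    (u₀ : Ω → Vec d) (z : ℕ → Ω → Fin m → ℝ) : Prop where
  measurable : ∀ k, Measurable (z k)
  law : ∀ k, P.map (z k) = Measure.pi fun _ => gaussianReal 0 1
  indep : iIndepFun z P
  indep_initial : IndepFun u₀ (fun ω k => z k ω) P

/-! ### The truncated polynomial reference scheme -/

/-- `χ` is a truncation function at level `R`: a smooth function which is the identity on
`I_{R/3}`, vanishes outside `I_R`, and each of whose components is `1`-Lipschitz. -/
structure IsTruncation {d : ℕ} (R : ℝ) (χ : Vec d → Vec d) : Prop where
  smooth : ContDiff ℝ (⊤ : ℕ∞) χ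
  eq_self : ∀ x ∈ cube d (R / 3), χ x = x
  eq_zero : ∀ x, x ∉ cube d R → χ x = 0
  lipschitz : ∀ x y i, |χ x i - χ y i| ≤ ‖x - y‖

/-- The reference scheme
`v_{k+1} = χ (v_k + p_b(v_k) h + p_σ(v_k) z_k √h)`, `v_0 = χ (u_0)`. -/
def refScheme {d m : ℕ} {Ω : Type*} (χ : Vec d → Vec d) (pb : Fin d → MvPolynomial (Fin d) ℝ)
    (pσ : Matrix (Fin d) (Fin m) (MvPolynomial (Fin d) ℝ)) (h : ℝ)
    (u₀ : Ω → Vec d) (z : ℕ → Ω → Fin m → ℝ) : ℕ → Ω → Vec d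
  | 0, ω => χ (u₀ ω)
  | k + 1, ω =>
    let v := refScheme χ pb pσ h u₀ z k ω
    χ (v + h • evalVec pb v + √h • WithLp.toLp 2 ((evalMat pσ v).mulVec (z k ω)))

/-- The moments `E[v^γ]` of a random vector. -/
def moment {d : ℕ} {Ω : Type*} [MeasurableSpace Ω] (P : Measure Ω) (v : Ω → Vec d) (γ : Idx d) : ℝ :=
  ∫ ω, mono γ (v ω) ∂P

/-! ### Polynomial chaos arithmetic associated with a moment sequence -/

/-- The linear functional on polynomials with `x^γ ↦ μ γ`. -/
def functional {d : ℕ} (μ : Idx d → ℝ) (p : MvPolynomial (Fin d) ℝ) : ℝ :=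
  ∑ γ ∈ p.support, p.coeff γ * μ γ

/-- The multi-indices strictly below `α` in the graded lexicographic order. -/
def idxBelow {d : ℕ} (α : Idx d) : Finset (Idx d) :=
  (idxLE d α.degree).filter fun β =>
    MonomialOrder.degLex.toSyn β < MonomialOrder.degLex.toSyn α

/-- The orthonormal polynomials `T_α` obtained by Gram-Schmidt from the monomials, in graded
lexicographic order, with respect to the bilinear form `⟨p, q⟩ = functional μ (p * q)`. -/
def orthoPoly {d : ℕ} (μ : Idx d → ℝ) (α : Idx d) : MvPolynomial (Fin d) ℝ :=
  let w := MvPolynomial.monomial α 1 - ∑ β ∈ (idxBelow α).attach,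
    functional μ (MvPolynomial.monomial α 1 * orthoPoly μ β.1) • orthoPoly μ β.1
  (√(functional μ (w * w)))⁻¹ • w
termination_by wellFounded_lt.wrap (MonomialOrder.degLex.toSyn α)
decreasing_by all_goals exact (Finset.mem_filter.mp β.2).2

/-- The triple products `Γ_{αβη}`. -/
def triple {d : ℕ} (μ : Idx d → ℝ) (α β η : Idx d) : ℝ :=
  functional μ (orthoPoly μ α * orthoPoly μ β * orthoPoly μ η)

/-- The coefficient of `T_α` in the expansion of `x^γ` in the orthonormal polynomials. -/
def expCoeff {d : ℕ} (μ : Idx d → ℝ) (γ α : Idx d) : ℝ :=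
  functional μ (MvPolynomial.monomial γ 1 * orthoPoly μ α)

/-- The coefficient of `T_η` in the projection `Π_L(w₁ w₂)` of the product of `w₁ = x^{γ₁}`,
`|γ₁| ≤ S`, and `w₂ = x^{γ₂}`, `|γ₂| ≤ L`:
`∑_{|α| ≤ S, |β| ≤ L} w_{1,α} w_{2,β} Γ_{αβη}`. -/
def projCoeff {d : ℕ} (L S : ℕ) (μ : Idx d → ℝ) (γ₁ γ₂ η : Idx d) : ℝ :=
  ∑ α ∈ idxLE d S, ∑ β ∈ idxLE d L, expCoeff μ γ₁ α * expCoeff μ γ₂ β * triple μ α β η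

/-- A rule which writes each `γ` with `|γ| ≤ 2L + 2S` as `γ₁ + γ₂ + γ₃ + γ₄` with
`|γ₁|, |γ₂| ≤ L` and `|γ₃|, |γ₄| ≤ S`, where `γ₄ = 0` if `|γ| ≤ 2L + S`. -/
structure IsSplitting {d : ℕ} (L S : ℕ) (s : Idx d → Fin 4 → Idx d) : Prop where
  sum_eq : ∀ γ : Idx d, γ.degree ≤ 2 * L + 2 * S → s γ 0 + s γ 1 + s γ 2 + s γ 3 = γ
  degree_L : ∀ γ : Idx d, γ.degree ≤ 2 * L + 2 * S → (s γ 0).degree ≤ L ∧ (s γ 1).degree ≤ L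
  degree_S : ∀ γ : Idx d, γ.degree ≤ 2 * L + 2 * S → (s γ 2).degree ≤ S ∧ (s γ 3).degree ≤ S
  last_eq_zero : ∀ γ : Idx d, γ.degree ≤ 2 * L + S → s γ 3 = 0

/-- The approximate expectation `ℰ[x^γ]`, computed from the triple products only: for
`|γ| ≤ 2L + S` it is `ℰ[x^{γ₁} x^{γ₂} x^{γ₃}] = ∑ w_{1,α} w_{2,β} w_{3,η} Γ_{αβη}`; for larger `|γ|`
the products `x^{γ₁} x^{γ₃}` and `x^{γ₂} x^{γ₄}` are first projected onto the span of
`T_η`, `|η| ≤ L`. -/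
def approxExp {d : ℕ} (L S : ℕ) (s : Idx d → Fin 4 → Idx d) (μ : Idx d → ℝ) (γ : Idx d) : ℝ :=
  if γ.degree ≤ 2 * L + S then
    ∑ α ∈ idxLE d L, ∑ β ∈ idxLE d L, ∑ η ∈ idxLE d S,
      expCoeff μ (s γ 0) α * expCoeff μ (s γ 1) β * expCoeff μ (s γ 2) η * triple μ α β η
  else
    ∑ η ∈ idxLE d L, projCoeff L S μ (s γ 2) (s γ 0) η * projCoeff L S μ (s γ 3) (s γ 1) η

/-- `ℰ[x^κ p]` for a polynomial `p`, by linearity. -/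
def approxExpPoly {d : ℕ} (L S : ℕ) (s : Idx d → Fin 4 → Idx d) (μ : Idx d → ℝ) (κ : Idx d)
    (p : MvPolynomial (Fin d) ℝ) : ℝ :=
  functional (approxExp L S s μ) (MvPolynomial.monomial κ 1 * p)

/-! ### The mRPC algorithm -/

/-- The moments `m_{k,γ}`, `|γ| ≤ 2L + S`, propagated by mRPC from the initial moments `μ₀`. The
diffusion term runs over unordered pairs `i ≤ l`, so it is
`(h/2) ∑_{i,l} ℰ[∂_i ∂_l (x^γ) (p_σ p_σᵀ)_{il}]`. Moments of order above `2L + S` are not propagated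
(they are set to `0` and never used). -/
def mrpc {d m : ℕ} (L S : ℕ) (s : Idx d → Fin 4 → Idx d) (pb : Fin d → MvPolynomial (Fin d) ℝ)
    (pσ : Matrix (Fin d) (Fin m) (MvPolynomial (Fin d) ℝ)) (h : ℝ) (μ₀ : Idx d → ℝ) :
    ℕ → Idx d → ℝ
  | 0, γ => if γ.degree ≤ 2 * L + S then μ₀ γ else 0
  | k + 1, γ =>
    let μ := mrpc L S s pb pσ h μ₀ k
    if γ.degree ≤ 2 * L + S then
      μ γ
      + h * ∑ i, (γ i : ℝ) * approxExpPoly L S s μ (γ - Finsupp.single i 1) (pb i)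
      + h * ∑ j, ∑ i, ∑ l ∈ Finset.univ.filter (fun l => i ≤ l),
          ((γ i : ℝ) * ((γ l : ℝ) - if i = l then 1 else 0) / (1 + if i = l then 1 else 0)) *
            approxExpPoly L S s μ (γ - Finsupp.single i 1 - Finsupp.single l 1) (pσ i j * pσ l j)
    else 0

/-- The moments computed by mRPC at a step with propagated moments `μ`: the propagated ones for
`|γ| ≤ 2L + S`, and `ℰ[x^γ]` for `2L + S < |γ| ≤ 2L + 2S`. -/
def computed {d : ℕ} (L S : ℕ) (s : Idx d → Fin 4 → Idx d) (μ : Idx d → ℝ) (γ : Idx d) : ℝ :=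
  if γ.degree ≤ 2 * L + S then μ γ else approxExp L S s μ γ

/-- The Hankel matrix `(μ_{α+β})_{|α|, |β| ≤ L}`. -/
def hankel {d : ℕ} (L : ℕ) (μ : Idx d → ℝ) : Matrix (idxLE d L) (idxLE d L) ℝ :=
  Matrix.of fun α β => μ (α.1 + β.1)

/-- Stability assumption for the mRPC moments up to step `n`: positive definite Hankel matrices and
`|m_{k,γ}| ≤ Cδ √(|γ|!)` for `|γ| ≤ 2L + 2S`. -/
structure Stable {d : ℕ} (Cδ : ℝ) (L S n : ℕ) (s : Idx d → Fin 4 → Idx d)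
    (mom : ℕ → Idx d → ℝ) : Prop where
  posDef : ∀ k ≤ n, (hankel L (mom k)).PosDef
  bound : ∀ k ≤ n, ∀ γ : Idx d, γ.degree ≤ 2 * L + 2 * S →
    |computed L S s (mom k) γ| ≤ Cδ * √(γ.degree.factorial : ℝ)

/-- The weighted distance `∑_{|γ| ≤ J} |μ_γ - ν_γ| / |γ|!` between moment sequences. -/
def momentDist {d : ℕ} (J : ℕ) (μ ν : Idx d → ℝ) : ℝ :=
  ∑ γ ∈ idxLE d J, |μ γ - ν γ| / (γ.degree.factorial : ℝ)

end MRPC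

end

/-! Both moment sequences nearly satisfy one linear recursion, μ_γ ↦ μ_γ + h μ(G x^γ), where G is
the second-order generator with polynomial coefficients (`genPoly`); the proof bounds the two
defects and the growth of their difference.

mRPC. Positive definiteness of the Hankel matrix makes the T_α orthonormal, so monomials of order at
most L equal their finite expansions and ℰ[x^γ] = m_γ for |γ| ≤ J (`approxExp_eq`). With the
projected values as moments of order above J, mRPC satisfies the recursion exactly (`mrpc_succ`,
`approxExp_eq_computed`). How good the projected values are is never examined.

Reference scheme. Its moments satisfy the recursion up to |γ|! times two errors. A weak Taylor
expansion of one untruncated step contributes h^{3/2} e^{O(R)}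
(`abs_integral_mono_eulerStep_sub_le`). Truncation contributes at most e^{-δR²} e^{O(R)}: it acts
only after an exit from I_{R/3}, which Gaussian-type exponential moments make rare
(`integral_exp_frozenScheme_le`, `abs_moment_truncation_sub_le`). The choice of R means h =
e^{-δR²/2}, so both errors are at most h · e^{-δR²/4} e^{O(R)} (`abs_moment_refScheme_succ_sub_le`).

Propagation. With the weight 1/|γ|! the generator maps moments of order at most 2L+2S to moments of
order at most J with norm at most d²(M_b + M_σ/2) = O(R^η) (`sum_functional_genPoly_le`), so
Gronwall costs e^{O(R^η)}. Orders j with J < j ≤ 2L+2S are not propagated. There both sides are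
bounded a priori, by R^j and C_δ √j!, and division by j! leaves e^{-qj} for any prescribed q once R
is large, because j > J ≥ L, L is of order R^η and η > 1 (`tail_sum_le`).

Balance. The factor e^{-δR²/4} beats e^{O(R^η)} because η < 2, and q is chosen to beat the Gronwall
factor and the number of multi-indices (`total_error_le`). The total is O(e^{-R}), smaller than
every power of -log h = δR²/2. -/

noncomputable section

namespace MRPC

/-! ### The linear functional of a moment sequence -/

section Functional

variable {d : ℕ}

theorem functional_eq_sum (μ : Idx d → ℝ) (p : MvPolynomial (Fin d) ℝ) {s : Finset (Idx d)}
    (hs : p.support ⊆ s) : functional μ p = ∑ γ ∈ s, p.coeff γ * μ γ := by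
  refine Finset.sum_subset hs fun γ _ h => ?_
  rw [MvPolynomial.notMem_support_iff.1 h, zero_mul]

/-- `functional μ` as a linear map. -/
def functionalLin (μ : Idx d → ℝ) : MvPolynomial (Fin d) ℝ →ₗ[ℝ] ℝ where
  toFun := functional μ
  map_add' p q := by
    classical
    rw [functional_eq_sum μ (p + q) MvPolynomial.support_add,
      functional_eq_sum μ p (Finset.subset_union_left (s₂ := q.support)),
      functional_eq_sum μ q (Finset.subset_union_right (s₁ := p.support)),
      ← Finset.sum_add_distrib]
    simp [add_mul]
  map_smul' c p := by
    rw [functional_eq_sum μ (c • p) (MvPolynomial.support_smul), functional]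
    simp [Finset.mul_sum, mul_assoc]

theorem functional_add (μ : Idx d → ℝ) (p q : MvPolynomial (Fin d) ℝ) :
    functional μ (p + q) = functional μ p + functional μ q := (functionalLin μ).map_add p q

theorem functional_sub (μ : Idx d → ℝ) (p q : MvPolynomial (Fin d) ℝ) :
    functional μ (p - q) = functional μ p - functional μ q := (functionalLin μ).map_sub p q

theorem functional_smul (μ : Idx d → ℝ) (c : ℝ) (p : MvPolynomial (Fin d) ℝ) :
    functional μ (c • p) = c * functional μ p := (functionalLin μ).map_smul c p

theorem functional_zero (μ : Idx d → ℝ) : functional μ 0 = 0 := (functionalLin μ).map_zero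

theorem functional_sum (μ : Idx d → ℝ) {ι : Type*} (s : Finset ι)
    (p : ι → MvPolynomial (Fin d) ℝ) :
    functional μ (∑ i ∈ s, p i) = ∑ i ∈ s, functional μ (p i) := map_sum (functionalLin μ) p s

theorem functional_monomial (μ : Idx d → ℝ) (γ : Idx d) (c : ℝ) :
    functional μ (MvPolynomial.monomial γ c) = c * μ γ := by
  rw [functional_eq_sum μ _ MvPolynomial.support_monomial_subset]
  simp

theorem sum_monomial_of_subset (p : MvPolynomial (Fin d) ℝ) {s : Finset (Idx d)}
    (hs : p.support ⊆ s) : p = ∑ γ ∈ s, MvPolynomial.monomial γ (p.coeff γ) := by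
  conv_lhs => rw [← MvPolynomial.support_sum_monomial_coeff p]
  refine Finset.sum_subset hs fun γ _ h => ?_
  rw [MvPolynomial.notMem_support_iff.1 h, map_zero]

end Functional

/-! ### Gram-Schmidt orthogonalization of the monomials -/

section GramSchmidt

variable {d : ℕ}

theorem hankel_pos {L : ℕ} {μ : Idx d → ℝ} (h : (hankel L μ).PosDef)
    {p : MvPolynomial (Fin d) ℝ} (hp : p.support ⊆ idxLE d L) (hp0 : p ≠ 0) :
    0 < functional μ (p * p) := by
  have hx : (fun α : idxLE d L => p.coeff α.1) ≠ 0 := by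
    intro hx
    apply hp0
    ext γ
    by_cases hγ : γ ∈ idxLE d L
    · simpa using congrFun hx ⟨γ, hγ⟩
    · simpa using MvPolynomial.notMem_support_iff.1 (fun h => hγ (hp h))
  have := h.dotProduct_mulVec_pos hx
  refine this.trans_eq ?_
  conv_rhs => rw [sum_monomial_of_subset p hp]
  rw [Finset.sum_mul_sum, functional_sum]
  simp only [functional_sum, MvPolynomial.monomial_mul, functional_monomial, dotProduct,
    Matrix.mulVec, hankel, Matrix.of_apply]
  rw [← Finset.sum_coe_sort (idxLE d L)]
  refine Finset.sum_congr rfl fun α _ => ?_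
  rw [← Finset.sum_coe_sort (idxLE d L), Finset.mul_sum]
  refine Finset.sum_congr rfl fun β _ => ?_
  simp
  ring

/-- The unnormalized Gram-Schmidt polynomial. -/
def gsResidual (μ : Idx d → ℝ) (α : Idx d) : MvPolynomial (Fin d) ℝ :=
  MvPolynomial.monomial α 1 - ∑ β ∈ idxBelow α,
    functional μ (MvPolynomial.monomial α 1 * orthoPoly μ β) • orthoPoly μ β

theorem orthoPoly_eq (μ : Idx d → ℝ) (α : Idx d) :
    orthoPoly μ α =
      (√(functional μ (gsResidual μ α * gsResidual μ α)))⁻¹ • gsResidual μ α := by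
  rw [orthoPoly]
  simp only [gsResidual]
  rw [Finset.sum_attach (idxBelow α)
    (fun β => functional μ (MvPolynomial.monomial α 1 * orthoPoly μ β) • orthoPoly μ β)]

theorem degree_le_of_toSyn_le {α β : Idx d}
    (h : MonomialOrder.degLex.toSyn β ≤ MonomialOrder.degLex.toSyn α) :
    β.degree ≤ α.degree := by
  rw [MonomialOrder.degLex_le_iff, Finsupp.DegLex.le_iff] at h
  rcases h with h | h
  · exact h.le
  · exact h.1.le

theorem mem_idxBelow {α β : Idx d} : β ∈ idxBelow α ↔
    MonomialOrder.degLex.toSyn β < MonomialOrder.degLex.toSyn α := by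
  simp only [idxBelow, Finset.mem_filter, mem_idxLE, and_iff_right_iff_imp]
  exact fun h => degree_le_of_toSyn_le h.le

/-- The four claims feed each other, so they are proved together by induction along the graded
lexicographic order. Positive definiteness is what keeps the normalising factor from being the
default value 0⁻¹ = 0. The last claim is the one that lets a monomial be rebuilt from the T_β. -/
theorem orthoPoly_aux {L : ℕ} {μ : Idx d → ℝ} (h : (hankel L μ).PosDef) (α : Idx d)
    (hα : α.degree ≤ L) :
    (orthoPoly μ α).support ⊆ insert α (idxBelow α) ∧
    (∀ β ∈ idxBelow α, functional μ (orthoPoly μ α * orthoPoly μ β) = 0) ∧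
    functional μ (orthoPoly μ α * orthoPoly μ α) = 1 ∧
    gsResidual μ α = √(functional μ (gsResidual μ α * gsResidual μ α)) • orthoPoly μ α := by
  induction hn : MonomialOrder.degLex.toSyn α using WellFoundedLT.induction generalizing α with
  | ind x IH =>
  subst hn
  have IH' : ∀ β ∈ idxBelow α, _ := fun β hβ =>
    IH _ (mem_idxBelow.1 hβ) β ((degree_le_of_toSyn_le (mem_idxBelow.1 hβ).le).trans hα) rfl
  have hsuppβ : ∀ β ∈ idxBelow α, (orthoPoly μ β).support ⊆ idxBelow α := by
    intro β hβ γ hγ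
    rcases Finset.mem_insert.1 ((IH' β hβ).1 hγ) with rfl | h1
    · exact hβ
    · exact mem_idxBelow.2 ((mem_idxBelow.1 h1).trans (mem_idxBelow.1 hβ))
  have hsum : (∑ β ∈ idxBelow α, functional μ (MvPolynomial.monomial α 1 * orthoPoly μ β) •
      orthoPoly μ β).support ⊆ idxBelow α := by
    refine MvPolynomial.support_sum.trans (Finset.biUnion_subset.2 fun β hβ => ?_)
    exact MvPolynomial.support_smul.trans (hsuppβ β hβ)
  have hw : (gsResidual μ α).support ⊆ insert α (idxBelow α) := by
    rw [gsResidual, Finset.insert_eq]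
    refine (MvPolynomial.support_sub _ _ _).trans (Finset.union_subset_union ?_ hsum)
    exact MvPolynomial.support_monomial_subset
  have hins : insert α (idxBelow α) ⊆ idxLE d L := by
    intro γ hγ
    rcases Finset.mem_insert.1 hγ with rfl | h1
    · exact mem_idxLE.2 hα
    · exact mem_idxLE.2 ((degree_le_of_toSyn_le (mem_idxBelow.1 h1).le).trans hα)
  -- The subtracted terms are supported strictly below α, so the coefficient at α is still 1.
  have hw0 : gsResidual μ α ≠ 0 := by
    intro h0
    have := congrArg (MvPolynomial.coeff α) h0
    rw [gsResidual, MvPolynomial.coeff_sub, MvPolynomial.coeff_monomial, if_pos rfl,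
      MvPolynomial.notMem_support_iff.1 (fun h => lt_irrefl _ (mem_idxBelow.1 (hsum h)))] at this
    simp at this
  have hpos := hankel_pos h (hw.trans hins) hw0
  have hsq := Real.sqrt_pos.2 hpos
  have hT := orthoPoly_eq μ α
  have horth : ∀ β ∈ idxBelow α, ∀ γ ∈ idxBelow α,
      functional μ (orthoPoly μ β * orthoPoly μ γ) = if β = γ then 1 else 0 := by
    intro β hβ γ hγ
    split_ifs with hbg
    · subst hbg; exact (IH' β hβ).2.2.1
    · rcases lt_trichotomy (MonomialOrder.degLex.toSyn β) (MonomialOrder.degLex.toSyn γ)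
        with h1 | h1 | h1
      · rw [mul_comm]; exact (IH' γ hγ).2.1 β (mem_idxBelow.2 h1)
      · exact absurd (MonomialOrder.degLex.toSyn.injective h1) hbg
      · exact (IH' β hβ).2.1 γ (mem_idxBelow.2 h1)
  refine ⟨?_, fun β hβ => ?_, ?_, ?_⟩
  · rw [hT]; exact MvPolynomial.support_smul.trans hw
  · rw [hT, smul_mul_assoc, functional_smul]
    refine mul_eq_zero_of_right _ ?_
    rw [gsResidual, sub_mul, functional_sub, Finset.sum_mul, functional_sum, sub_eq_zero]
    simp only [smul_mul_assoc, functional_smul]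
    rw [Finset.sum_eq_single β]
    · rw [horth β hβ β hβ, if_pos rfl, mul_one]
    · intro γ hγ hne
      rw [horth γ hγ β hβ, if_neg hne, mul_zero]
    · exact fun h => absurd hβ h
  · conv_lhs => rw [hT]
    rw [smul_mul_smul_comm, functional_smul, ← mul_inv, Real.mul_self_sqrt hpos.le,
      inv_mul_cancel₀ hpos.ne']
  · conv_rhs => rw [hT]
    rw [smul_smul, mul_inv_cancel₀ hsq.ne', one_smul]

theorem functional_orthoPoly_mul {L : ℕ} {μ : Idx d → ℝ} (h : (hankel L μ).PosDef)
    {α β : Idx d} (hα : α.degree ≤ L) (hβ : β.degree ≤ L) :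
    functional μ (orthoPoly μ α * orthoPoly μ β) = if α = β then 1 else 0 := by
  split_ifs with hab
  · subst hab; exact (orthoPoly_aux h α hα).2.2.1
  · rcases lt_trichotomy (MonomialOrder.degLex.toSyn α) (MonomialOrder.degLex.toSyn β)
      with h1 | h1 | h1
    · rw [mul_comm]; exact (orthoPoly_aux h β hβ).2.1 α (mem_idxBelow.2 h1)
    · exact absurd (MonomialOrder.degLex.toSyn.injective h1) hab
    · exact (orthoPoly_aux h α hα).2.1 β (mem_idxBelow.2 h1)

/-- A monomial of order at most `n ≤ L` equals its expansion in the `T_α`, `|α| ≤ n`. -/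
theorem monomial_eq_sum_expCoeff {L n : ℕ} {μ : Idx d → ℝ} (h : (hankel L μ).PosDef)
    (hn : n ≤ L) {κ : Idx d} (hκ : κ.degree ≤ n) :
    MvPolynomial.monomial κ (1 : ℝ) = ∑ α ∈ idxLE d n, expCoeff μ κ α • orthoPoly μ α := by
  have hmem : MvPolynomial.monomial κ (1 : ℝ) ∈
      Submodule.span ℝ (Set.range fun α : idxLE d n => orthoPoly μ α.1) := by
    have h1 : MvPolynomial.monomial κ (1 : ℝ) = gsResidual μ κ + ∑ β ∈ idxBelow κ,
        functional μ (MvPolynomial.monomial κ 1 * orthoPoly μ β) • orthoPoly μ β := by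
      rw [gsResidual, sub_add_cancel]
    rw [h1, (orthoPoly_aux h κ (hκ.trans hn)).2.2.2]
    refine add_mem (Submodule.smul_mem _ _ (Submodule.subset_span ⟨⟨κ, mem_idxLE.2 hκ⟩, rfl⟩))
      (Submodule.sum_mem _ fun β hβ => Submodule.smul_mem _ _ (Submodule.subset_span
        ⟨⟨β, mem_idxLE.2 ((degree_le_of_toSyn_le (mem_idxBelow.1 hβ).le).trans hκ)⟩, rfl⟩))
  -- The identity is linear in p and holds for each T_β by orthonormality, hence on their span. Only
  -- |α| ≤ n occurs, so with n = S it matches the sum over |η| ≤ S in `approxExp`.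
  have key : ∀ p ∈ Submodule.span ℝ (Set.range fun α : idxLE d n => orthoPoly μ α.1),
      p = ∑ α ∈ idxLE d n, functional μ (p * orthoPoly μ α) • orthoPoly μ α := by
    intro p hp
    induction hp using Submodule.span_induction with
    | mem x hx =>
      obtain ⟨⟨β, hβ⟩, rfl⟩ := hx
      rw [Finset.sum_eq_single β]
      · simp [functional_orthoPoly_mul h ((mem_idxLE.1 hβ).trans hn) ((mem_idxLE.1 hβ).trans hn)]
      · intro α hα hne
        simp only
        rw [functional_orthoPoly_mul h ((mem_idxLE.1 hβ).trans hn) ((mem_idxLE.1 hα).trans hn),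
          if_neg (Ne.symm hne), zero_smul]
      · exact fun h => absurd hβ h
    | zero => simp [functional_zero]
    | add x y _ _ hx hy =>
      conv_lhs => rw [hx, hy]
      rw [← Finset.sum_add_distrib]
      simp only [add_mul, functional_add, add_smul]
    | smul c x _ hx =>
      conv_lhs => rw [hx]
      rw [Finset.smul_sum]
      simp only [smul_mul_assoc, functional_smul, smul_smul]
  exact key _ hmem

/-- The approximate expectation is exact for monomials of order at most `2L + S`. -/
theorem approxExp_eq {L S : ℕ} {s : Idx d → Fin 4 → Idx d} {μ : Idx d → ℝ}
    (hs : IsSplitting L S s) (h : (hankel L μ).PosDef) (hSL : S ≤ L) {γ : Idx d}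
    (hγ : γ.degree ≤ 2 * L + S) : approxExp L S s μ γ = μ γ := by
  have hγ' : γ.degree ≤ 2 * L + 2 * S := by omega
  have hsum := hs.sum_eq γ hγ'
  rw [hs.last_eq_zero γ hγ, add_zero] at hsum
  have hprod : MvPolynomial.monomial γ (1 : ℝ) = MvPolynomial.monomial (s γ 0) 1 *
      MvPolynomial.monomial (s γ 1) 1 * MvPolynomial.monomial (s γ 2) 1 := by
    rw [MvPolynomial.monomial_mul, MvPolynomial.monomial_mul, hsum]; simp
  have : μ γ = functional μ (MvPolynomial.monomial γ 1) := by
    rw [functional_monomial, one_mul]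
  rw [this, hprod, monomial_eq_sum_expCoeff h le_rfl (hs.degree_L γ hγ').1,
    monomial_eq_sum_expCoeff h le_rfl (hs.degree_L γ hγ').2,
    monomial_eq_sum_expCoeff h hSL (hs.degree_S γ hγ').1, approxExp, if_pos hγ]
  rw [Finset.sum_mul_sum, Finset.sum_mul, functional_sum]
  refine Finset.sum_congr rfl fun α _ => ?_
  rw [Finset.sum_mul_sum, functional_sum]
  refine Finset.sum_congr rfl fun β _ => ?_
  rw [functional_sum]
  refine Finset.sum_congr rfl fun η _ => ?_
  rw [smul_mul_smul_comm, smul_mul_smul_comm, functional_smul, triple]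

end GramSchmidt

/-! ### The generator on polynomials -/

section Generator

variable {d m : ℕ}

/-- The generator `p ↦ ∑ ∂_i p · b_i + ½ ∑ ∂_l ∂_i p · (σσᵀ)_{il}`. -/
def genPoly (pb : Fin d → MvPolynomial (Fin d) ℝ)
    (pσ : Matrix (Fin d) (Fin m) (MvPolynomial (Fin d) ℝ)) (p : MvPolynomial (Fin d) ℝ) :
    MvPolynomial (Fin d) ℝ :=
  ∑ i, MvPolynomial.pderiv i p * pb i +
    (1 / 2 : ℝ) • ∑ i, ∑ l, MvPolynomial.pderiv l (MvPolynomial.pderiv i p) *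
      (pσ * pσ.transpose) i l

theorem pderiv_pderiv_monomial (γ : Idx d) (i l : Fin d) :
    MvPolynomial.pderiv l (MvPolynomial.pderiv i (MvPolynomial.monomial γ (1 : ℝ))) =
      ((γ i : ℝ) * ((γ l : ℝ) - if i = l then 1 else 0)) •
        MvPolynomial.monomial (γ - Finsupp.single i 1 - Finsupp.single l 1) 1 := by
  rw [MvPolynomial.pderiv_monomial, MvPolynomial.pderiv_monomial, MvPolynomial.smul_monomial]
  congr 1
  by_cases h0 : γ i = 0
  · simp [h0]
  · by_cases hil : i = l
    · subst hil
      have : 1 ≤ γ i := Nat.one_le_iff_ne_zero.2 h0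
      simp [Nat.cast_sub this]
    · simp [hil]

/-- An unordered pair off the diagonal stands for two equal terms, while the diagonal carries weight
1/2. This identifies the diffusion term of the algorithm with the second-order part of `genPoly`. -/
theorem sum_le_eq_half_sum {ι : Type*} [Fintype ι] [LinearOrder ι] (f : ι → ι → ℝ)
    (hf : ∀ i l, f i l = f l i) :
    ∑ i, ∑ l ∈ Finset.univ.filter (fun l => i ≤ l), f i l / (1 + if i = l then 1 else 0) =
      1 / 2 * ∑ i, ∑ l, f i l := by
  have h1 : ∀ i l : ι, (if i ≤ l then f i l / (1 + if i = l then 1 else 0) else 0) +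
      (if l ≤ i then f l i / (1 + if l = i then 1 else 0) else 0) = f i l := by
    intro i l
    rcases lt_trichotomy i l with h | h | h
    · simp [h.le, h.ne, not_le.2 h]
    · subst h; simp; ring
    · simp [h.le, h.ne, not_le.2 h, hf]
  have h2 : ∑ i, ∑ l, f i l = 2 * ∑ i, ∑ l,
      (if i ≤ l then f i l / (1 + if i = l then 1 else 0) else 0) := by
    rw [two_mul]
    nth_rw 3 [Finset.sum_comm]
    rw [← Finset.sum_add_distrib]
    refine Finset.sum_congr rfl fun i _ => ?_
    rw [← Finset.sum_add_distrib]
    exact Finset.sum_congr rfl fun l _ => (h1 i l).symm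
  rw [h2]
  simp only [Finset.sum_filter]
  ring

theorem functional_genPoly (pb : Fin d → MvPolynomial (Fin d) ℝ)
    (pσ : Matrix (Fin d) (Fin m) (MvPolynomial (Fin d) ℝ)) (ν : Idx d → ℝ) (γ : Idx d) :
    functional ν (genPoly pb pσ (MvPolynomial.monomial γ 1)) =
      ∑ i, (γ i : ℝ) * functional ν (MvPolynomial.monomial (γ - Finsupp.single i 1) 1 * pb i) +
      1 / 2 * ∑ i, ∑ l, ((γ i : ℝ) * ((γ l : ℝ) - if i = l then 1 else 0)) *
        functional ν (MvPolynomial.monomial (γ - Finsupp.single i 1 - Finsupp.single l 1) 1 *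
          (pσ * pσ.transpose) i l) := by
  rw [genPoly, functional_add, functional_smul, functional_sum, functional_sum]
  congr 1
  · refine Finset.sum_congr rfl fun i _ => ?_
    rw [← functional_smul, ← smul_mul_assoc, MvPolynomial.pderiv_monomial,
      MvPolynomial.smul_monomial]
    simp
  · congr 1
    refine Finset.sum_congr rfl fun i _ => ?_
    rw [functional_sum]
    refine Finset.sum_congr rfl fun l _ => ?_
    rw [pderiv_pderiv_monomial, smul_mul_assoc, functional_smul]

/-- This puts the algorithm in the form of an explicit Euler step for the moment equation dμ_γ/dt =
μ(G x^γ), closed by ℰ; it needs neither orthonormality nor stability. -/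
theorem mrpc_succ (L S : ℕ) (s : Idx d → Fin 4 → Idx d) (pb : Fin d → MvPolynomial (Fin d) ℝ)
    (pσ : Matrix (Fin d) (Fin m) (MvPolynomial (Fin d) ℝ)) (h : ℝ) (μ₀ : Idx d → ℝ) (k : ℕ)
    {γ : Idx d} (hγ : γ.degree ≤ 2 * L + S) :
    mrpc L S s pb pσ h μ₀ (k + 1) γ = mrpc L S s pb pσ h μ₀ k γ +
      h * functional (approxExp L S s (mrpc L S s pb pσ h μ₀ k))
        (genPoly pb pσ (MvPolynomial.monomial γ 1)) := by
  rw [mrpc]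
  simp only [if_pos hγ]
  rw [functional_genPoly, mul_add, ← add_assoc]
  congr 2
  rw [← sum_le_eq_half_sum]
  · rw [Finset.sum_comm]
    refine Finset.sum_congr rfl fun i _ => ?_
    rw [Finset.sum_comm]
    refine Finset.sum_congr rfl fun l _ => ?_
    rw [← Finset.mul_sum, div_mul_eq_mul_div]
    congr 2
    rw [Matrix.mul_apply, Finset.mul_sum, functional_sum]
    rfl
  · intro i l
    have h1 : (pσ * pσ.transpose) i l = (pσ * pσ.transpose) l i := by
      rw [Matrix.mul_apply, Matrix.mul_apply]
      exact Finset.sum_congr rfl fun j _ => mul_comm _ _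
    rw [h1, tsub_right_comm]
    by_cases hil : i = l
    · subst hil; rfl
    · simp only [hil, Ne.symm hil, if_false, sub_zero, mul_comm (γ i : ℝ)]

theorem approxExp_eq_computed {L S : ℕ} {s : Idx d → Fin 4 → Idx d} {μ : Idx d → ℝ}
    (hs : IsSplitting L S s) (h : (hankel L μ).PosDef) (hSL : S ≤ L) :
    approxExp L S s μ = computed L S s μ := by
  funext γ
  rw [computed]
  split_ifs with hγ
  · exact approxExp_eq hs h hSL hγ
  · rfl

end Generator

/-! ### The generator in the factorially weighted norm -/

section WeightedNorm

variable {d m : ℕ}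

/-- The reason for the weight 1/|γ|!: the factor n produced by a derivative is absorbed by n (n-1)!
= n!, and multiplication by a monomial of order a then costs a further factors, each at most w. -/
theorem mul_factorial_le {n a w : ℕ} (hn : 1 ≤ n) (h : n + a ≤ w + 1) :
    n * (n - 1 + a).factorial ≤ w ^ a * n.factorial := by
  induction a with
  | zero => simp [Nat.mul_factorial_pred (by omega : n ≠ 0)]
  | succ a ih =>
    have := ih (by omega)
    rw [← add_assoc, Nat.factorial_succ, pow_succ]
    calc n * ((n - 1 + a + 1) * (n - 1 + a).factorial)
        = (n - 1 + a + 1) * (n * (n - 1 + a).factorial) := by ring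
      _ ≤ w * (w ^ a * n.factorial) := Nat.mul_le_mul (by omega) this
      _ = _ := by ring

theorem mul_mul_factorial_le {n a w : ℕ} (hn : 2 ≤ n) (h : n + a ≤ w + 1) :
    n * (n - 1) * (n - 2 + a).factorial ≤ w ^ a * n.factorial := by
  have h1 := mul_factorial_le (n := n - 1) (a := a) (w := w) (by omega) (by omega)
  rw [show n - 1 - 1 = n - 2 by omega] at h1
  calc n * (n - 1) * (n - 2 + a).factorial = n * ((n - 1) * (n - 2 + a).factorial) := by ring
    _ ≤ n * (w ^ a * (n - 1).factorial) := Nat.mul_le_mul le_rfl h1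
    _ = w ^ a * (n * (n - 1).factorial) := by ring
    _ = _ := by rw [Nat.mul_factorial_pred (by omega : n ≠ 0)]

/-- Here c is the coefficient produced by differentiating x^γ. Where it is nonzero, κ ≤ γ, so the
truncated subtraction is genuine and γ ↦ γ - κ + α is injective; the left side is then reindexed
into part of the right side. -/
theorem sum_shift_le {J w : ℕ} (e : Idx d → ℝ) (κ α : Idx d) (c : Idx d → ℕ) {W : ℝ}
    (hW : 0 ≤ W) (hκ : ∀ γ, c γ ≠ 0 → κ ≤ γ) (hJ : J + α.degree ≤ w)
    (hc : ∀ γ : Idx d, γ.degree ≤ J → c γ ≠ 0 →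
      c γ * ((γ - κ + α).degree.factorial : ℝ) ≤ W * γ.degree.factorial) :
    ∑ γ ∈ idxLE d J, c γ * |e (γ - κ + α)| / (γ.degree.factorial : ℝ) ≤
      W * ∑ γ ∈ idxLE d w, |e γ| / (γ.degree.factorial : ℝ) := by
  classical
  have h1 : ∑ γ ∈ idxLE d J, c γ * |e (γ - κ + α)| / (γ.degree.factorial : ℝ) =
      ∑ γ ∈ (idxLE d J).filter (fun γ => c γ ≠ 0),
        c γ * |e (γ - κ + α)| / (γ.degree.factorial : ℝ) := by
    rw [Finset.sum_filter]
    refine Finset.sum_congr rfl fun γ _ => ?_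
    split_ifs with h
    · rfl
    · rw [not_not] at h
      simp [h]
  have hinj : Set.InjOn (fun γ => γ - κ + α) ((idxLE d J).filter (fun γ => c γ ≠ 0)) := by
    intro γ hγ γ' hγ' h
    simp only [Finset.coe_filter, Set.mem_ofPred_eq] at hγ hγ'
    have h2 : γ - κ = γ' - κ := add_right_cancel h
    rw [← tsub_add_cancel_of_le (hκ γ hγ.2), h2, tsub_add_cancel_of_le (hκ γ' hγ'.2)]
  rw [h1, Finset.mul_sum]
  calc _ ≤ ∑ γ ∈ (idxLE d J).filter (fun γ => c γ ≠ 0),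
        W * (|e (γ - κ + α)| / ((γ - κ + α).degree.factorial : ℝ)) := by
        refine Finset.sum_le_sum fun γ hγ => ?_
        rw [Finset.mem_filter, mem_idxLE] at hγ
        have h2 := hc γ hγ.1 hγ.2
        have h3 : (0 : ℝ) < γ.degree.factorial := by positivity
        have h4 : (0 : ℝ) < (γ - κ + α).degree.factorial := by positivity
        rw [← mul_div_assoc, div_le_div_iff₀ h3 h4]
        nlinarith [mul_le_mul_of_nonneg_right h2 (abs_nonneg (e (γ - κ + α)))]
    _ = ∑ γ ∈ ((idxLE d J).filter (fun γ => c γ ≠ 0)).image (fun γ => γ - κ + α),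
        W * (|e γ| / (γ.degree.factorial : ℝ)) := by
        rw [Finset.sum_image hinj]
    _ ≤ _ := by
        refine Finset.sum_le_sum_of_subset_of_nonneg ?_ fun γ _ _ => by positivity
        intro γ hγ
        obtain ⟨γ', h', rfl⟩ := Finset.mem_image.1 hγ
        rw [Finset.mem_filter, mem_idxLE] at h'
        have : (γ' - κ).degree ≤ γ'.degree := Finsupp.degree_mono tsub_le_self
        rw [mem_idxLE, map_add]
        omega

theorem degree_sub_eq {κ γ : Idx d} (h : κ ≤ γ) : (γ - κ).degree = γ.degree - κ.degree := by
  have := congrArg Finsupp.degree (tsub_add_cancel_of_le h)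
  rw [map_add] at this
  omega

theorem apply_le_degree (γ : Idx d) (i : Fin d) : γ i ≤ γ.degree := Finsupp.le_degree i γ

theorem sum_drift_shift_le {J w : ℕ} (e : Idx d → ℝ) (α : Idx d) (i : Fin d)
    (hJ : J + α.degree ≤ w) :
    ∑ γ ∈ idxLE d J, (γ i : ℝ) * |e (γ - Finsupp.single i 1 + α)| / (γ.degree.factorial : ℝ) ≤
      (w : ℝ) ^ α.degree * ∑ γ ∈ idxLE d w, |e γ| / (γ.degree.factorial : ℝ) := by
  have hκ : ∀ γ : Idx d, γ i ≠ 0 → Finsupp.single i 1 ≤ γ := fun γ h =>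
    Finsupp.single_le_iff.2 (Nat.one_le_iff_ne_zero.2 h)
  refine sum_shift_le e (Finsupp.single i 1) α (fun γ => γ i) (by positivity) hκ hJ
    fun γ hγ h0 => ?_
  rw [map_add, degree_sub_eq (hκ γ h0), Finsupp.degree_single]
  have h1 := apply_le_degree γ i
  have h2 : 1 ≤ γ i := Nat.one_le_iff_ne_zero.2 h0
  have := mul_factorial_le (n := γ.degree) (a := α.degree) (w := w) (by omega) (by omega)
  exact_mod_cast (Nat.mul_le_mul_right _ h1).trans this

theorem sum_diffusion_shift_le {J w : ℕ} (e : Idx d → ℝ) (α : Idx d) (i l : Fin d)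
    (hJ : J + α.degree ≤ w) :
    ∑ γ ∈ idxLE d J, |(γ i : ℝ) * ((γ l : ℝ) - if i = l then 1 else 0)| *
        |e (γ - Finsupp.single i 1 - Finsupp.single l 1 + α)| / (γ.degree.factorial : ℝ) ≤
      (w : ℝ) ^ α.degree * ∑ γ ∈ idxLE d w, |e γ| / (γ.degree.factorial : ℝ) := by
  -- If γ_i ≠ 0, then γ_l - δ_{il} is the l-th entry of γ - e_i; if γ_i = 0, both products vanish.
  -- So the coefficient is a natural number despite the subtraction.
  have hcast : ∀ γ : Idx d, |(γ i : ℝ) * ((γ l : ℝ) - if i = l then 1 else 0)| =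
      ((γ i * (γ - Finsupp.single i 1 : Idx d) l : ℕ) : ℝ) := by
    intro γ
    by_cases h0 : γ i = 0
    · simp [h0]
    · by_cases hil : i = l
      · subst hil
        have : 1 ≤ γ i := Nat.one_le_iff_ne_zero.2 h0
        rw [abs_of_nonneg]
        · simp [Nat.cast_sub this]
        · have : (1 : ℝ) ≤ γ i := by exact_mod_cast this
          simp only [if_true]
          nlinarith
      · simp [hil, abs_of_nonneg]
  have hκ : ∀ γ : Idx d, γ i * (γ - Finsupp.single i 1 : Idx d) l ≠ 0 →
      Finsupp.single i 1 + Finsupp.single l 1 ≤ γ := fun γ h => by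
    have h1 : Finsupp.single i 1 ≤ γ :=
      Finsupp.single_le_iff.2 (Nat.one_le_iff_ne_zero.2 (left_ne_zero_of_mul h))
    have h2 : Finsupp.single l 1 ≤ γ - Finsupp.single i 1 :=
      Finsupp.single_le_iff.2 (Nat.one_le_iff_ne_zero.2 (right_ne_zero_of_mul h))
    calc _ = Finsupp.single l 1 + Finsupp.single i 1 := add_comm _ _
      _ ≤ γ - Finsupp.single i 1 + Finsupp.single i 1 := by gcongr
      _ = γ := tsub_add_cancel_of_le h1
  simp only [hcast, tsub_tsub]
  refine sum_shift_le e _ α (fun γ => γ i * (γ - Finsupp.single i 1 : Idx d) l) (by positivity) hκ hJ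
    fun γ hγ h0 => ?_
  have hdeg := Finsupp.degree_mono (hκ γ h0)
  rw [map_add, degree_sub_eq (hκ γ h0)]
  simp only [map_add, Finsupp.degree_single] at hdeg ⊢
  have h1 := apply_le_degree γ i
  have h2 := apply_le_degree (γ - Finsupp.single i 1 : Idx d) l
  rw [degree_sub_eq (le_self_add.trans (hκ γ h0)), Finsupp.degree_single] at h2
  have := mul_mul_factorial_le (n := γ.degree) (a := α.degree) (w := w) (by omega) (by omega)
  exact_mod_cast (Nat.mul_le_mul_right _ (Nat.mul_le_mul h1 h2)).trans this

theorem abs_functional_monomial_mul_le {S : ℕ} (e : Idx d → ℝ) (κ : Idx d)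
    {p : MvPolynomial (Fin d) ℝ} (hp : p.totalDegree ≤ S) :
    |functional e (MvPolynomial.monomial κ 1 * p)| ≤
      ∑ α ∈ idxLE d S, |p.coeff α| * |e (κ + α)| := by
  have hs : p.support ⊆ idxLE d S := fun α hα =>
    mem_idxLE.2 ((MvPolynomial.le_totalDegree hα).trans hp)
  conv_lhs => rw [sum_monomial_of_subset p hs, Finset.mul_sum, functional_sum]
  refine (Finset.abs_sum_le_sum_abs _ _).trans (Finset.sum_le_sum fun α _ => ?_)
  rw [MvPolynomial.monomial_mul, functional_monomial, one_mul, abs_mul]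

theorem abs_entry_le_frob {p q : ℕ} (A : Matrix (Fin p) (Fin q) ℝ) (i : Fin p) (j : Fin q) :
    |A i j| ≤ frob A := by
  rw [frob]
  refine Real.abs_le_sqrt ?_
  calc A i j ^ 2 ≤ ∑ l, A i l ^ 2 :=
        Finset.single_le_sum (f := fun l => A i l ^ 2) (fun _ _ => sq_nonneg _)
          (Finset.mem_univ j)
    _ ≤ _ := Finset.single_le_sum (f := fun k => ∑ l, A k l ^ 2)
          (fun _ _ => Finset.sum_nonneg fun _ _ => sq_nonneg _) (Finset.mem_univ i)

/-- The generator is bounded, with norm at most `d² (M_b + M_σ / 2)`, from the weighted norm on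
moments of order at most `2L + 2S` to the weighted norm on moments of order at most `2L + S`. -/
theorem sum_functional_genPoly_le {L S : ℕ} {pb : Fin d → MvPolynomial (Fin d) ℝ}
    {pσ : Matrix (Fin d) (Fin m) (MvPolynomial (Fin d) ℝ)}
    (hb : ∀ i, (pb i).totalDegree ≤ S) (hσ : ∀ i j, 2 * (pσ i j).totalDegree ≤ S)
    (e : Idx d → ℝ) :
    ∑ γ ∈ idxLE d (2 * L + S),
        |functional e (genPoly pb pσ (MvPolynomial.monomial γ 1))| / (γ.degree.factorial : ℝ) ≤
      (d : ℝ) ^ 2 * (driftSum S (2 * L + 2 * S) pb + 1 / 2 * diffusionSum S (2 * L + 2 * S) pσ) *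
        ∑ γ ∈ idxLE d (2 * L + 2 * S), |e γ| / (γ.degree.factorial : ℝ) := by
  set D := ∑ γ ∈ idxLE d (2 * L + 2 * S), |e γ| / (γ.degree.factorial : ℝ) with hD
  have hD0 : 0 ≤ D := Finset.sum_nonneg fun _ _ => by positivity
  have hA : ∀ i l, ((pσ * pσ.transpose) i l).totalDegree ≤ S := by
    intro i l
    rw [Matrix.mul_apply]
    refine MvPolynomial.totalDegree_finsetSum_le fun j _ => ?_
    refine (MvPolynomial.totalDegree_mul _ _).trans ?_
    have h1 := hσ i j
    have h2 := hσ l j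
    rw [Matrix.transpose_apply]
    omega
  have hpt : ∀ γ ∈ idxLE d (2 * L + S),
      |functional e (genPoly pb pσ (MvPolynomial.monomial γ 1))| / (γ.degree.factorial : ℝ) ≤
      ∑ i, ∑ α ∈ idxLE d S, |(pb i).coeff α| *
        ((γ i : ℝ) * |e (γ - Finsupp.single i 1 + α)| / (γ.degree.factorial : ℝ)) +
      1 / 2 * ∑ i, ∑ l, ∑ α ∈ idxLE d S, |((pσ * pσ.transpose) i l).coeff α| *
        (|(γ i : ℝ) * ((γ l : ℝ) - if i = l then 1 else 0)| *
          |e (γ - Finsupp.single i 1 - Finsupp.single l 1 + α)| / (γ.degree.factorial : ℝ)) := by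
    intro γ _
    rw [functional_genPoly]
    refine (div_le_div_of_nonneg_right (abs_add_le _ _) (by positivity)).trans ?_
    rw [add_div]
    refine add_le_add ?_ ?_
    · refine (div_le_div_of_nonneg_right (Finset.abs_sum_le_sum_abs _ _) (by positivity)).trans ?_
      rw [Finset.sum_div]
      refine Finset.sum_le_sum fun i _ => ?_
      rw [abs_mul, Nat.abs_cast]
      refine (div_le_div_of_nonneg_right (mul_le_mul_of_nonneg_left
        (abs_functional_monomial_mul_le e _ (hb i)) (Nat.cast_nonneg _)) (by positivity)).trans ?_
      rw [Finset.mul_sum, Finset.sum_div]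
      exact Finset.sum_le_sum fun α _ => le_of_eq (by ring)
    · rw [abs_mul, abs_of_nonneg (by norm_num : (0 : ℝ) ≤ 1 / 2), mul_div_assoc]
      refine mul_le_mul_of_nonneg_left ?_ (by norm_num)
      refine (div_le_div_of_nonneg_right (Finset.abs_sum_le_sum_abs _ _) (by positivity)).trans ?_
      rw [Finset.sum_div]
      refine Finset.sum_le_sum fun i _ => ?_
      refine (div_le_div_of_nonneg_right (Finset.abs_sum_le_sum_abs _ _) (by positivity)).trans ?_
      rw [Finset.sum_div]
      refine Finset.sum_le_sum fun l _ => ?_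
      rw [abs_mul]
      refine (div_le_div_of_nonneg_right (mul_le_mul_of_nonneg_left
        (abs_functional_monomial_mul_le e _ (hA i l)) (abs_nonneg _)) (by positivity)).trans ?_
      rw [Finset.mul_sum, Finset.sum_div]
      exact Finset.sum_le_sum fun α _ => le_of_eq (by ring)
  refine (Finset.sum_le_sum hpt).trans ?_
  rw [Finset.sum_add_distrib, ← Finset.mul_sum, Finset.sum_comm]
  have hdr : ∀ i, ∑ γ ∈ idxLE d (2 * L + S), ∑ α ∈ idxLE d S, |(pb i).coeff α| *
        ((γ i : ℝ) * |e (γ - Finsupp.single i 1 + α)| / (γ.degree.factorial : ℝ)) ≤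
      driftSum S (2 * L + 2 * S) pb * D := by
    intro i
    rw [Finset.sum_comm, driftSum, Finset.sum_mul]
    refine Finset.sum_le_sum fun α hα => ?_
    rw [mem_idxLE] at hα
    rw [← Finset.mul_sum, mul_assoc]
    refine mul_le_mul ?_ ?_ (Finset.sum_nonneg fun _ _ => by positivity) (norm_nonneg _)
    · exact PiLp.norm_apply_le (WithLp.toLp 2 fun i => (pb i).coeff α : Vec d) i
    · have := sum_drift_shift_le (J := 2 * L + S) (w := 2 * L + 2 * S) e α i (by omega)
      push_cast at this
      exact this
  have hdi : ∀ i l, ∑ γ ∈ idxLE d (2 * L + S), ∑ α ∈ idxLE d S,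
        |((pσ * pσ.transpose) i l).coeff α| *
        (|(γ i : ℝ) * ((γ l : ℝ) - if i = l then 1 else 0)| *
          |e (γ - Finsupp.single i 1 - Finsupp.single l 1 + α)| / (γ.degree.factorial : ℝ)) ≤
      diffusionSum S (2 * L + 2 * S) pσ * D := by
    intro i l
    rw [Finset.sum_comm, diffusionSum, Finset.sum_mul]
    refine Finset.sum_le_sum fun α hα => ?_
    rw [mem_idxLE] at hα
    rw [← Finset.mul_sum, mul_assoc]
    refine mul_le_mul ?_ ?_ (Finset.sum_nonneg fun _ _ => by positivity) (Real.sqrt_nonneg _)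
    · exact abs_entry_le_frob (Matrix.of fun i l =>
        MvPolynomial.coeff α ((pσ * pσ.transpose) i l)) i l
    · have := sum_diffusion_shift_le (J := 2 * L + S) (w := 2 * L + 2 * S) e α i l (by omega)
      push_cast at this
      exact this
  have hdr0 : 0 ≤ driftSum S (2 * L + 2 * S) pb := Finset.sum_nonneg fun _ _ => by positivity
  have h1 := Finset.sum_le_sum fun i (_ : i ∈ (Finset.univ : Finset (Fin d))) => hdr i
  have h2 : ∑ γ ∈ idxLE d (2 * L + S), ∑ i, ∑ l, ∑ α ∈ idxLE d S,
        |((pσ * pσ.transpose) i l).coeff α| *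
        (|(γ i : ℝ) * ((γ l : ℝ) - if i = l then 1 else 0)| *
          |e (γ - Finsupp.single i 1 - Finsupp.single l 1 + α)| / (γ.degree.factorial : ℝ)) ≤
      ∑ i : Fin d, ∑ l : Fin d, diffusionSum S (2 * L + 2 * S) pσ * D := by
    rw [Finset.sum_comm]
    refine Finset.sum_le_sum fun i _ => ?_
    rw [Finset.sum_comm]
    exact Finset.sum_le_sum fun l _ => hdi i l
  simp only [Finset.sum_const, Finset.card_univ, Fintype.card_fin, nsmul_eq_mul] at h1 h2
  -- The drift contributes d terms and the diffusion d² pairs; the common factor d² is used for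
  -- both.
  have h3 : (d : ℝ) ≤ (d : ℝ) ^ 2 := by
    exact_mod_cast Nat.le_self_pow two_ne_zero d
  have h4 := mul_le_mul_of_nonneg_right h3 (mul_nonneg hdr0 hD0)
  linarith

end WeightedNorm

/-! ### Second-order Taylor expansion of monomials along a parabola -/

section Taylor

variable {d : ℕ}

theorem eval_monomial_one (γ : Idx d) (x : Vec d) :
    MvPolynomial.eval (fun l => x l) (MvPolynomial.monomial γ 1) = mono γ x := by
  rw [MvPolynomial.eval_monomial, one_mul, mono, Finsupp.prod_fintype]
  simp

/-- First-order coefficient in `s` of `p (v + s A + s² B)`. -/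
def taylorOne (v A : Fin d → ℝ) (p : MvPolynomial (Fin d) ℝ) : ℝ :=
  ∑ i, A i * MvPolynomial.eval v (MvPolynomial.pderiv i p)

/-- Second-order coefficient in `s` of `p (v + s A + s² B)`. -/
def taylorTwo (v A B : Fin d → ℝ) (p : MvPolynomial (Fin d) ℝ) : ℝ :=
  ∑ i, B i * MvPolynomial.eval v (MvPolynomial.pderiv i p) +
    1 / 2 * ∑ i, ∑ l, A i * A l *
      MvPolynomial.eval v (MvPolynomial.pderiv l (MvPolynomial.pderiv i p))

theorem taylorOne_X_mul (v A : Fin d → ℝ) (i : Fin d) (p : MvPolynomial (Fin d) ℝ) :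
    taylorOne v A (MvPolynomial.X i * p) =
      v i * taylorOne v A p + A i * MvPolynomial.eval v p := by
  simp only [taylorOne, Derivation.leibniz, MvPolynomial.pderiv_X, smul_eq_mul, map_add, map_mul,
    MvPolynomial.eval_X, mul_add, Finset.sum_add_distrib, Finset.mul_sum]
  congr 1
  · exact Finset.sum_congr rfl fun j _ => by ring
  · rw [Finset.sum_eq_single i]
    · simp
    · intro j _ hj
      simp [hj.symm]
    · simp

theorem taylorTwo_X_mul (v A B : Fin d → ℝ) (i : Fin d) (p : MvPolynomial (Fin d) ℝ) :
    taylorTwo v A B (MvPolynomial.X i * p) =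
      v i * taylorTwo v A B p + A i * taylorOne v A p + B i * MvPolynomial.eval v p := by
  have h1 : ∀ j, A j * taylorOne v A (MvPolynomial.pderiv j (MvPolynomial.X i * p)) =
      v i * (A j * taylorOne v A (MvPolynomial.pderiv j p)) +
        A i * (A j * MvPolynomial.eval v (MvPolynomial.pderiv j p)) +
        if j = i then A i * taylorOne v A p else 0 := by
    intro j
    rw [Derivation.leibniz, MvPolynomial.pderiv_X]
    have hadd : ∀ p q, taylorOne v A (p + q) = taylorOne v A p + taylorOne v A q := by
      intro p q
      simp only [taylorOne, map_add, mul_add, Finset.sum_add_distrib]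
    rw [hadd, smul_eq_mul, smul_eq_mul, taylorOne_X_mul]
    split_ifs with hj
    · subst hj; simp; ring
    · have : taylorOne v A 0 = 0 := by simp [taylorOne]
      rw [Pi.single_eq_of_ne (Ne.symm hj), mul_zero, this]; ring
  have h2 : ∀ q, taylorTwo v A B q = taylorOne v B q +
      1 / 2 * ∑ j, A j * taylorOne v A (MvPolynomial.pderiv j q) := by
    intro q
    simp only [taylorTwo, taylorOne, Finset.mul_sum, mul_assoc]
  rw [h2, h2, taylorOne_X_mul, Finset.sum_congr rfl fun j _ => h1 j, Finset.sum_add_distrib,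
    Finset.sum_add_distrib, ← Finset.mul_sum, ← Finset.mul_sum, Finset.sum_ite_eq']
  simp only [Finset.mem_univ, if_true]
  rw [show ∑ j, A j * MvPolynomial.eval v (MvPolynomial.pderiv j p) = taylorOne v A p from rfl]
  ring

/-- Multiplication by one variable multiplies the sum of the absolute values of the three Taylor
coefficients and of the remainder bound ρ by at most |v_i| + |A_i| + |B_i|. Carrying this whole sum
through the induction yields M^n with no combinatorial factor in n or d. -/
theorem taylor_aux (v A B : Fin d → ℝ) {s M : ℝ} (hs0 : 0 ≤ s) (hs1 : s ≤ 1)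
    (hM : ∀ i, |v i| + |A i| + |B i| ≤ M) (n : ℕ) (γ : Idx d) (hγ : γ.degree = n) :
    ∃ ρ : ℝ, 0 ≤ ρ ∧
      |MvPolynomial.eval v (MvPolynomial.monomial γ 1)| +
        |taylorOne v A (MvPolynomial.monomial γ 1)| +
        |taylorTwo v A B (MvPolynomial.monomial γ 1)| + ρ ≤ M ^ n ∧
      |MvPolynomial.eval (fun i => v i + s * A i + s ^ 2 * B i) (MvPolynomial.monomial γ 1) -
        MvPolynomial.eval v (MvPolynomial.monomial γ 1) -
        s * taylorOne v A (MvPolynomial.monomial γ 1) -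
        s ^ 2 * taylorTwo v A B (MvPolynomial.monomial γ 1)| ≤ s ^ 3 * ρ := by
  induction n generalizing γ with
  | zero =>
    rw [Finsupp.degree_eq_zero_iff] at hγ
    subst hγ
    exact ⟨0, le_rfl, by simp [taylorOne, taylorTwo], by simp [taylorOne, taylorTwo]⟩
  | succ n ih =>
    obtain ⟨i, hi⟩ : ∃ i, γ i ≠ 0 := by
      by_contra! h
      have : γ = 0 := Finsupp.ext h
      simp [this] at hγ
    have hle : Finsupp.single i 1 ≤ γ := Finsupp.single_le_iff.2 (Nat.one_le_iff_ne_zero.2 hi)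
    obtain ⟨ρ, hρ, h1, h2⟩ := ih (γ - Finsupp.single i 1)
      (by rw [degree_sub_eq hle, Finsupp.degree_single]; omega)
    have hX : MvPolynomial.monomial γ (1 : ℝ) =
        MvPolynomial.X i * MvPolynomial.monomial (γ - Finsupp.single i 1) 1 := by
      rw [MvPolynomial.X, MvPolynomial.monomial_mul, add_tsub_cancel_of_le hle, one_mul]
    rw [hX, taylorOne_X_mul, taylorTwo_X_mul]
    simp only [map_mul, MvPolynomial.eval_X]
    set c0 := MvPolynomial.eval v (MvPolynomial.monomial (γ - Finsupp.single i 1) 1)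
    set c1 := taylorOne v A (MvPolynomial.monomial (γ - Finsupp.single i 1) 1)
    set c2 := taylorTwo v A B (MvPolynomial.monomial (γ - Finsupp.single i 1) 1)
    set E := MvPolynomial.eval (fun i => v i + s * A i + s ^ 2 * B i)
      (MvPolynomial.monomial (γ - Finsupp.single i 1) 1)
    -- The old remainder times the new variable, plus the products of order s³ and s⁴, namely c1
    -- B_i, c2 A_i and c2 B_i; s ≤ 1 lets the last one count as order s³.
    refine ⟨(|v i| + |A i| + |B i|) * ρ + (|c1| * |B i| + |c2| * |A i| + |c2| * |B i|),
      by positivity, ?_, ?_⟩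
    · have e0 : |v i * c0| = |v i| * |c0| := abs_mul _ _
      have e1 : |v i * c1 + A i * c0| ≤ |v i| * |c1| + |A i| * |c0| :=
        (abs_add_le _ _).trans_eq (by rw [abs_mul, abs_mul])
      have e2 : |v i * c2 + A i * c1 + B i * c0| ≤ |v i| * |c2| + |A i| * |c1| + |B i| * |c0| :=
        (abs_add_three _ _ _).trans_eq (by rw [abs_mul, abs_mul, abs_mul])
      have hM0 : 0 ≤ |v i| + |A i| + |B i| := by positivity
      have := mul_le_mul (hM i) h1 (by positivity) (hM0.trans (hM i))
      rw [pow_succ']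
      nlinarith
    · have e : (v i + s * A i + s ^ 2 * B i) * E - v i * c0 - s * (v i * c1 + A i * c0) -
          s ^ 2 * (v i * c2 + A i * c1 + B i * c0) =
          (v i + s * A i + s ^ 2 * B i) * (E - c0 - s * c1 - s ^ 2 * c2) +
          s ^ 3 * (c1 * B i + c2 * A i + s * (c2 * B i)) := by ring
      rw [e]
      have hs2 : s ^ 2 ≤ 1 := pow_le_one₀ hs0 hs1
      have f1 : |v i + s * A i + s ^ 2 * B i| ≤ |v i| + |A i| + |B i| := by
        refine (abs_add_three _ _ _).trans ?_
        rw [abs_mul, abs_mul, abs_of_nonneg hs0, abs_of_nonneg (sq_nonneg s)]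
        gcongr
        · exact mul_le_of_le_one_left (abs_nonneg _) hs1
        · exact mul_le_of_le_one_left (abs_nonneg _) hs2
      have f2 : |c1 * B i + c2 * A i + s * (c2 * B i)| ≤
          |c1| * |B i| + |c2| * |A i| + |c2| * |B i| := by
        refine (abs_add_three _ _ _).trans ?_
        rw [abs_mul, abs_mul, abs_mul, abs_mul, abs_of_nonneg hs0]
        exact add_le_add le_rfl (mul_le_of_le_one_left (by positivity) hs1)
      refine (abs_add_le _ _).trans ?_
      rw [abs_mul, abs_mul (s ^ 3), abs_of_nonneg (pow_nonneg hs0 3)]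
      have g1 := mul_le_mul f1 h2 (abs_nonneg _) (by positivity)
      have g2 := mul_le_mul_of_nonneg_left f2 (pow_nonneg hs0 3)
      linarith

/-- M^n ≤ n! e^M turns the bound of `taylor_aux` into |γ|! times a quantity independent of γ,
exactly what the weighted norm divides out. -/
theorem abs_taylor_remainder_le (v A B : Fin d → ℝ) {s M : ℝ} (hs0 : 0 ≤ s) (hs1 : s ≤ 1)
    (hM : ∀ i, |v i| + |A i| + |B i| ≤ M) (hM0 : 0 ≤ M) (γ : Idx d) :
    |MvPolynomial.eval (fun i => v i + s * A i + s ^ 2 * B i) (MvPolynomial.monomial γ 1) -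
        MvPolynomial.eval v (MvPolynomial.monomial γ 1) -
        s * taylorOne v A (MvPolynomial.monomial γ 1) -
        s ^ 2 * taylorTwo v A B (MvPolynomial.monomial γ 1)| ≤
      s ^ 3 * (γ.degree.factorial * Real.exp M) := by
  obtain ⟨ρ, hρ, h1, h2⟩ := taylor_aux v A B hs0 hs1 hM _ γ rfl
  refine h2.trans (mul_le_mul_of_nonneg_left ?_ (pow_nonneg hs0 3))
  have h3 : ρ ≤ M ^ γ.degree := le_trans (by
    have := abs_nonneg (MvPolynomial.eval v (MvPolynomial.monomial γ 1))
    have := abs_nonneg (taylorOne v A (MvPolynomial.monomial γ 1))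
    have := abs_nonneg (taylorTwo v A B (MvPolynomial.monomial γ 1))
    linarith) h1
  have h4 := Real.pow_div_factorial_le_exp M hM0 γ.degree
  rw [div_le_iff₀ (by positivity)] at h4
  linarith

theorem abs_mono_le {γ : Idx d} {x : Vec d} {M : ℝ} (hM : ∀ i, |x i| ≤ M) :
    |mono γ x| ≤ M ^ γ.degree := by
  rw [mono, Finset.abs_prod, Finsupp.degree_eq_sum, ← Finset.prod_pow_eq_pow_sum]
  refine Finset.prod_le_prod (fun _ _ => abs_nonneg _) fun i _ => ?_
  rw [abs_pow]
  exact pow_le_pow_left₀ (abs_nonneg _) (hM i) _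

theorem abs_mono_le_factorial_mul_exp {γ : Idx d} {x : Vec d} {M : ℝ} (hM0 : 0 ≤ M)
    (hM : ∀ i, |x i| ≤ M) : |mono γ x| ≤ γ.degree.factorial * Real.exp M := by
  have h4 := Real.pow_div_factorial_le_exp M hM0 γ.degree
  rw [div_le_iff₀ (by positivity)] at h4
  linarith [abs_mono_le (γ := γ) hM]

theorem abs_apply_le_norm (x : Vec d) (i : Fin d) : |x i| ≤ ‖x‖ := PiLp.norm_apply_le x i

theorem abs_mono_le_exp_norm (γ : Idx d) (x : Vec d) :
    |mono γ x| ≤ γ.degree.factorial * Real.exp ‖x‖ :=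
  abs_mono_le_factorial_mul_exp (norm_nonneg _) (abs_apply_le_norm x)

end Taylor

/-! ### Gaussian integrals, uniform in the dimension of the noise -/

section Gaussian

variable {d m : ℕ}

/-- The standard Gaussian measure on `ℝ^m`. -/
def stdNormal (m : ℕ) : Measure (Fin m → ℝ) := Measure.pi fun _ => gaussianReal 0 1

instance : IsProbabilityMeasure (stdNormal m) := by unfold stdNormal; infer_instance

/-- The Gaussian estimates below are reduced to this one-dimensional law. Its variance sees only
|θ|², which is why no constant depends on m. -/
theorem stdNormal_map_dotProduct (θ : Fin m → ℝ) :
    (stdNormal m).map (fun z => θ ⬝ᵥ z) = gaussianReal 0 (∑ j, θ j ^ 2).toNNReal := by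
  have h1 : (fun z : Fin m → ℝ => θ ⬝ᵥ z) =
      (innerSL ℝ (WithLp.toLp 2 θ : EuclideanSpace ℝ (Fin m))) ∘ WithLp.toLp 2 := by
    funext z
    simp [PiLp.inner_apply, dotProduct, mul_comm]
  rw [h1, stdNormal, ← Measure.map_map (by fun_prop) (by fun_prop), map_pi_eq_stdGaussian,
    IsGaussian.map_eq_gaussianReal, integral_strongDual_stdGaussian, variance_dual_stdGaussian,
    innerSL_apply_norm, EuclideanSpace.real_norm_sq_eq]

theorem measurable_dotProduct (θ : Fin m → ℝ) : Measurable fun z : Fin m → ℝ => θ ⬝ᵥ z := by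
  unfold dotProduct
  fun_prop

theorem integrable_exp_dotProduct (θ : Fin m → ℝ) :
    Integrable (fun z => Real.exp (θ ⬝ᵥ z)) (stdNormal m) := by
  have h := integrable_exp_mul_gaussianReal (μ := 0) (v := (∑ j, θ j ^ 2).toNNReal) 1
  rw [← stdNormal_map_dotProduct] at h
  simpa [Function.comp_def] using h.comp_measurable (measurable_dotProduct θ)

theorem integral_exp_dotProduct (θ : Fin m → ℝ) :
    ∫ z, Real.exp (θ ⬝ᵥ z) ∂stdNormal m = Real.exp ((∑ j, θ j ^ 2) / 2) := by
  have h := mgf_gaussianReal (stdNormal_map_dotProduct θ) 1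
  rw [mgf] at h
  simpa [Real.coe_toNNReal _ (Finset.sum_nonneg fun j _ => sq_nonneg (θ j))] using h

theorem integrable_exp_mul_sq_gaussianReal {t : ℝ} (ht : t ≤ 1 / 4) :
    Integrable (fun x => Real.exp (t * x ^ 2)) (gaussianReal 0 1) := by
  rw [gaussianReal_of_var_ne_zero _ one_ne_zero,
    integrable_withDensity_iff (measurable_gaussianPDF 0 1) (by simp [gaussianPDF])]
  have h := (integrable_exp_neg_mul_sq (b := 1 / 2 - t) (by linarith)).const_mul (√(2 * Real.pi))⁻¹
  refine h.congr (Filter.Eventually.of_forall fun x => ?_)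
  simp only [gaussianPDF, gaussianPDFReal]
  rw [ENNReal.toReal_ofReal (by positivity)]
  simp only [NNReal.coe_one, sub_zero, mul_one]
  rw [mul_left_comm, ← Real.exp_add]
  congr 2
  ring

theorem integral_exp_mul_sq_gaussianReal_le {t : ℝ} (ht0 : 0 ≤ t) (ht : t ≤ 1 / 4) :
    ∫ x, Real.exp (t * x ^ 2) ∂gaussianReal 0 1 ≤ Real.exp (2 * t) := by
  have h1 : ∫ x, Real.exp (t * x ^ 2) ∂gaussianReal 0 1 = √((1 - 2 * t)⁻¹) := by
    rw [integral_gaussianReal_eq_integral_smul one_ne_zero]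
    have : ∀ x : ℝ, gaussianPDFReal 0 1 x • Real.exp (t * x ^ 2) =
        (√(2 * Real.pi))⁻¹ * Real.exp (-(1 / 2 - t) * x ^ 2) := by
      intro x
      simp only [gaussianPDFReal, NNReal.coe_one, sub_zero, mul_one, smul_eq_mul]
      rw [mul_assoc, ← Real.exp_add]
      congr 2
      ring
    simp only [this]
    rw [integral_const_mul, integral_gaussian, ← Real.sqrt_inv, ← Real.sqrt_mul (by positivity)]
    congr 1
    have h1 : (1 - 2 * t) ≠ 0 := by linarith
    have h2 : (1 / 2 - t) ≠ 0 := by linarith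
    field_simp
  rw [h1, Real.sqrt_le_left (Real.exp_pos _).le, ← Real.exp_nat_mul]
  have h2 : 0 < 1 - 2 * t := by linarith
  -- (1 - 2t)(1 + 4t) = 1 + 2t(1 - 4t), which is at least 1 because 0 ≤ t ≤ 1/4.
  calc (1 - 2 * t)⁻¹ ≤ 1 + 4 * t := by
        rw [inv_le_iff_one_le_mul₀ h2]; nlinarith
    _ ≤ Real.exp (4 * t) := by linarith [Real.add_one_le_exp (4 * t)]
    _ = _ := by congr 1; push_cast; ring

theorem integral_exp_dotProduct_sq_le {s V : ℝ} (θ : Fin m → ℝ) (hs : 0 ≤ s)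
    (hV : ∑ j, θ j ^ 2 ≤ V) (hsV : s * V ≤ 1 / 4) :
    Integrable (fun z => Real.exp (s * (θ ⬝ᵥ z) ^ 2)) (stdNormal m) ∧
      ∫ z, Real.exp (s * (θ ⬝ᵥ z) ^ 2) ∂stdNormal m ≤ Real.exp (2 * s * V) := by
  set c := √(∑ j, θ j ^ 2) with hc
  have hc2 : c ^ 2 = ∑ j, θ j ^ 2 := Real.sq_sqrt (Finset.sum_nonneg fun j _ => sq_nonneg _)
  have hlaw : (stdNormal m).map (fun z => θ ⬝ᵥ z) = (gaussianReal 0 1).map (fun x => c * x) := by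
    rw [stdNormal_map_dotProduct, gaussianReal_map_const_mul, mul_zero]
    congr 1
    ext
    simp [hc2, Finset.sum_nonneg fun j (_ : j ∈ Finset.univ) => sq_nonneg (θ j)]
  have hm : Measurable fun x : ℝ => Real.exp (s * x ^ 2) := by fun_prop
  have ht : s * c ^ 2 ≤ s * V := by rw [hc2]; exact mul_le_mul_of_nonneg_left hV hs
  have hi := integrable_exp_mul_sq_gaussianReal (ht.trans hsV)
  have hb := integral_exp_mul_sq_gaussianReal_le (mul_nonneg hs (sq_nonneg c)) (ht.trans hsV)
  have he : ∀ x, s * (c * x) ^ 2 = s * c ^ 2 * x ^ 2 := fun x => by ring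
  constructor
  · have : Integrable (fun x : ℝ => Real.exp (s * x ^ 2)) ((stdNormal m).map (fun z => θ ⬝ᵥ z)) := by
      rw [hlaw, integrable_map_measure hm.aestronglyMeasurable (by fun_prop)]
      simpa only [Function.comp_def, he] using hi
    exact this.comp_measurable (measurable_dotProduct θ)
  · have h1 : ∫ z, Real.exp (s * (θ ⬝ᵥ z) ^ 2) ∂stdNormal m =
        ∫ x, Real.exp (s * x ^ 2) ∂(stdNormal m).map (fun z => θ ⬝ᵥ z) :=
      (integral_map (measurable_dotProduct θ).aemeasurable hm.aestronglyMeasurable).symm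
    rw [h1, hlaw, integral_map (by fun_prop) hm.aestronglyMeasurable]
    simp only [he]
    refine hb.trans (Real.exp_le_exp.2 ?_)
    linarith

theorem integral_dotProduct (θ : Fin m → ℝ) :
    Integrable (fun z => θ ⬝ᵥ z) (stdNormal m) ∧ ∫ z, θ ⬝ᵥ z ∂stdNormal m = 0 := by
  have hm := measurable_dotProduct θ
  constructor
  · have h := (memLp_id_gaussianReal (μ := 0) (v := (∑ j, θ j ^ 2).toNNReal) 1).integrable
      (by simp)
    rw [← stdNormal_map_dotProduct] at h
    exact h.comp_measurable hm
  · have h : ∫ z, θ ⬝ᵥ z ∂stdNormal m = ∫ x, x ∂(stdNormal m).map (fun z => θ ⬝ᵥ z) :=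
      (integral_map hm.aemeasurable aestronglyMeasurable_id).symm
    rw [h, stdNormal_map_dotProduct, integral_id_gaussianReal]

theorem integral_dotProduct_sq (θ : Fin m → ℝ) :
    Integrable (fun z => (θ ⬝ᵥ z) ^ 2) (stdNormal m) ∧
      ∫ z, (θ ⬝ᵥ z) ^ 2 ∂stdNormal m = ∑ j, θ j ^ 2 := by
  have hm := measurable_dotProduct θ
  constructor
  · have h := (memLp_id_gaussianReal (μ := 0) (v := (∑ j, θ j ^ 2).toNNReal) 2).integrable_sq
    rw [← stdNormal_map_dotProduct] at h
    exact h.comp_measurable hm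
  · have h : ∫ z, (θ ⬝ᵥ z) ^ 2 ∂stdNormal m = ∫ x, x ^ 2 ∂(stdNormal m).map (fun z => θ ⬝ᵥ z) :=
      (integral_map hm.aemeasurable (continuous_pow 2).aestronglyMeasurable).symm
    have hv := variance_fun_id_gaussianReal (μ := 0) (v := (∑ j, θ j ^ 2).toNNReal)
    rw [variance_of_integral_eq_zero (by fun_prop) integral_id_gaussianReal] at hv
    rw [h, stdNormal_map_dotProduct, hv,
      Real.coe_toNNReal _ (Finset.sum_nonneg fun j _ => sq_nonneg _)]

theorem integral_dotProduct_mul_dotProduct (θ ψ : Fin m → ℝ) :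
    Integrable (fun z => (θ ⬝ᵥ z) * (ψ ⬝ᵥ z)) (stdNormal m) ∧
      ∫ z, (θ ⬝ᵥ z) * (ψ ⬝ᵥ z) ∂stdNormal m = θ ⬝ᵥ ψ := by
  obtain ⟨i1, e1⟩ := integral_dotProduct_sq (θ + ψ)
  obtain ⟨i2, e2⟩ := integral_dotProduct_sq θ
  obtain ⟨i3, e3⟩ := integral_dotProduct_sq ψ
  have h : (fun z => (θ ⬝ᵥ z) * (ψ ⬝ᵥ z)) =
      fun z => 1 / 2 * (((θ + ψ) ⬝ᵥ z) ^ 2 - (θ ⬝ᵥ z) ^ 2 - (ψ ⬝ᵥ z) ^ 2) := by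
    funext z
    rw [add_dotProduct]
    ring
  rw [h]
  have i12 : Integrable (fun z => ((θ + ψ) ⬝ᵥ z) ^ 2 - (θ ⬝ᵥ z) ^ 2) (stdNormal m) := i1.sub i2
  refine ⟨(i12.sub i3).const_mul _, ?_⟩
  rw [integral_const_mul, integral_sub i12 i3, integral_sub i1 i2, e1, e2, e3,
    ← Finset.sum_sub_distrib, ← Finset.sum_sub_distrib, Finset.mul_sum]
  exact Finset.sum_congr rfl fun j _ => by simp only [Pi.add_apply]; ring

theorem norm_toLp_sq (x : Fin d → ℝ) : ‖(WithLp.toLp 2 x : Vec d)‖ ^ 2 = ∑ i, x i ^ 2 := by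
  rw [EuclideanSpace.real_norm_sq_eq]

/-- By Jensen, the exponential of s ∑_i (A_i·z)² is at most the average over the d rows of exp(s d
(A_i·z)²), and each row is a scalar Gaussian. The price is the factor d in the smallness condition
and in the exponent. -/
theorem integral_exp_mulVec_sq_le {s V : ℝ} (A : Matrix (Fin d) (Fin m) ℝ) (hs : 0 ≤ s)
    (hV : ∑ i, ∑ j, A i j ^ 2 ≤ V) (hsV : s * d * V ≤ 1 / 4) :
    Integrable (fun z => Real.exp (s * ‖(WithLp.toLp 2 (A.mulVec z) : Vec d)‖ ^ 2)) (stdNormal m) ∧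
      ∫ z, Real.exp (s * ‖(WithLp.toLp 2 (A.mulVec z) : Vec d)‖ ^ 2) ∂stdNormal m ≤
        Real.exp (2 * s * d * V) := by
  rcases Nat.eq_zero_or_pos d with rfl | hd
  · simp [norm_toLp_sq]
  have hd' : (0 : ℝ) < d := by exact_mod_cast hd
  have hrow : ∀ i, ∑ j, A i j ^ 2 ≤ V := fun i =>
    (Finset.single_le_sum (f := fun i => ∑ j, A i j ^ 2)
      (fun _ _ => Finset.sum_nonneg fun _ _ => sq_nonneg _) (Finset.mem_univ i)).trans hV
  have hi := fun i => integral_exp_dotProduct_sq_le (s := s * d) (A i) (by positivity) (hrow i) hsV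
  have hpt : ∀ z : Fin m → ℝ, Real.exp (s * ‖(WithLp.toLp 2 (A.mulVec z) : Vec d)‖ ^ 2) ≤
      ∑ i, (d : ℝ)⁻¹ * Real.exp (s * d * (A i ⬝ᵥ z) ^ 2) := by
    intro z
    have := convexOn_exp.map_sum_le (t := Finset.univ) (w := fun _ : Fin d => (d : ℝ)⁻¹)
      (p := fun i => s * d * (A i ⬝ᵥ z) ^ 2) (fun _ _ => by positivity)
      (by simp [hd'.ne']) (fun _ _ => Set.mem_univ _)
    simp only [smul_eq_mul] at this
    refine le_trans (le_of_eq ?_) this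
    congr 1
    rw [norm_toLp_sq, Finset.mul_sum]
    refine Finset.sum_congr rfl fun i _ => ?_
    rw [Matrix.mulVec]
    field_simp
  have hint : Integrable (fun z => ∑ i, (d : ℝ)⁻¹ * Real.exp (s * d * (A i ⬝ᵥ z) ^ 2))
      (stdNormal m) := integrable_finsetSum _ fun i _ => (hi i).1.const_mul _
  have hmeas : Measurable fun z : Fin m → ℝ =>
      Real.exp (s * ‖(WithLp.toLp 2 (A.mulVec z) : Vec d)‖ ^ 2) := by
    have : Continuous fun z : Fin m → ℝ => A.mulVec z := by fun_prop
    fun_prop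
  have hI : Integrable (fun z => Real.exp (s * ‖(WithLp.toLp 2 (A.mulVec z) : Vec d)‖ ^ 2))
      (stdNormal m) := by
    refine hint.mono' hmeas.aestronglyMeasurable (Filter.Eventually.of_forall fun z => ?_)
    rw [Real.norm_eq_abs, Real.abs_exp]
    exact hpt z
  refine ⟨hI, (integral_mono hI hint hpt).trans ?_⟩
  rw [integral_finsetSum _ fun i _ => (hi i).1.const_mul _]
  calc _ ≤ ∑ i : Fin d, (d : ℝ)⁻¹ * Real.exp (2 * (s * d) * V) := by
        refine Finset.sum_le_sum fun i _ => ?_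
        rw [integral_const_mul]
        exact mul_le_mul_of_nonneg_left (hi i).2 (by positivity)
    _ = _ := by
        simp only [Finset.sum_const, Finset.card_univ, Fintype.card_fin, nsmul_eq_mul]
        rw [mul_inv_cancel_left₀ hd'.ne']
        congr 1
        ring

theorem measurable_norm_mulVec (A : Matrix (Fin d) (Fin m) ℝ) :
    Measurable fun z : Fin m → ℝ => ‖(WithLp.toLp 2 (A.mulVec z) : Vec d)‖ := by
  have : Continuous fun z : Fin m → ℝ => A.mulVec z := by fun_prop
  fun_prop

theorem integral_exp_two_mul_norm_mulVec_le {V : ℝ} (A : Matrix (Fin d) (Fin m) ℝ)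
    (hV : ∑ i, ∑ j, A i j ^ 2 ≤ V) :
    Integrable (fun z => Real.exp (2 * ‖(WithLp.toLp 2 (A.mulVec z) : Vec d)‖)) (stdNormal m) ∧
      ∫ z, Real.exp (2 * ‖(WithLp.toLp 2 (A.mulVec z) : Vec d)‖) ∂stdNormal m ≤
        Real.exp (4 * (d * V + 1) + 1) := by
  have hV0 : 0 ≤ V := (Finset.sum_nonneg fun _ _ => Finset.sum_nonneg fun _ _ => sq_nonneg _).trans hV
  -- The linear exponent is absorbed by 2x ≤ 1/s + s x². This s meets s d V ≤ 1/4, and the +1 keeps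
  -- it finite when d V = 0.
  set s := (4 * (d * V + 1))⁻¹ with hs
  have hD : 0 < 4 * (d * V + 1) := by positivity
  have hs0 : 0 < s := inv_pos.2 hD
  have hsV : s * d * V ≤ 1 / 4 := by
    rw [mul_assoc, hs, inv_mul_le_iff₀ hD]; linarith
  obtain ⟨h1, h2⟩ := integral_exp_mulVec_sq_le A hs0.le hV hsV
  have hpt : ∀ z : Fin m → ℝ, Real.exp (2 * ‖(WithLp.toLp 2 (A.mulVec z) : Vec d)‖) ≤
      Real.exp (4 * (d * V + 1)) *
        Real.exp (s * ‖(WithLp.toLp 2 (A.mulVec z) : Vec d)‖ ^ 2) := by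
    intro z
    rw [← Real.exp_add, Real.exp_le_exp]
    set x := ‖(WithLp.toLp 2 (A.mulVec z) : Vec d)‖
    have h3 : 4 * (d * V + 1) * s = 1 := mul_inv_cancel₀ hD.ne'
    nlinarith [mul_nonneg hs0.le (sq_nonneg (x - 4 * (d * V + 1)))]
  have hint := h1.const_mul (Real.exp (4 * (d * V + 1)))
  have hI : Integrable (fun z => Real.exp (2 * ‖(WithLp.toLp 2 (A.mulVec z) : Vec d)‖))
      (stdNormal m) := by
    refine hint.mono' ((measurable_norm_mulVec A).const_mul 2).exp.aestronglyMeasurable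
      (Filter.Eventually.of_forall fun z => ?_)
    rw [Real.norm_eq_abs, Real.abs_exp]
    exact hpt z
  refine ⟨hI, (integral_mono hI hint hpt).trans ?_⟩
  rw [integral_const_mul, Real.exp_add]
  refine mul_le_mul_of_nonneg_left (h2.trans (Real.exp_le_exp.2 ?_)) (Real.exp_pos _).le
  linarith

/-- Expanding the square leaves a term linear in z and a quadratic one, separated by e^{u+w} ≤
(e^{2u} + e^{2w})/2. The linear term is a scalar Gaussian of variance at most (2aq)² V |y|², so the
coefficient of |y|² is free of d; the dimension enters only the additive constant. This is what
makes δ_* independent of d. -/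
theorem integral_exp_norm_add_mulVec_sq_le {a q V : ℝ} (A : Matrix (Fin d) (Fin m) ℝ) (y : Vec d)
    (ha : 0 ≤ a) (hV : ∑ i, ∑ j, A i j ^ 2 ≤ V) (hqV : 2 * a * q ^ 2 * d * V ≤ 1 / 4) :
    Integrable (fun z => Real.exp (a * ‖y + q • (WithLp.toLp 2 (A.mulVec z) : Vec d)‖ ^ 2))
      (stdNormal m) ∧
    ∫ z, Real.exp (a * ‖y + q • (WithLp.toLp 2 (A.mulVec z) : Vec d)‖ ^ 2) ∂stdNormal m ≤
      Real.exp (a * ‖y‖ ^ 2 + 4 * a ^ 2 * q ^ 2 * V * ‖y‖ ^ 2 + 2 * a * q ^ 2 * d * V) := by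
  set θ : Fin m → ℝ := fun j => ∑ i, y i * A i j with hθ
  have hθy : ∑ j, θ j ^ 2 ≤ V * ‖y‖ ^ 2 := by
    calc ∑ j, θ j ^ 2 ≤ ∑ j, (∑ i, y i ^ 2) * ∑ i, A i j ^ 2 :=
          Finset.sum_le_sum fun j _ => Finset.sum_mul_sq_le_sq_mul_sq _ _ _
      _ = ‖y‖ ^ 2 * ∑ i, ∑ j, A i j ^ 2 := by
          rw [← Finset.mul_sum, Finset.sum_comm, EuclideanSpace.real_norm_sq_eq]
      _ ≤ _ := by rw [mul_comm]; gcongr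
  have hexp : ∀ z : Fin m → ℝ, a * ‖y + q • (WithLp.toLp 2 (A.mulVec z) : Vec d)‖ ^ 2 =
      a * ‖y‖ ^ 2 + 2 * a * q * (θ ⬝ᵥ z) +
        a * q ^ 2 * ‖(WithLp.toLp 2 (A.mulVec z) : Vec d)‖ ^ 2 := by
    intro z
    have hin : inner ℝ y (WithLp.toLp 2 (A.mulVec z) : Vec d) = θ ⬝ᵥ z := by
      simp only [PiLp.inner_apply, RCLike.inner_apply, conj_trivial, hθ, dotProduct, Matrix.mulVec,
        Finset.sum_mul]
      rw [Finset.sum_comm]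
      exact Finset.sum_congr rfl fun i _ => Finset.sum_congr rfl fun j _ => by ring
    rw [norm_add_sq_real, inner_smul_right, hin, norm_smul, mul_pow, Real.norm_eq_abs, sq_abs]
    ring
  set ψ : Fin m → ℝ := (4 * a * q) • θ with hψ
  obtain ⟨i2, e2⟩ := integral_exp_mulVec_sq_le A (s := 2 * a * q ^ 2) (by positivity) hV hqV
  have i1 := integrable_exp_dotProduct ψ
  have e1 := integral_exp_dotProduct ψ
  -- α and β centre the two parts: with them subtracted, the doubled exponentials e^{2u} and e^{2w}
  -- both have expectation at most 1.
  set α := (∑ j, ψ j ^ 2) / 4 with hα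
  set β := 2 * a * q ^ 2 * d * V with hβ
  have hα' : α ≤ 4 * a ^ 2 * q ^ 2 * V * ‖y‖ ^ 2 := by
    have : ∑ j, ψ j ^ 2 = (4 * a * q) ^ 2 * ∑ j, θ j ^ 2 := by
      rw [Finset.mul_sum]
      exact Finset.sum_congr rfl fun j _ => by simp only [hψ, Pi.smul_apply, smul_eq_mul]; ring
    rw [hα, this]
    nlinarith [mul_le_mul_of_nonneg_left hθy (sq_nonneg (a * q))]
  have hpt : ∀ z : Fin m → ℝ,
      Real.exp (a * ‖y + q • (WithLp.toLp 2 (A.mulVec z) : Vec d)‖ ^ 2) ≤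
      Real.exp (a * ‖y‖ ^ 2 + α + β) * (1 / 2 * (Real.exp (-(2 * α)) * Real.exp (ψ ⬝ᵥ z) +
        Real.exp (-(2 * β)) *
          Real.exp (2 * a * q ^ 2 * ‖(WithLp.toLp 2 (A.mulVec z) : Vec d)‖ ^ 2))) := by
    intro z
    rw [hexp]
    set x := ‖(WithLp.toLp 2 (A.mulVec z) : Vec d)‖
    have h1 : ψ ⬝ᵥ z = 4 * a * q * (θ ⬝ᵥ z) := by rw [hψ, smul_dotProduct, smul_eq_mul]
    rw [h1, ← Real.exp_add, ← Real.exp_add]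
    set u := 2 * a * q * (θ ⬝ᵥ z) - α with hu
    set w := a * q ^ 2 * x ^ 2 - β with hw
    rw [show a * ‖y‖ ^ 2 + 2 * a * q * (θ ⬝ᵥ z) + a * q ^ 2 * x ^ 2 =
        (a * ‖y‖ ^ 2 + α + β) + (u + w) by rw [hu, hw]; ring,
      show -(2 * α) + 4 * a * q * (θ ⬝ᵥ z) = u + u by rw [hu]; ring,
      show -(2 * β) + 2 * a * q ^ 2 * x ^ 2 = w + w by rw [hw]; ring,
      Real.exp_add _ (u + w)]
    refine mul_le_mul_of_nonneg_left ?_ (Real.exp_pos _).le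
    rw [Real.exp_add, Real.exp_add, Real.exp_add]
    nlinarith [sq_nonneg (Real.exp u - Real.exp w)]
  have hint := (((i1.const_mul (Real.exp (-(2 * α)))).add
    (i2.const_mul (Real.exp (-(2 * β))))).const_mul (1 / 2)).const_mul
      (Real.exp (a * ‖y‖ ^ 2 + α + β))
  have hmeas : Measurable fun z : Fin m → ℝ =>
      Real.exp (a * ‖y + q • (WithLp.toLp 2 (A.mulVec z) : Vec d)‖ ^ 2) := by
    have : Continuous fun z : Fin m → ℝ => A.mulVec z := by fun_prop
    fun_prop
  have hI : Integrable (fun z =>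
      Real.exp (a * ‖y + q • (WithLp.toLp 2 (A.mulVec z) : Vec d)‖ ^ 2)) (stdNormal m) := by
    refine hint.mono' hmeas.aestronglyMeasurable (Filter.Eventually.of_forall fun z => ?_)
    rw [Real.norm_eq_abs, Real.abs_exp]
    exact hpt z
  refine ⟨hI, (integral_mono hI hint hpt).trans ?_⟩
  simp only [Pi.add_apply]
  rw [integral_const_mul, integral_const_mul,
    integral_add (i1.const_mul _) (i2.const_mul _), integral_const_mul, integral_const_mul, e1]
  have h1 : Real.exp (-(2 * α)) * Real.exp ((∑ j, ψ j ^ 2) / 2) = 1 := by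
    rw [← Real.exp_add, hα]; ring_nf; exact Real.exp_zero
  have h2 : Real.exp (-(2 * β)) * ∫ z, Real.exp (2 * a * q ^ 2 *
      ‖(WithLp.toLp 2 (A.mulVec z) : Vec d)‖ ^ 2) ∂stdNormal m ≤ 1 := by
    refine (mul_le_mul_of_nonneg_left e2 (Real.exp_pos _).le).trans_eq ?_
    rw [← Real.exp_add, hβ]; ring_nf; exact Real.exp_zero
  calc _ ≤ Real.exp (a * ‖y‖ ^ 2 + α + β) * 1 :=
        mul_le_mul_of_nonneg_left (by linarith) (Real.exp_pos _).le
    _ ≤ _ := by rw [mul_one, Real.exp_le_exp]; linarith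

end Gaussian

/-! ### One step of the scheme from a fixed state -/

section OneStep

variable {d m : ℕ}

/-- One untruncated step `v + p_b(v) h + p_σ(v) z √h`. -/
def eulerStep (pb : Fin d → MvPolynomial (Fin d) ℝ)
    (pσ : Matrix (Fin d) (Fin m) (MvPolynomial (Fin d) ℝ)) (h : ℝ) (v : Vec d)
    (z : Fin m → ℝ) : Vec d :=
  v + h • evalVec pb v + √h • WithLp.toLp 2 ((evalMat pσ v).mulVec z)

variable {pb : Fin d → MvPolynomial (Fin d) ℝ}
  {pσ : Matrix (Fin d) (Fin m) (MvPolynomial (Fin d) ℝ)}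

theorem eulerStep_apply (h : ℝ) (v : Vec d) (z : Fin m → ℝ) (i : Fin d) :
    eulerStep pb pσ h v z i =
      v i + h * MvPolynomial.eval (fun l => v l) (pb i) + √h * (evalMat pσ v i ⬝ᵥ z) := by
  simp [eulerStep, evalVec, Matrix.mulVec]

theorem continuous_eval (p : MvPolynomial (Fin d) ℝ) :
    Continuous fun v : Vec d => MvPolynomial.eval (fun l => v l) p :=
  (MvPolynomial.continuous_eval p).comp (by fun_prop)

theorem continuous_eulerStep (h : ℝ) :
    Continuous fun q : Vec d × (Fin m → ℝ) => eulerStep pb pσ h q.1 q.2 := by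
  have : Continuous fun q : Vec d × (Fin m → ℝ) => fun i => eulerStep pb pσ h q.1 q.2 i := by
    refine continuous_pi fun i => ?_
    simp only [eulerStep_apply, dotProduct, evalMat, Matrix.of_apply]
    have h1 := (continuous_eval (pb i)).comp (continuous_fst (X := Vec d) (Y := Fin m → ℝ))
    have h2 := fun j => (continuous_eval (pσ i j)).comp (continuous_fst (X := Vec d) (Y := Fin m → ℝ))
    simp only [Function.comp_def] at h1 h2
    fun_prop
  exact (PiLp.continuous_toLp 2 _).comp this

theorem continuous_mono (γ : Idx d) : Continuous (mono γ) := by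
  unfold mono
  fun_prop

theorem norm_eulerStep_le {h β : ℝ} (h0 : 0 ≤ h) (h1 : h ≤ 1) {v : Vec d}
    (hβ : ‖evalVec pb v‖ ≤ β) (z : Fin m → ℝ) :
    ‖eulerStep pb pσ h v z‖ ≤
      ‖v‖ + β + ‖(WithLp.toLp 2 ((evalMat pσ v).mulVec z) : Vec d)‖ := by
  refine (norm_add₃_le).trans ?_
  rw [norm_smul, norm_smul, Real.norm_of_nonneg h0, Real.norm_of_nonneg (Real.sqrt_nonneg h)]
  have h2 : √h ≤ 1 := Real.sqrt_le_one.2 h1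
  gcongr
  · exact (mul_le_of_le_one_left (norm_nonneg _) h1).trans hβ
  · exact mul_le_of_le_one_left (norm_nonneg _) h2

theorem integral_exp_two_mul_norm_eulerStep_le {h β V : ℝ} (h0 : 0 ≤ h) (h1 : h ≤ 1) {v : Vec d}
    (hβ : ‖evalVec pb v‖ ≤ β) (hV : ∑ i, ∑ j, evalMat pσ v i j ^ 2 ≤ V) :
    Integrable (fun z => Real.exp (2 * ‖eulerStep pb pσ h v z‖)) (stdNormal m) ∧
    ∫ z, Real.exp (2 * ‖eulerStep pb pσ h v z‖) ∂stdNormal m ≤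
      Real.exp (2 * (‖v‖ + β) + (4 * (d * V + 1) + 1)) := by
  obtain ⟨i1, e1⟩ := integral_exp_two_mul_norm_mulVec_le (evalMat pσ v) hV
  have hpt : ∀ z : Fin m → ℝ, Real.exp (2 * ‖eulerStep pb pσ h v z‖) ≤
      Real.exp (2 * (‖v‖ + β)) *
        Real.exp (2 * ‖(WithLp.toLp 2 ((evalMat pσ v).mulVec z) : Vec d)‖) := by
    intro z
    rw [← Real.exp_add, Real.exp_le_exp]
    linarith [norm_eulerStep_le (pσ := pσ) h0 h1 hβ z]
  have hint := i1.const_mul (Real.exp (2 * (‖v‖ + β)))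
  have hc : Continuous fun z : Fin m → ℝ => eulerStep pb pσ h v z :=
    (continuous_eulerStep h).comp (by fun_prop : Continuous fun z : Fin m → ℝ => (v, z))
  have hI : Integrable (fun z => Real.exp (2 * ‖eulerStep pb pσ h v z‖)) (stdNormal m) := by
    refine hint.mono' (by fun_prop) (Filter.Eventually.of_forall fun z => ?_)
    rw [Real.norm_eq_abs, Real.abs_exp]
    exact hpt z
  refine ⟨hI, (integral_mono hI hint hpt).trans ?_⟩
  rw [integral_const_mul, Real.exp_add]
  exact mul_le_mul_of_nonneg_left e1 (Real.exp_pos _).le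

theorem integral_taylorOne (v : Fin d → ℝ) (A : Matrix (Fin d) (Fin m) ℝ)
    (p : MvPolynomial (Fin d) ℝ) :
    Integrable (fun z => taylorOne v (fun i => A i ⬝ᵥ z) p) (stdNormal m) ∧
      ∫ z, taylorOne v (fun i => A i ⬝ᵥ z) p ∂stdNormal m = 0 := by
  unfold taylorOne
  have hi := fun i => (integral_dotProduct (A i)).1.mul_const
    (MvPolynomial.eval v (MvPolynomial.pderiv i p))
  refine ⟨integrable_finsetSum _ fun i _ => hi i, ?_⟩
  rw [integral_finsetSum _ fun i _ => hi i]
  refine Finset.sum_eq_zero fun i _ => ?_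
  rw [integral_mul_const, (integral_dotProduct (A i)).2, zero_mul]

theorem integral_taylorTwo (v B : Fin d → ℝ) (A : Matrix (Fin d) (Fin m) ℝ)
    (p : MvPolynomial (Fin d) ℝ) :
    Integrable (fun z => taylorTwo v (fun i => A i ⬝ᵥ z) B p) (stdNormal m) ∧
      ∫ z, taylorTwo v (fun i => A i ⬝ᵥ z) B p ∂stdNormal m =
        ∑ i, B i * MvPolynomial.eval v (MvPolynomial.pderiv i p) +
          1 / 2 * ∑ i, ∑ l, (A i ⬝ᵥ A l) *
            MvPolynomial.eval v (MvPolynomial.pderiv l (MvPolynomial.pderiv i p)) := by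
  unfold taylorTwo
  have hi := fun i l => (integral_dotProduct_mul_dotProduct (A i) (A l)).1.mul_const
    (MvPolynomial.eval v (MvPolynomial.pderiv l (MvPolynomial.pderiv i p)))
  have hi' := fun i => integrable_finsetSum Finset.univ fun l _ => hi i l
  have hi2 := (integrable_finsetSum Finset.univ fun i _ => hi' i).const_mul (1 / 2)
  refine ⟨(integrable_const _).add hi2, ?_⟩
  rw [integral_add (integrable_const _) hi2, integral_const_mul, integral_const,
    integral_finsetSum _ fun i _ => hi' i, probReal_univ, one_smul]
  congr 2
  refine Finset.sum_congr rfl fun i _ => ?_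
  rw [integral_finsetSum _ fun l _ => hi i l]
  refine Finset.sum_congr rfl fun l _ => ?_
  rw [integral_mul_const, (integral_dotProduct_mul_dotProduct (A i) (A l)).2]

theorem eval_genPoly (v : Fin d → ℝ) (p : MvPolynomial (Fin d) ℝ) :
    MvPolynomial.eval v (genPoly pb pσ p) =
      ∑ i, MvPolynomial.eval v (pb i) * MvPolynomial.eval v (MvPolynomial.pderiv i p) +
        1 / 2 * ∑ i, ∑ l, ((fun j => MvPolynomial.eval v (pσ i j)) ⬝ᵥ
          (fun j => MvPolynomial.eval v (pσ l j))) *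
            MvPolynomial.eval v (MvPolynomial.pderiv l (MvPolynomial.pderiv i p)) := by
  simp only [genPoly, map_add, map_sum, map_mul, MvPolynomial.smul_eval, Matrix.mul_apply,
    Matrix.transpose_apply, dotProduct]
  congr 1
  · exact Finset.sum_congr rfl fun i _ => mul_comm _ _
  · congr 1
    exact Finset.sum_congr rfl fun i _ => Finset.sum_congr rfl fun l _ => mul_comm _ _

/-- Weak local error of one untruncated step on monomials. -/
theorem abs_integral_mono_eulerStep_sub_le {h β V : ℝ} (h0 : 0 ≤ h) (h1 : h ≤ 1) {v : Vec d}
    (hβ : ‖evalVec pb v‖ ≤ β) (hV : ∑ i, ∑ j, evalMat pσ v i j ^ 2 ≤ V) (γ : Idx d) :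
    |∫ z, mono γ (eulerStep pb pσ h v z) ∂stdNormal m - mono γ v -
        h * MvPolynomial.eval (fun l => v l) (genPoly pb pσ (MvPolynomial.monomial γ 1))| ≤
      √h ^ 3 * (γ.degree.factorial * Real.exp (‖v‖ + β + (4 * (d * V + 1) + 1))) := by
  set A := evalMat pσ v with hA
  -- In powers of s the noise has order 1 and the drift order 2. The first-order term has mean zero,
  -- the second-order one has mean G x^γ, and the remainder is of order s³; a sharper order in h is
  -- not needed.
  set s := √h with hs
  have hs0 : 0 ≤ s := Real.sqrt_nonneg h
  have hs1 : s ≤ 1 := Real.sqrt_le_one.2 h1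
  have hs2 : s ^ 2 = h := Real.sq_sqrt h0
  set v' : Fin d → ℝ := fun l => v l with hv'
  set B : Fin d → ℝ := fun i => MvPolynomial.eval v' (pb i) with hB
  set p : MvPolynomial (Fin d) ℝ := MvPolynomial.monomial γ 1 with hp
  obtain ⟨it1, et1⟩ := integral_taylorOne v' A p
  obtain ⟨it2, et2⟩ := integral_taylorTwo v' B A p
  have hgen : MvPolynomial.eval v' (genPoly pb pσ p) =
      ∫ z, taylorTwo v' (fun i => A i ⬝ᵥ z) B p ∂stdNormal m := by
    rw [et2, eval_genPoly]
    rfl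
  have hY : ∀ z : Fin m → ℝ, mono γ (eulerStep pb pσ h v z) =
      MvPolynomial.eval (fun i => v' i + s * (A i ⬝ᵥ z) + s ^ 2 * B i) p := by
    intro z
    rw [← eval_monomial_one]
    congr 2
    funext i
    rw [eulerStep_apply, hs2]
    ring
  obtain ⟨iE, eE⟩ := integral_exp_two_mul_norm_mulVec_le A hV
  have hc : Continuous fun z : Fin m → ℝ => eulerStep pb pσ h v z :=
    (continuous_eulerStep h).comp (by fun_prop : Continuous fun z : Fin m → ℝ => (v, z))
  have hrem : ∀ z : Fin m → ℝ,
      |mono γ (eulerStep pb pσ h v z) - mono γ v - s * taylorOne v' (fun i => A i ⬝ᵥ z) p -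
        s ^ 2 * taylorTwo v' (fun i => A i ⬝ᵥ z) B p| ≤
      s ^ 3 * (γ.degree.factorial * Real.exp (‖v‖ + β)) *
        Real.exp (2 * ‖(WithLp.toLp 2 (A.mulVec z) : Vec d)‖) := by
    intro z
    set x := ‖(WithLp.toLp 2 (A.mulVec z) : Vec d)‖ with hx
    rw [hY, ← eval_monomial_one]
    have hM : ∀ i, |v' i| + |A i ⬝ᵥ z| + |B i| ≤ ‖v‖ + x + β := by
      intro i
      refine add_le_add (add_le_add (abs_apply_le_norm v i) ?_) ?_
      · exact abs_apply_le_norm (WithLp.toLp 2 (A.mulVec z) : Vec d) i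
      · exact (abs_apply_le_norm (evalVec pb v) i).trans hβ
    have hβ0 : 0 ≤ β := (norm_nonneg _).trans hβ
    refine (abs_taylor_remainder_le v' _ B hs0 hs1 hM (by positivity) γ).trans ?_
    rw [mul_assoc (s ^ 3), mul_assoc, ← Real.exp_add]
    refine mul_le_mul_of_nonneg_left (mul_le_mul_of_nonneg_left (Real.exp_le_exp.2 ?_)
      (Nat.cast_nonneg _)) (pow_nonneg hs0 3)
    linarith [norm_nonneg (WithLp.toLp 2 (A.mulVec z) : Vec d)]
  have hYint : Integrable (fun z => mono γ (eulerStep pb pσ h v z)) (stdNormal m) := by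
    obtain ⟨i1, -⟩ := integral_exp_two_mul_norm_eulerStep_le (pσ := pσ) h0 h1 hβ hV
    refine (i1.const_mul (γ.degree.factorial : ℝ)).mono'
      ((continuous_mono γ).comp hc).aestronglyMeasurable (Filter.Eventually.of_forall fun z => ?_)
    rw [Real.norm_eq_abs]
    refine (abs_mono_le_exp_norm γ _).trans ?_
    gcongr
    linarith [norm_nonneg (eulerStep pb pσ h v z)]
  have i1 := hYint.sub (integrable_const (mono γ v))
  have i2 := i1.sub (it1.const_mul s)
  have e : ∫ z, mono γ (eulerStep pb pσ h v z) ∂stdNormal m - mono γ v -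
      h * MvPolynomial.eval v' (genPoly pb pσ p) =
      ∫ z, (mono γ (eulerStep pb pσ h v z) - mono γ v -
        s * taylorOne v' (fun i => A i ⬝ᵥ z) p -
        s ^ 2 * taylorTwo v' (fun i => A i ⬝ᵥ z) B p) ∂stdNormal m := by
    have f1 := integral_sub i2 (it2.const_mul (s ^ 2))
    have f2 := integral_sub i1 (it1.const_mul s)
    have f3 := integral_sub hYint (integrable_const (μ := stdNormal m) (mono γ v))
    simp only [Pi.sub_apply] at f1 f2 f3
    rw [f1, f2, f3, integral_const_mul, integral_const_mul, et1, ← hgen, hs2, integral_const,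
      probReal_univ, one_smul]
    ring
  rw [e]
  refine (abs_integral_le_integral_abs).trans ?_
  calc _ ≤ ∫ z, s ^ 3 * (γ.degree.factorial * Real.exp (‖v‖ + β)) *
        Real.exp (2 * ‖(WithLp.toLp 2 (A.mulVec z) : Vec d)‖) ∂stdNormal m :=
        integral_mono ((i2.sub (it2.const_mul (s ^ 2))).abs) (iE.const_mul _) hrem
    _ ≤ s ^ 3 * (γ.degree.factorial * Real.exp (‖v‖ + β)) * Real.exp (4 * (d * V + 1) + 1) := by
        rw [integral_const_mul]
        exact mul_le_mul_of_nonneg_left eE (by positivity)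
    _ = _ := by rw [Real.exp_add (‖v‖ + β)]; ring

end OneStep

/-! ### Truncation -/

section Truncation

variable {d : ℕ}

theorem measurableSet_cube (R : ℝ) : MeasurableSet (cube d R) := by
  have : cube d R = ⋂ i, {x : Vec d | |x i| ≤ R} := by ext; simp [cube]
  rw [this]
  exact MeasurableSet.iInter fun i => measurableSet_le (by fun_prop) measurable_const

theorem lt_norm_of_notMem_cube {R : ℝ} {x : Vec d} (hx : x ∉ cube d R) : R < ‖x‖ := by
  simp only [cube, Set.mem_ofPred_eq, not_forall, not_le] at hx
  obtain ⟨i, hi⟩ := hx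
  exact hi.trans_le (abs_apply_le_norm x i)

theorem norm_le_of_mem_cube {R : ℝ} (hR : 0 ≤ R) {x : Vec d} (hx : x ∈ cube d R) :
    ‖x‖ ≤ d * R := by
  refine abs_le_of_sq_le_sq' ?_ (by positivity) |>.2
  rw [EuclideanSpace.real_norm_sq_eq]
  calc ∑ i, x i ^ 2 ≤ ∑ _i : Fin d, R ^ 2 :=
        Finset.sum_le_sum fun i _ => sq_le_sq' (abs_le.1 (hx i)).1 (abs_le.1 (hx i)).2
    _ = d * R ^ 2 := by simp
    _ ≤ d ^ 2 * R ^ 2 := by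
        gcongr
        exact_mod_cast Nat.le_self_pow two_ne_zero d
    _ = _ := by ring

/-- A displacement of length R + ε along e_i takes any point out of I_R, where χ vanishes; the
Lipschitz bound on the i-th component then gives |χ_i(x)| ≤ R + ε. -/
theorem IsTruncation.mem_cube {R : ℝ} {χ : Vec d → Vec d} (hχ : IsTruncation R χ) (hR : 0 ≤ R)
    (x : Vec d) : χ x ∈ cube d R := by
  intro i
  refine le_of_forall_pos_le_add fun ε hε => ?_
  obtain ⟨t, ht, ht'⟩ : ∃ t : ℝ, |t| = R + ε ∧ R < |x i + t| := by
    rcases le_total 0 (x i) with h | h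
    · exact ⟨R + ε, abs_of_pos (by linarith), by rw [abs_of_pos] <;> linarith⟩
    · refine ⟨-(R + ε), by rw [abs_neg, abs_of_pos (by linarith)], ?_⟩
      rw [abs_of_neg] <;> linarith
  have h1 := hχ.lipschitz x (x + EuclideanSpace.single i t) i
  rw [hχ.eq_zero (x + EuclideanSpace.single i t) ?_] at h1
  · simpa [ht] using h1
  · intro h2
    have := h2 i
    simp at this
    linarith

theorem IsTruncation.measurable {R : ℝ} {χ : Vec d → Vec d} (hχ : IsTruncation R χ) :
    Measurable χ := hχ.smooth.continuous.measurable

/-- If `Y ∉ I_{R/3}` forces `|W| ≥ R/3`, then exponential moments of `W` control the effect of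
truncation on the moments of `Y`. -/
theorem abs_moment_truncation_sub_le {Ω : Type*} [MeasurableSpace Ω] {P : Measure Ω}
    [IsProbabilityMeasure P] {R a M M' : ℝ} {χ : Vec d → Vec d} (hχ : IsTruncation R χ)
    (hR : 0 ≤ R) (ha : 0 ≤ a) {Y W : Ω → Vec d} (hY : Measurable Y)
    (hbad : ∀ ω, Y ω ∉ cube d (R / 3) → R / 3 ≤ ‖W ω‖)
    (iW : Integrable (fun ω => Real.exp (a * ‖W ω‖ ^ 2)) P)
    (eW : ∫ ω, Real.exp (a * ‖W ω‖ ^ 2) ∂P ≤ M)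
    (iY : Integrable (fun ω => Real.exp (2 * ‖Y ω‖)) P)
    (eY : ∫ ω, Real.exp (2 * ‖Y ω‖) ∂P ≤ M') (γ : Idx d) :
    |moment P (fun ω => χ (Y ω)) γ - moment P Y γ| ≤
      γ.degree.factorial * (Real.exp (-(a * R ^ 2 / 18)) * (M + 2 * Real.exp (2 * R) + 2 * M')) := by
  set F : ℝ := (γ.degree.factorial : ℝ) with hF
  have hF0 : 0 ≤ F := Nat.cast_nonneg _
  set τ := Real.exp (-(a * R ^ 2 / 18)) with hτ
  have hχint : Integrable (fun ω => mono γ (χ (Y ω))) P := by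
    refine (integrable_const (F * Real.exp R)).mono'
      ((continuous_mono γ).measurable.comp (hχ.measurable.comp hY)).aestronglyMeasurable
      (Filter.Eventually.of_forall fun ω => ?_)
    exact abs_mono_le_factorial_mul_exp hR (hχ.mem_cube hR _)
  have hYint : Integrable (fun ω => mono γ (Y ω)) P := by
    refine (iY.const_mul F).mono' ((continuous_mono γ).measurable.comp hY).aestronglyMeasurable
      (Filter.Eventually.of_forall fun ω => ?_)
    refine (abs_mono_le_exp_norm γ _).trans ?_
    gcongr
    linarith [norm_nonneg (Y ω)]
  have hpt : ∀ ω, |mono γ (χ (Y ω)) - mono γ (Y ω)| ≤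
      F * (τ * (Real.exp (a * ‖W ω‖ ^ 2) + 2 * Real.exp (2 * R) + 2 * Real.exp (2 * ‖Y ω‖))) := by
    intro ω
    by_cases hω : Y ω ∈ cube d (R / 3)
    · rw [hχ.eq_self _ hω, sub_self, abs_zero]
      positivity
    · set X := Real.exp R + Real.exp ‖Y ω‖ with hX
      have h1 : |mono γ (χ (Y ω)) - mono γ (Y ω)| ≤ F * X := by
        refine (abs_sub _ _).trans ?_
        rw [hX, mul_add]
        exact add_le_add (abs_mono_le_factorial_mul_exp hR (hχ.mem_cube hR _))
          (abs_mono_le_exp_norm γ _)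
      refine h1.trans (mul_le_mul_of_nonneg_left ?_ hF0)
      have h2 : X ^ 2 ≤ 2 * Real.exp (2 * R) + 2 * Real.exp (2 * ‖Y ω‖) := by
        rw [hX, two_mul R, two_mul ‖Y ω‖, Real.exp_add, Real.exp_add]
        nlinarith [sq_nonneg (Real.exp R - Real.exp ‖Y ω‖)]
      -- This is τ⁻² = e^{aR²/9} ≤ e^{a|W|²}, valid because |W| ≥ R/3. Together with X ≤ 1/τ + τX²
      -- it replaces Cauchy–Schwarz between the size X and the exit event, and halving the exponent
      -- 1/9 gives the 1/18 in τ.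
      have h3 : 1 / τ ≤ τ * Real.exp (a * ‖W ω‖ ^ 2) := by
        rw [hτ, one_div, ← Real.exp_neg, ← Real.exp_add, Real.exp_le_exp]
        have := pow_le_pow_left₀ (by positivity) (hbad ω hω) 2
        nlinarith
      have hτ0 : 0 < τ := Real.exp_pos _
      have h4 : X ≤ 1 / τ + τ * X ^ 2 := by
        rw [← sub_nonneg]
        have : 1 / τ + τ * X ^ 2 - X = ((τ * X - 1 / 2) ^ 2 + 3 / 4) / τ := by
          field_simp
          ring
        rw [this]
        positivity
      calc X ≤ 1 / τ + τ * X ^ 2 := h4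
        _ ≤ τ * Real.exp (a * ‖W ω‖ ^ 2) +
            τ * (2 * Real.exp (2 * R) + 2 * Real.exp (2 * ‖Y ω‖)) :=
          add_le_add h3 (mul_le_mul_of_nonneg_left h2 hτ0.le)
        _ = _ := by ring
  have i1 : Integrable (fun ω => Real.exp (a * ‖W ω‖ ^ 2) + 2 * Real.exp (2 * R)) P :=
    iW.add (integrable_const _)
  have i2 : Integrable (fun ω => Real.exp (a * ‖W ω‖ ^ 2) + 2 * Real.exp (2 * R) +
    2 * Real.exp (2 * ‖Y ω‖)) P := i1.add (iY.const_mul 2)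
  rw [moment, moment, ← integral_sub hχint hYint]
  refine abs_integral_le_integral_abs.trans ?_
  refine (integral_mono (hχint.sub hYint).abs ((i2.const_mul τ).const_mul F) hpt).trans ?_
  rw [integral_const_mul, integral_const_mul, integral_add i1 (iY.const_mul 2),
    integral_add iW (integrable_const _), integral_const, probReal_univ, one_smul,
    integral_const_mul]
  gcongr

end Truncation

/-! ### Recursions driven by independent Gaussian vectors -/

section Chain

variable {d m : ℕ} {Ω E : Type*} [MeasurableSpace Ω] [MeasurableSpace E] {P : Measure Ω}

/-- The joint law is a triple product, which may be bracketed either way. The noise is assumed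
independent within itself and, as a whole sequence, of u₀; regrouping yields independence of (u₀,
z_0, …, z_{k-1}) from z_k. -/
theorem IndepFun.prodMk_of_indepFun_prodMk {α β γ : Type*} [MeasurableSpace α] [MeasurableSpace β]
    [MeasurableSpace γ] [IsProbabilityMeasure P] {u : Ω → α} {v : Ω → β} {w : Ω → γ}
    (hu : Measurable u) (hv : Measurable v) (hw : Measurable w) (hvw : IndepFun v w P)
    (huvw : IndepFun u (fun ω => (v ω, w ω)) P) : IndepFun (fun ω => (u ω, v ω)) w P := by
  have huv : IndepFun u v P := huvw.comp measurable_id measurable_fst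
  have := Measure.isProbabilityMeasure_map (μ := P) hu.aemeasurable
  have := Measure.isProbabilityMeasure_map (μ := P) hv.aemeasurable
  have := Measure.isProbabilityMeasure_map (μ := P) hw.aemeasurable
  rw [indepFun_iff_map_prod_eq_prod_map_map (hu.prodMk hv).aemeasurable hw.aemeasurable,
    (indepFun_iff_map_prod_eq_prod_map_map hu.aemeasurable hv.aemeasurable).1 huv]
  have h1 := (indepFun_iff_map_prod_eq_prod_map_map hu.aemeasurable
    (hv.prodMk hw).aemeasurable).1 huvw
  rw [(indepFun_iff_map_prod_eq_prod_map_map hv.aemeasurable hw.aemeasurable).1 hvw] at h1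
  have h2 := (measurePreserving_prodAssoc (P.map u) (P.map v) (P.map w)).symm
    MeasurableEquiv.prodAssoc
  rw [← h2.map_eq, ← h1, Measure.map_map (MeasurableEquiv.measurable _)
    (hu.prodMk (hv.prodMk hw))]
  rfl

theorem GaussianNoise.indepFun_past [IsProbabilityMeasure P] {u₀ : Ω → Vec d}
    {z : ℕ → Ω → Fin m → ℝ} (hz : GaussianNoise P u₀ z) (hu : Measurable u₀) (k : ℕ) :
    IndepFun (fun ω => (u₀ ω, fun j : Finset.range k => z j ω)) (z k) P := by
  refine IndepFun.prodMk_of_indepFun_prodMk hu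
    (measurable_pi_lambda _ fun j => hz.measurable j) (hz.measurable k) ?_ ?_
  · have h1 := hz.indep.indepFun_finset (Finset.range k) {k}
      (by simp) hz.measurable
    exact h1.comp measurable_id (measurable_pi_apply (⟨k, by simp⟩ : ({k} : Finset ℕ)))
  · have hm : Measurable fun y : ℕ → Fin m → ℝ => ((fun j : Finset.range k => y j), y k) := by
      fun_prop
    exact hz.indep_initial.comp measurable_id hm

theorem GaussianNoise.indepFun_chain [IsProbabilityMeasure P] {u₀ : Ω → Vec d}
    {z : ℕ → Ω → Fin m → ℝ} (hz : GaussianNoise P u₀ z) (hu : Measurable u₀) {f : Vec d → E}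
    (hf : Measurable f) {g : E → (Fin m → ℝ) → E} (hg : Measurable (Function.uncurry g))
    {X : ℕ → Ω → E} (h0 : ∀ ω, X 0 ω = f (u₀ ω)) (hs : ∀ k ω, X (k + 1) ω = g (X k ω) (z k ω))
    (k : ℕ) : Measurable (X k) ∧ IndepFun (X k) (z k) P := by
  have key : ∃ F : Vec d × (Finset.range k → Fin m → ℝ) → E, Measurable F ∧
      ∀ ω, X k ω = F (u₀ ω, fun j : Finset.range k => z j ω) := by
    induction k with
    | zero => exact ⟨fun q => f q.1, hf.comp measurable_fst, h0⟩
    | succ k ih =>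
      obtain ⟨F, hF, hX⟩ := ih
      have hlt : ∀ j : Finset.range k, (j : ℕ) ∈ Finset.range (k + 1) := fun j =>
        Finset.mem_range.2 ((Finset.mem_range.1 j.2).trans (Nat.lt_succ_self k))
      refine ⟨fun q => g (F (q.1, fun j => q.2 ⟨j, hlt j⟩))
        (q.2 ⟨k, Finset.mem_range.2 (Nat.lt_succ_self k)⟩), ?_, fun ω => ?_⟩
      · have h1 : Measurable fun q : Vec d × (Finset.range (k + 1) → Fin m → ℝ) =>
            F (q.1, fun j => q.2 ⟨j, hlt j⟩) := hF.comp (by fun_prop)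
        exact hg.comp (h1.prodMk (by fun_prop))
      · rw [hs, hX]
  obtain ⟨F, hF, hX⟩ := key
  have hm : Measurable fun ω => (u₀ ω, fun j : Finset.range k => z j ω) :=
    hu.prodMk (measurable_pi_lambda _ fun j => hz.measurable j)
  rw [show X k = F ∘ fun ω => (u₀ ω, fun j : Finset.range k => z j ω) from funext hX]
  exact ⟨hF.comp hm, (hz.indepFun_past hu k).comp hF measurable_id⟩

/-- Conditioning on X, written as Tonelli for the product law. Working with nonnegative integrals
makes integrability a conclusion, as the induction on exponential moments requires. -/
theorem integrable_of_indepFun [IsProbabilityMeasure P] {X : Ω → E} {ζ : Ω → Fin m → ℝ}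
    (hX : Measurable X) (hζ : Measurable ζ) (hlaw : P.map ζ = stdNormal m)
    (hind : IndepFun X ζ P) {f : E → (Fin m → ℝ) → ℝ} (hf : Measurable (Function.uncurry f))
    (hf0 : ∀ x y, 0 ≤ f x y) {G : Ω → ℝ} (hG : Integrable G P)
    (hi : ∀ ω, Integrable (f (X ω)) (stdNormal m))
    (hle : ∀ ω, ∫ y, f (X ω) y ∂stdNormal m ≤ G ω) :
    Integrable (fun ω => f (X ω) (ζ ω)) P ∧ ∫ ω, f (X ω) (ζ ω) ∂P ≤ ∫ ω, G ω ∂P := by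
  have hG0 : ∀ ω, 0 ≤ G ω := fun ω => (integral_nonneg (hf0 _)).trans (hle ω)
  have hmeas : Measurable fun ω => f (X ω) (ζ ω) := hf.comp (hX.prodMk hζ)
  have hf' : Measurable fun q : E × (Fin m → ℝ) => ENNReal.ofReal (f q.1 q.2) :=
    hf.ennreal_ofReal
  have h1 : ∫⁻ ω, ENNReal.ofReal (f (X ω) (ζ ω)) ∂P ≤ ∫⁻ ω, ENNReal.ofReal (G ω) ∂P := by
    have e1 : ∫⁻ ω, ENNReal.ofReal (f (X ω) (ζ ω)) ∂P =
        ∫⁻ q, ENNReal.ofReal (f q.1 q.2) ∂(P.map fun ω => (X ω, ζ ω)) :=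
      (lintegral_map hf' (hX.prodMk hζ)).symm
    rw [e1, (indepFun_iff_map_prod_eq_prod_map_map hX.aemeasurable hζ.aemeasurable).1 hind, hlaw,
      lintegral_prod _ hf'.aemeasurable, lintegral_map hf'.lintegral_prod_right' hX]
    refine lintegral_mono fun ω => ?_
    rw [← ofReal_integral_eq_lintegral_ofReal (hi ω) (Filter.Eventually.of_forall (hf0 _))]
    exact ENNReal.ofReal_le_ofReal (hle ω)
  have h2 : ∫⁻ ω, ENNReal.ofReal (G ω) ∂P = ENNReal.ofReal (∫ ω, G ω ∂P) :=
    (ofReal_integral_eq_lintegral_ofReal hG (Filter.Eventually.of_forall hG0)).symm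
  have h3 : Integrable (fun ω => f (X ω) (ζ ω)) P := by
    refine ⟨hmeas.aestronglyMeasurable, ?_⟩
    rw [hasFiniteIntegral_iff_ofReal (Filter.Eventually.of_forall fun ω => hf0 _ _)]
    exact h1.trans_lt (h2 ▸ ENNReal.ofReal_lt_top)
  refine ⟨h3, ?_⟩
  rw [h2, ← ofReal_integral_eq_lintegral_ofReal h3
    (Filter.Eventually.of_forall fun ω => hf0 _ _)] at h1
  exact (ENNReal.ofReal_le_ofReal_iff (integral_nonneg hG0)).1 h1

theorem integral_of_indepFun [IsProbabilityMeasure P] {X : Ω → E} {ζ : Ω → Fin m → ℝ}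
    (hX : Measurable X) (hζ : Measurable ζ) (hlaw : P.map ζ = stdNormal m)
    (hind : IndepFun X ζ P) {f : E → (Fin m → ℝ) → ℝ} (hf : Measurable (Function.uncurry f))
    (hint : Integrable (fun ω => f (X ω) (ζ ω)) P) :
    Integrable (fun ω => ∫ y, f (X ω) y ∂stdNormal m) P ∧
      ∫ ω, f (X ω) (ζ ω) ∂P = ∫ ω, ∫ y, f (X ω) y ∂stdNormal m ∂P := by
  have := Measure.isProbabilityMeasure_map (μ := P) hX.aemeasurable
  have hmap := (indepFun_iff_map_prod_eq_prod_map_map hX.aemeasurable hζ.aemeasurable).1 hind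
  rw [hlaw] at hmap
  have h1 : Integrable (Function.uncurry f) ((P.map X).prod (stdNormal m)) := by
    rw [← hmap, integrable_map_measure hf.aestronglyMeasurable (hX.prodMk hζ).aemeasurable]
    exact hint
  have hm : AEStronglyMeasurable (fun x => ∫ y, f x y ∂stdNormal m) (P.map X) :=
    hf.stronglyMeasurable.integral_prod_right.aestronglyMeasurable
  constructor
  · exact (integrable_map_measure hm hX.aemeasurable).1 h1.integral_prod_left
  · have e1 : ∫ ω, f (X ω) (ζ ω) ∂P =
        ∫ q, Function.uncurry f q ∂(P.map fun ω => (X ω, ζ ω)) :=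
      (integral_map (hX.prodMk hζ).aemeasurable hf.aestronglyMeasurable).symm
    rw [e1, hmap, integral_prod _ h1]
    exact integral_map hX.aemeasurable hm

end Chain

/-! ### The reference scheme -/

section Scheme

variable {d m : ℕ} {Ω : Type*}
  {pb : Fin d → MvPolynomial (Fin d) ℝ} {pσ : Matrix (Fin d) (Fin m) (MvPolynomial (Fin d) ℝ)}

open Classical in
/-- One untruncated step inside `I_{R/3}`, and no motion outside of it. -/
def frozenStep (pb : Fin d → MvPolynomial (Fin d) ℝ)
    (pσ : Matrix (Fin d) (Fin m) (MvPolynomial (Fin d) ℝ)) (h R : ℝ) (v : Vec d)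
    (z : Fin m → ℝ) : Vec d :=
  if v ∈ cube d (R / 3) then eulerStep pb pσ h v z else v

/-- The untruncated scheme, frozen when it leaves `I_{R/3}`. -/
def frozenScheme (pb : Fin d → MvPolynomial (Fin d) ℝ)
    (pσ : Matrix (Fin d) (Fin m) (MvPolynomial (Fin d) ℝ)) (h R : ℝ)
    (u₀ : Ω → Vec d) (z : ℕ → Ω → Fin m → ℝ) : ℕ → Ω → Vec d
  | 0, ω => u₀ ω
  | k + 1, ω => frozenStep pb pσ h R (frozenScheme pb pσ h R u₀ z k ω) (z k ω)

theorem refScheme_succ (χ : Vec d → Vec d) (h : ℝ) (u₀ : Ω → Vec d) (z : ℕ → Ω → Fin m → ℝ)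
    (k : ℕ) (ω : Ω) : refScheme χ pb pσ h u₀ z (k + 1) ω =
      χ (eulerStep pb pσ h (refScheme χ pb pσ h u₀ z k ω) (z k ω)) := rfl

/-- The outside of I_{R/3} is absorbing for the frozen chain. If the chain is inside at time k, it
never left, so χ has acted as the identity up to then. -/
theorem refScheme_eq_frozenScheme {R : ℝ} {χ : Vec d → Vec d} (hχ : IsTruncation R χ) (h : ℝ)
    (u₀ : Ω → Vec d) (z : ℕ → Ω → Fin m → ℝ) (k : ℕ) (ω : Ω)
    (hk : frozenScheme pb pσ h R u₀ z k ω ∈ cube d (R / 3)) :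
    refScheme χ pb pσ h u₀ z k ω = frozenScheme pb pσ h R u₀ z k ω := by
  induction k with
  | zero => exact hχ.eq_self _ hk
  | succ k ih =>
    rw [frozenScheme, frozenStep] at hk ⊢
    by_cases h1 : frozenScheme pb pσ h R u₀ z k ω ∈ cube d (R / 3)
    · rw [if_pos h1] at hk ⊢
      rw [refScheme_succ, ih h1, hχ.eq_self _ hk]
    · rw [if_neg h1] at hk
      exact absurd hk h1

/-- Used in contrapositive form: an untruncated step leaving I_{R/3} forces the frozen chain to be
outside as well, so exponential moments of the frozen chain measure how rarely χ acts. They are not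
derived for the truncated scheme itself, since the componentwise Lipschitz condition gives only
|χ(x)| ≤ √d |x|, a factor that cannot be iterated over n steps. -/
theorem eulerStep_mem_cube {R : ℝ} {χ : Vec d → Vec d} (hχ : IsTruncation R χ) (h : ℝ)
    (u₀ : Ω → Vec d) (z : ℕ → Ω → Fin m → ℝ) (k : ℕ) (ω : Ω)
    (hk : frozenScheme pb pσ h R u₀ z (k + 1) ω ∈ cube d (R / 3)) :
    eulerStep pb pσ h (refScheme χ pb pσ h u₀ z k ω) (z k ω) ∈ cube d (R / 3) := by
  rw [frozenScheme, frozenStep] at hk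
  by_cases h1 : frozenScheme pb pσ h R u₀ z k ω ∈ cube d (R / 3)
  · rw [if_pos h1] at hk
    rwa [refScheme_eq_frozenScheme hχ h u₀ z k ω h1]
  · rw [if_neg h1] at hk
    exact absurd hk h1

theorem measurable_eulerStep (h : ℝ) :
    Measurable (Function.uncurry (eulerStep pb pσ h)) := by
  exact (continuous_eulerStep h).measurable

theorem measurable_frozenStep (h R : ℝ) :
    Measurable (Function.uncurry (frozenStep pb pσ h R)) := by
  classical
  have : Function.uncurry (frozenStep pb pσ h R) = fun q : Vec d × (Fin m → ℝ) =>
      if q.1 ∈ cube d (R / 3) then eulerStep pb pσ h q.1 q.2 else q.1 := by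
    funext q
    rw [Function.uncurry, frozenStep]
  rw [this]
  exact Measurable.ite (measurable_fst (measurableSet_cube _)) (continuous_eulerStep h).measurable
    measurable_fst

theorem refScheme_mem_cube {R : ℝ} {χ : Vec d → Vec d} (hχ : IsTruncation R χ) (hR : 0 ≤ R)
    (h : ℝ) (u₀ : Ω → Vec d) (z : ℕ → Ω → Fin m → ℝ) (k : ℕ) (ω : Ω) :
    refScheme χ pb pσ h u₀ z k ω ∈ cube d R := by
  cases k with
  | zero => exact hχ.mem_cube hR _
  | succ k => exact hχ.mem_cube hR _

/-- Growth of the exponential moment in one step of the frozen scheme. -/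
theorem integral_exp_frozenStep_le {K δ₀ h R a : ℝ} (hK : 0 < K) (ha : 0 ≤ a) (haδ : a ≤ δ₀)
    (h0 : 0 < h) (h1 : h ≤ 1) (hKh : K * h ≤ 1) (hdh : 8 * δ₀ * h * d * K ^ 2 ≤ 1 / 4)
    (hR : 0 ≤ R)
    (hb : ∀ x ∈ cube d R, ‖evalVec pb x‖ ≤ K * (‖x‖ + 2))
    (hσ : ∀ x ∈ cube d R, ∑ i, ∑ j, evalMat pσ x i j ^ 2 ≤ 4 * K ^ 2) (v : Vec d) :
    Integrable (fun z => Real.exp (a * ‖frozenStep pb pσ h R v z‖ ^ 2)) (stdNormal m) ∧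
    ∫ z, Real.exp (a * ‖frozenStep pb pσ h R v z‖ ^ 2) ∂stdNormal m ≤
      Real.exp (a * (1 + (7 * K + 128 * δ₀ * K ^ 2) * h) * ‖v‖ ^ 2 +
        (8 * δ₀ * (1 + 16 * δ₀ * K ^ 2) * K + 8 * δ₀ * d * K ^ 2) * h) := by
  have hδ0 : 0 ≤ δ₀ := ha.trans haδ
  by_cases hv : v ∈ cube d (R / 3)
  · have hvR : v ∈ cube d R := fun i => (hv i).trans (by linarith)
    have e1 : ∀ z, frozenStep pb pσ h R v z = (v + h • evalVec pb v) +
        √h • (WithLp.toLp 2 ((evalMat pσ v).mulVec z) : Vec d) := fun z => by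
      rw [frozenStep, if_pos hv, eulerStep]
    simp only [e1]
    set y := v + h • evalVec pb v with hy
    have hs2 : √h ^ 2 = h := Real.sq_sqrt h0.le
    obtain ⟨i1, b1⟩ := integral_exp_norm_add_mulVec_sq_le (a := a) (q := √h) (V := 4 * K ^ 2)
      (evalMat pσ v) y ha (hσ v hvR) (by
        rw [hs2]
        calc 2 * a * h * d * (4 * K ^ 2) = 8 * a * h * d * K ^ 2 := by ring
          _ ≤ 8 * δ₀ * h * d * K ^ 2 := by gcongr
          _ ≤ _ := hdh)
    refine ⟨i1, b1.trans (Real.exp_le_exp.2 ?_)⟩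
    rw [hs2]
    set p := K * h with hp
    set x := ‖v‖ with hx
    have hp0 : 0 ≤ p := by positivity
    have hx0 : 0 ≤ x := norm_nonneg _
    have hyn : ‖y‖ ≤ x * (1 + p) + 2 * p := by
      refine (norm_add_le _ _).trans ?_
      rw [norm_smul, Real.norm_of_nonneg h0.le]
      have := mul_le_mul_of_nonneg_left (hb v hvR) h0.le
      rw [hp]
      linarith
    -- From p² ≤ p and 2x ≤ 1 + x²: the square (1+p)² gives 3p, the cross term gives 4p to both x²
    -- and the constant, and 4p² gives the remaining 4p.
    have hy2 : ‖y‖ ^ 2 ≤ (1 + 7 * p) * x ^ 2 + 8 * p := by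
      have h2 : ‖y‖ ^ 2 ≤ (x * (1 + p) + 2 * p) ^ 2 := pow_le_pow_left₀ (norm_nonneg _) hyn 2
      have h3 : p ^ 2 ≤ p := by nlinarith
      nlinarith [mul_nonneg hp0 (sq_nonneg (x - 1)), mul_nonneg (sub_nonneg.2 h3) (sq_nonneg x),
        mul_nonneg (sub_nonneg.2 h3) hx0, sq_nonneg (x - 1),
        mul_nonneg (sub_nonneg.2 h3) (sq_nonneg (x - 1))]
    set κ := 16 * a * K ^ 2 * h with hκ
    have hκ0 : 0 ≤ κ := by positivity
    have hκ1 : κ ≤ 16 * δ₀ * K ^ 2 := by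
      calc κ ≤ 16 * δ₀ * K ^ 2 * h := by rw [hκ]; gcongr
        _ ≤ 16 * δ₀ * K ^ 2 * 1 := by gcongr
        _ = _ := mul_one _
    have hκ2 : κ ≤ 16 * δ₀ * K ^ 2 * h := by rw [hκ]; gcongr
    calc a * ‖y‖ ^ 2 + 4 * a ^ 2 * h * (4 * K ^ 2) * ‖y‖ ^ 2 + 2 * a * h * d * (4 * K ^ 2)
        = a * (1 + κ) * ‖y‖ ^ 2 + 8 * a * h * d * K ^ 2 := by rw [hκ]; ring
      _ ≤ a * (1 + κ) * ((1 + 7 * p) * x ^ 2 + 8 * p) + 8 * δ₀ * h * d * K ^ 2 := by gcongr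
      _ = a * ((1 + κ) * (1 + 7 * p)) * x ^ 2 + a * (1 + κ) * 8 * p + 8 * δ₀ * h * d * K ^ 2 := by
          ring
      _ ≤ a * (1 + (7 * K + 128 * δ₀ * K ^ 2) * h) * x ^ 2 +
          δ₀ * (1 + 16 * δ₀ * K ^ 2) * 8 * p + 8 * δ₀ * h * d * K ^ 2 := by
          gcongr
          -- Hence κ + 7κp ≤ 8κ, and 8 · 16 is the 128 of the rate.
          have h4 : κ * p ≤ κ := mul_le_of_le_one_right hκ0 hKh
          calc (1 + κ) * (1 + 7 * p) = 1 + 7 * p + κ + 7 * (κ * p) := by ring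
            _ ≤ 1 + 7 * p + 8 * (16 * δ₀ * K ^ 2 * h) := by linarith
            _ = _ := by rw [hp]; ring
      _ = _ := by rw [hp]; ring
  · have e1 : ∀ z : Fin m → ℝ, frozenStep pb pσ h R v z = v := fun z => by
      rw [frozenStep, if_neg hv]
    simp only [e1]
    refine ⟨integrable_const _, ?_⟩
    rw [integral_const, probReal_univ, one_smul, Real.exp_le_exp]
    have h2 : a * 1 * ‖v‖ ^ 2 ≤ a * (1 + (7 * K + 128 * δ₀ * K ^ 2) * h) * ‖v‖ ^ 2 := by
      gcongr
      have : 0 ≤ (7 * K + 128 * δ₀ * K ^ 2) * h := by positivity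
      linarith
    have h3 : 0 ≤ (8 * δ₀ * (1 + 16 * δ₀ * K ^ 2) * K + 8 * δ₀ * d * K ^ 2) * h := by positivity
    linarith

/-- The rate of decrease of the exponential moment. -/
def expRate (K δ₀ : ℝ) : ℝ := 7 * K + 128 * δ₀ * K ^ 2

/-- The rate of growth of the logarithm of the exponential moment. -/
def expGrowth (d : ℕ) (K δ₀ : ℝ) : ℝ :=
  8 * δ₀ * (1 + 16 * δ₀ * K ^ 2) * K + 8 * δ₀ * d * K ^ 2

variable [MeasurableSpace Ω] {P : Measure Ω}

/-- Each step enlarges the coefficient of |v|² by the factor 1 + ch with c = `expRate K δ₀`, so the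
exponent is lowered by the same factor at each step. After k ≤ n steps it is δ₀/(1+ch)^k ≥ δ₀
e^{-cT}. As c does not contain d, neither does the final exponent. -/
theorem integral_exp_frozenScheme_le [IsProbabilityMeasure P] {K T δ₀ M₀ h R : ℝ} {n : ℕ}
    {u₀ : Ω → Vec d} {z : ℕ → Ω → Fin m → ℝ} (hK : 0 < K) (hδ₀ : 0 < δ₀) (hT : n * h = T)
    (h0 : 0 < h) (h1 : h ≤ 1) (hKh : K * h ≤ 1) (hdh : 8 * δ₀ * h * d * K ^ 2 ≤ 1 / 4)
    (hR : 0 ≤ R)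
    (hb : ∀ x ∈ cube d R, ‖evalVec pb x‖ ≤ K * (‖x‖ + 2))
    (hσ : ∀ x ∈ cube d R, ∑ i, ∑ j, evalMat pσ x i j ^ 2 ≤ 4 * K ^ 2)
    (hu : InitialCondition δ₀ M₀ P u₀) (hz : GaussianNoise P u₀ z) {k : ℕ} (hk : k ≤ n) :
    Integrable (fun ω => Real.exp (δ₀ * Real.exp (-(expRate K δ₀ * T)) *
      ‖frozenScheme pb pσ h R u₀ z k ω‖ ^ 2)) P ∧
    ∫ ω, Real.exp (δ₀ * Real.exp (-(expRate K δ₀ * T)) *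
      ‖frozenScheme pb pσ h R u₀ z k ω‖ ^ 2) ∂P ≤ Real.exp (expGrowth d K δ₀ * T) * M₀ := by
  set c := expRate K δ₀ with hc
  set c' := expGrowth d K δ₀ with hc'
  have hc0 : 0 < c := by rw [hc, expRate]; positivity
  have hc0' : 0 ≤ c' := by rw [hc', expGrowth]; positivity
  have hq : 1 ≤ 1 + c * h := by nlinarith
  have hq0 : 0 < 1 + c * h := by linarith
  have hchain := hz.indepFun_chain hu.measurable measurable_id (measurable_frozenStep h R)
    (X := frozenScheme pb pσ h R u₀ z) (fun ω => rfl) (fun k ω => rfl)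
  have hM₀ : 0 ≤ M₀ := (integral_nonneg fun ω => (Real.exp_pos _).le).trans hu.bound
  have key : ∀ k : ℕ, Integrable (fun ω => Real.exp (δ₀ / (1 + c * h) ^ k *
      ‖frozenScheme pb pσ h R u₀ z k ω‖ ^ 2)) P ∧
      ∫ ω, Real.exp (δ₀ / (1 + c * h) ^ k *
        ‖frozenScheme pb pσ h R u₀ z k ω‖ ^ 2) ∂P ≤ Real.exp (c' * (k * h)) * M₀ := by
    intro k
    induction k with
    | zero =>
      simp only [pow_zero, div_one, Nat.cast_zero, zero_mul, mul_zero, Real.exp_zero, one_mul]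
      exact ⟨hu.integrable, hu.bound⟩
    | succ k ih =>
      have hak : 0 ≤ δ₀ / (1 + c * h) ^ (k + 1) := by positivity
      have hak' : δ₀ / (1 + c * h) ^ (k + 1) ≤ δ₀ := div_le_self hδ₀.le (one_le_pow₀ hq)
      have hstep := fun v => integral_exp_frozenStep_le (m := m) (pb := pb) (pσ := pσ) hK hak hak'
        h0 h1 hKh hdh hR hb hσ v
      have hG : ∀ v : Vec d, Real.exp (δ₀ / (1 + c * h) ^ (k + 1) *
          (1 + (7 * K + 128 * δ₀ * K ^ 2) * h) * ‖v‖ ^ 2 +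
          (8 * δ₀ * (1 + 16 * δ₀ * K ^ 2) * K + 8 * δ₀ * d * K ^ 2) * h) =
          Real.exp (c' * h) * Real.exp (δ₀ / (1 + c * h) ^ k * ‖v‖ ^ 2) := by
        intro v
        rw [← Real.exp_add]
        change Real.exp (δ₀ / (1 + c * h) ^ (k + 1) * (1 + c * h) * ‖v‖ ^ 2 + c' * h) = _
        congr 1
        rw [pow_succ]
        field_simp
        ring
      simp only [hG] at hstep
      obtain ⟨i1, b1⟩ := integrable_of_indepFun (hchain k).1 (hz.measurable k) (hz.law k)
        (hchain k).2 (f := fun v y => Real.exp (δ₀ / (1 + c * h) ^ (k + 1) *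
          ‖frozenStep pb pσ h R v y‖ ^ 2))
        (((measurable_frozenStep h R).norm.pow_const 2).const_mul _).exp
        (fun _ _ => (Real.exp_pos _).le) (ih.1.const_mul (Real.exp (c' * h)))
        (fun ω => (hstep _).1) (fun ω => (hstep _).2)
      refine ⟨i1, b1.trans ?_⟩
      rw [integral_const_mul]
      calc _ ≤ Real.exp (c' * h) * (Real.exp (c' * (k * h)) * M₀) :=
            mul_le_mul_of_nonneg_left ih.2 (Real.exp_pos _).le
        _ = _ := by
            rw [← mul_assoc, ← Real.exp_add]
            congr 2
            push_cast
            ring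
  obtain ⟨i1, b1⟩ := key k
  have hkT : k * h ≤ T := by
    rw [← hT]
    exact mul_le_mul_of_nonneg_right (by exact_mod_cast hk) h0.le
  have hpt : ∀ ω, Real.exp (δ₀ * Real.exp (-(c * T)) * ‖frozenScheme pb pσ h R u₀ z k ω‖ ^ 2) ≤
      Real.exp (δ₀ / (1 + c * h) ^ k * ‖frozenScheme pb pσ h R u₀ z k ω‖ ^ 2) := by
    intro ω
    rw [Real.exp_le_exp]
    refine mul_le_mul_of_nonneg_right ?_ (sq_nonneg _)
    rw [div_eq_mul_inv, Real.exp_neg]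
    refine mul_le_mul_of_nonneg_left (inv_anti₀ (by positivity) ?_) hδ₀.le
    calc (1 + c * h) ^ k ≤ Real.exp (c * h) ^ k :=
          pow_le_pow_left₀ hq0.le (by linarith [Real.add_one_le_exp (c * h)]) k
      _ = Real.exp (c * (k * h)) := by rw [← Real.exp_nat_mul]; ring_nf
      _ ≤ _ := Real.exp_le_exp.2 (mul_le_mul_of_nonneg_left hkT hc0.le)
  have hi : Integrable (fun ω => Real.exp (δ₀ * Real.exp (-(c * T)) *
      ‖frozenScheme pb pσ h R u₀ z k ω‖ ^ 2)) P := by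
    refine i1.mono' ((((hchain k).1.norm.pow_const 2).const_mul _).exp).aestronglyMeasurable
      (Filter.Eventually.of_forall fun ω => ?_)
    rw [Real.norm_eq_abs, Real.abs_exp]
    exact hpt ω
  refine ⟨hi, (integral_mono hi i1 hpt).trans (b1.trans ?_)⟩
  gcongr

theorem integrable_mono_of_mem_cube [IsProbabilityMeasure P] {R : ℝ} {v : Ω → Vec d}
    (hv : Measurable v) (hvR : ∀ ω, v ω ∈ cube d R) (γ : Idx d) :
    Integrable (fun ω => mono γ (v ω)) P :=
  (integrable_const (R ^ γ.degree)).mono'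
    ((continuous_mono γ).measurable.comp hv).aestronglyMeasurable
    (Filter.Eventually.of_forall fun ω => abs_mono_le (hvR ω))

theorem abs_moment_le [IsProbabilityMeasure P] {R : ℝ} {v : Ω → Vec d}
    (hv : Measurable v) (hvR : ∀ ω, v ω ∈ cube d R) (γ : Idx d) :
    |moment P v γ| ≤ R ^ γ.degree := by
  refine abs_integral_le_integral_abs.trans ?_
  refine (integral_mono (integrable_mono_of_mem_cube hv hvR γ).abs (integrable_const _)
    fun ω => abs_mono_le (hvR ω)).trans_eq ?_
  rw [integral_const, probReal_univ, one_smul]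

theorem integral_eval_eq_functional [IsProbabilityMeasure P] {R : ℝ} {v : Ω → Vec d}
    (hv : Measurable v) (hvR : ∀ ω, v ω ∈ cube d R) (p : MvPolynomial (Fin d) ℝ) :
    Integrable (fun ω => MvPolynomial.eval (fun l => v ω l) p) P ∧
      ∫ ω, MvPolynomial.eval (fun l => v ω l) p ∂P = functional (moment P v) p := by
  have h1 : ∀ x : Vec d, MvPolynomial.eval (fun l => x l) p =
      ∑ γ ∈ p.support, p.coeff γ * mono γ x := fun x => by
    rw [MvPolynomial.eval_eq']
    rfl
  simp only [h1]
  have hi := fun γ => (integrable_mono_of_mem_cube (P := P) hv hvR γ).const_mul (p.coeff γ)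
  refine ⟨integrable_finsetSum _ fun γ _ => hi γ, ?_⟩
  rw [integral_finsetSum _ fun γ _ => hi γ, functional]
  exact Finset.sum_congr rfl fun γ _ => integral_const_mul _ _

end Scheme

/-! ### Error propagation -/

section LocalError

variable {d m : ℕ} {Ω : Type*} [MeasurableSpace Ω] {P : Measure Ω}
  {pb : Fin d → MvPolynomial (Fin d) ℝ} {pσ : Matrix (Fin d) (Fin m) (MvPolynomial (Fin d) ℝ)}

/-- An affine bound in `R` for the logarithm of the exponential moments of one step from `I_R`. -/
def stepExponent (d : ℕ) (K R : ℝ) : ℝ :=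
  (d + 1) * R + K * (d * R + 2) + (4 * (d * (4 * K ^ 2) + 1) + 1)

/-- Local weak error of the reference scheme on monomials. -/
theorem abs_moment_refScheme_succ_sub_le [IsProbabilityMeasure P] {K T δ₀ M₀ h R : ℝ} {n : ℕ}
    {u₀ : Ω → Vec d} {z : ℕ → Ω → Fin m → ℝ} {χ : Vec d → Vec d}
    (hK : 0 < K) (hδ₀ : 0 < δ₀) (hT : n * h = T)
    (h0 : 0 < h) (h1 : h ≤ 1) (hKh : K * h ≤ 1) (hdh : 8 * δ₀ * h * d * K ^ 2 ≤ 1 / 4)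
    (hR : 0 ≤ R)
    (hb : ∀ x ∈ cube d R, ‖evalVec pb x‖ ≤ K * (‖x‖ + 2))
    (hσ : ∀ x ∈ cube d R, ∑ i, ∑ j, evalMat pσ x i j ^ 2 ≤ 4 * K ^ 2)
    (hu : InitialCondition δ₀ M₀ P u₀) (hz : GaussianNoise P u₀ z) (hχ : IsTruncation R χ)
    {k : ℕ} (hk : k < n) (γ : Idx d) :
    |moment P (refScheme χ pb pσ h u₀ z (k + 1)) γ - moment P (refScheme χ pb pσ h u₀ z k) γ -
      h * functional (moment P (refScheme χ pb pσ h u₀ z k))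
        (genPoly pb pσ (MvPolynomial.monomial γ 1))| ≤
    γ.degree.factorial * (Real.exp (-(δ₀ * Real.exp (-(expRate K δ₀ * T)) * R ^ 2 / 18)) *
      (Real.exp (expGrowth d K δ₀ * T) * M₀ + 2 * Real.exp (2 * R) +
        2 * Real.exp (2 * stepExponent d K R)) + √h ^ 3 * Real.exp (stepExponent d K R)) := by
  set v := refScheme χ pb pσ h u₀ z with hv
  set B := stepExponent d K R with hB
  set V := 4 * K ^ 2 with hV
  have hvR : ∀ ω, v k ω ∈ cube d R := fun ω => refScheme_mem_cube hχ hR h u₀ z k ω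
  have hg : Measurable (Function.uncurry fun v y => χ (eulerStep pb pσ h v y)) :=
    hχ.measurable.comp (measurable_eulerStep h)
  obtain ⟨hvm, hvi⟩ := hz.indepFun_chain hu.measurable hχ.measurable hg
    (X := v) (fun ω => rfl) (fun k ω => rfl) k
  have hnorm : ∀ ω, ‖v k ω‖ ≤ d * R := fun ω => norm_le_of_mem_cube hR (hvR ω)
  have hβ : ∀ ω, ‖evalVec pb (v k ω)‖ ≤ K * (d * R + 2) := fun ω =>
    (hb _ (hvR ω)).trans (mul_le_mul_of_nonneg_left (by linarith [hnorm ω]) hK.le)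
  set Y : Ω → Vec d := fun ω => eulerStep pb pσ h (v k ω) (z k ω) with hY
  have hYm : Measurable Y := (measurable_eulerStep h).comp (hvm.prodMk (hz.measurable k))
  have hBle : ∀ ω, ‖v k ω‖ + K * (d * R + 2) + (4 * (d * V + 1) + 1) ≤ B := fun ω => by
    rw [hB, stepExponent]; linarith [hnorm ω]
  have hC0 : 0 ≤ 4 * (d * V + 1) + 1 := by positivity
  obtain ⟨iY, eY⟩ := integrable_of_indepFun hvm (hz.measurable k) (hz.law k) hvi
    (f := fun v y => Real.exp (2 * ‖eulerStep pb pσ h v y‖))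
    (((measurable_eulerStep h).norm).const_mul 2).exp (fun _ _ => (Real.exp_pos _).le)
    (integrable_const (Real.exp (2 * B)))
    (fun ω => (integral_exp_two_mul_norm_eulerStep_le h0.le h1 (hβ ω) (hσ _ (hvR ω))).1)
    (fun ω => (integral_exp_two_mul_norm_eulerStep_le h0.le h1 (hβ ω) (hσ _ (hvR ω))).2.trans
      (Real.exp_le_exp.2 (by linarith [hBle ω])))
  rw [integral_const, probReal_univ, one_smul] at eY
  obtain ⟨iW, eW⟩ := integral_exp_frozenScheme_le hK hδ₀ hT h0 h1 hKh hdh hR hb hσ hu hz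
    (Nat.succ_le_of_lt hk)
  have hbad : ∀ ω, Y ω ∉ cube d (R / 3) →
      R / 3 ≤ ‖frozenScheme pb pσ h R u₀ z (k + 1) ω‖ := fun ω hω =>
    (lt_norm_of_notMem_cube fun hw => hω (eulerStep_mem_cube hχ h u₀ z k ω hw)).le
  have htr := abs_moment_truncation_sub_le hχ hR (by positivity) hYm hbad iW eW iY eY γ
  have hYint : Integrable (fun ω => mono γ (Y ω)) P := by
    refine (iY.const_mul (γ.degree.factorial : ℝ)).mono'
      ((continuous_mono γ).measurable.comp hYm).aestronglyMeasurable
      (Filter.Eventually.of_forall fun ω => ?_)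
    refine (abs_mono_le_exp_norm γ _).trans ?_
    gcongr
    linarith [norm_nonneg (Y ω)]
  obtain ⟨i1, e1⟩ := integral_of_indepFun hvm (hz.measurable k) (hz.law k) hvi
    (f := fun v y => mono γ (eulerStep pb pσ h v y))
    ((continuous_mono γ).measurable.comp (measurable_eulerStep h)) hYint
  obtain ⟨i2, e2⟩ := integral_eval_eq_functional (P := P) hvm hvR
    (genPoly pb pσ (MvPolynomial.monomial γ 1))
  have i3 := integrable_mono_of_mem_cube (P := P) hvm hvR γ
  have hloc : |moment P Y γ - moment P (v k) γ - h * functional (moment P (v k))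
      (genPoly pb pσ (MvPolynomial.monomial γ 1))| ≤
      √h ^ 3 * (γ.degree.factorial * Real.exp B) := by
    have i4 := i1.sub i3
    have f1 := integral_sub i4 (i2.const_mul h)
    have f2 := integral_sub i1 i3
    simp only [Pi.sub_apply] at f1 f2
    have e3 : moment P Y γ - moment P (v k) γ - h * functional (moment P (v k))
        (genPoly pb pσ (MvPolynomial.monomial γ 1)) =
        ∫ ω, (∫ y, mono γ (eulerStep pb pσ h (v k ω) y) ∂stdNormal m - mono γ (v k ω) -
          h * MvPolynomial.eval (fun l => v k ω l)
            (genPoly pb pσ (MvPolynomial.monomial γ 1))) ∂P := by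
      rw [f1, f2, integral_const_mul, e2, ← e1]
      rfl
    rw [e3]
    refine abs_integral_le_integral_abs.trans ?_
    refine (integral_mono (i4.sub (i2.const_mul h)).abs
      (integrable_const (√h ^ 3 * (γ.degree.factorial * Real.exp B))) fun ω => ?_).trans_eq ?_
    · refine (abs_integral_mono_eulerStep_sub_le h0.le h1 (hβ ω) (hσ _ (hvR ω)) γ).trans ?_
      gcongr
      exact hBle ω
    · rw [integral_const, probReal_univ, one_smul]
  have e4 : moment P (v (k + 1)) γ = moment P (fun ω => χ (Y ω)) γ := rfl
  rw [e4]
  calc |moment P (fun ω => χ (Y ω)) γ - moment P (v k) γ - h * functional (moment P (v k))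
        (genPoly pb pσ (MvPolynomial.monomial γ 1))|
      = |(moment P (fun ω => χ (Y ω)) γ - moment P Y γ) + (moment P Y γ - moment P (v k) γ -
          h * functional (moment P (v k)) (genPoly pb pσ (MvPolynomial.monomial γ 1)))| := by
        congr 1; ring
    _ ≤ _ := (abs_add_le _ _).trans (add_le_add htr hloc)
    _ = _ := by ring

theorem abs_moment_refScheme_zero_sub_le [IsProbabilityMeasure P] {K T δ₀ M₀ h R : ℝ}
    {u₀ : Ω → Vec d} {z : ℕ → Ω → Fin m → ℝ} {χ : Vec d → Vec d} (hK : 0 < K) (hT : 0 < T)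
    (hδ₀ : 0 < δ₀) (hR : 0 ≤ R) (hu : InitialCondition δ₀ M₀ P u₀) (hχ : IsTruncation R χ)
    (γ : Idx d) :
    |moment P (refScheme χ pb pσ h u₀ z 0) γ - moment P u₀ γ| ≤
      γ.degree.factorial * (Real.exp (-(δ₀ * Real.exp (-(expRate K δ₀ * T)) * R ^ 2 / 18)) *
        (M₀ + 2 * Real.exp (2 * R) + 2 * (Real.exp δ₀⁻¹ * M₀))) := by
  have hle : Real.exp (-(expRate K δ₀ * T)) ≤ 1 := by
    rw [Real.exp_le_one_iff, expRate]
    have : 0 ≤ (7 * K + 128 * δ₀ * K ^ 2) * T := by positivity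
    linarith
  have iW : Integrable (fun ω => Real.exp (δ₀ * Real.exp (-(expRate K δ₀ * T)) * ‖u₀ ω‖ ^ 2)) P ∧
      ∫ ω, Real.exp (δ₀ * Real.exp (-(expRate K δ₀ * T)) * ‖u₀ ω‖ ^ 2) ∂P ≤ M₀ := by
    have hpt : ∀ ω, Real.exp (δ₀ * Real.exp (-(expRate K δ₀ * T)) * ‖u₀ ω‖ ^ 2) ≤
        Real.exp (δ₀ * ‖u₀ ω‖ ^ 2) := fun ω => by
      rw [Real.exp_le_exp]
      gcongr
      exact mul_le_of_le_one_right hδ₀.le hle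
    have hi : Integrable (fun ω =>
        Real.exp (δ₀ * Real.exp (-(expRate K δ₀ * T)) * ‖u₀ ω‖ ^ 2)) P := by
      refine hu.integrable.mono'
        (((hu.measurable.norm.pow_const 2).const_mul _).exp).aestronglyMeasurable
        (Filter.Eventually.of_forall fun ω => ?_)
      rw [Real.norm_eq_abs, Real.abs_exp]
      exact hpt ω
    exact ⟨hi, (integral_mono hi hu.integrable hpt).trans hu.bound⟩
  have iY : Integrable (fun ω => Real.exp (2 * ‖u₀ ω‖)) P ∧
      ∫ ω, Real.exp (2 * ‖u₀ ω‖) ∂P ≤ Real.exp δ₀⁻¹ * M₀ := by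
    have hpt : ∀ ω, Real.exp (2 * ‖u₀ ω‖) ≤ Real.exp δ₀⁻¹ * Real.exp (δ₀ * ‖u₀ ω‖ ^ 2) := by
      intro ω
      rw [← Real.exp_add, Real.exp_le_exp]
      have : δ₀⁻¹ + δ₀ * ‖u₀ ω‖ ^ 2 - 2 * ‖u₀ ω‖ = δ₀ * (‖u₀ ω‖ - δ₀⁻¹) ^ 2 := by
        field_simp
        ring
      have h2 : 0 ≤ δ₀ * (‖u₀ ω‖ - δ₀⁻¹) ^ 2 := by positivity
      linarith
    have hi : Integrable (fun ω => Real.exp (2 * ‖u₀ ω‖)) P := by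
      refine (hu.integrable.const_mul (Real.exp δ₀⁻¹)).mono'
        ((hu.measurable.norm.const_mul 2).exp).aestronglyMeasurable (Filter.Eventually.of_forall fun ω => ?_)
      rw [Real.norm_eq_abs, Real.abs_exp]
      exact hpt ω
    refine ⟨hi, (integral_mono hi (hu.integrable.const_mul _) hpt).trans ?_⟩
    rw [integral_const_mul]
    exact mul_le_mul_of_nonneg_left hu.bound (Real.exp_pos _).le
  exact abs_moment_truncation_sub_le hχ hR (by positivity) hu.measurable
    (fun ω hω => (lt_norm_of_notMem_cube hω).le) iW.1 iW.2 iY.1 iY.2 γ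

end LocalError

/-! ### Discrete Gronwall inequality and growth of the weighted moment error. -/

section Propagation

variable {d m : ℕ}

theorem discrete_gronwall {D : ℕ → ℝ} {h A E E₀ : ℝ} {n : ℕ} (h0 : 0 ≤ h) (hA : 0 ≤ A)
    (hE : 0 ≤ E) (hE₀ : 0 ≤ E₀) (hD₀ : D 0 ≤ E₀)
    (hD : ∀ k < n, D (k + 1) ≤ (1 + h * A) * D k + h * E) {k : ℕ} (hk : k ≤ n) :
    D k ≤ Real.exp (A * (k * h)) * (E₀ + k * h * E) := by
  induction k with
  | zero => simpa using hD₀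
  | succ k ih =>
    have ih' := ih (by omega)
    have h1 : 1 + h * A ≤ Real.exp (A * h) := by linarith [Real.add_one_le_exp (A * h)]
    have h2 : 0 ≤ 1 + h * A := by positivity
    have h3 : 1 ≤ Real.exp (A * ((k + 1 : ℕ) * h)) := Real.one_le_exp (by positivity)
    calc D (k + 1) ≤ (1 + h * A) * D k + h * E := hD k (by omega)
      _ ≤ (1 + h * A) * (Real.exp (A * (k * h)) * (E₀ + k * h * E)) + h * E := by gcongr
      _ ≤ Real.exp (A * h) * (Real.exp (A * (k * h)) * (E₀ + k * h * E)) +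
          Real.exp (A * ((k + 1 : ℕ) * h)) * (h * E) := by
          refine add_le_add (mul_le_mul_of_nonneg_right h1 (by positivity)) ?_
          exact le_mul_of_one_le_left (by positivity) h3
      _ = _ := by
          rw [← mul_assoc, ← Real.exp_add]
          push_cast
          rw [show A * h + A * (k * h) = A * ((k + 1) * h) by ring]
          ring

theorem functional_sub_left (μ ν : Idx d → ℝ) (p : MvPolynomial (Fin d) ℝ) :
    functional μ p - functional ν p = functional (fun γ => μ γ - ν γ) p := by
  simp only [functional, ← Finset.sum_sub_distrib, mul_sub]

/-- Subtracting the recursions, the error e gains the local defect and h e(G x^γ). The latter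
involves orders up to 2L+2S, while e is propagated only up to 2L+S. The gap is not compared but
bounded by τ, from the cube on one side and stability on the other. -/
theorem momentDist_mrpc_le {L S n : ℕ} {s : Idx d → Fin 4 → Idx d}
    {pb : Fin d → MvPolynomial (Fin d) ℝ} {pσ : Matrix (Fin d) (Fin m) (MvPolynomial (Fin d) ℝ)}
    {h R Cδ A ε ε₀ τ : ℝ} {μ₀ : Idx d → ℝ} {M : ℕ → Idx d → ℝ} (h0 : 0 ≤ h) (hA : 0 ≤ A)
    (hε : 0 ≤ ε) (hε₀ : 0 ≤ ε₀) (hSL : S ≤ L) (hs : IsSplitting L S s)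
    (hst : Stable Cδ L S n s (mrpc L S s pb pσ h μ₀))
    (hb : ∀ i, (pb i).totalDegree ≤ S) (hσ : ∀ i j, 2 * (pσ i j).totalDegree ≤ S)
    (hcoef : (d : ℝ) ^ 2 *
      (driftSum S (2 * L + 2 * S) pb + 1 / 2 * diffusionSum S (2 * L + 2 * S) pσ) ≤ A)
    (hM : ∀ k ≤ n, ∀ γ, |M k γ| ≤ R ^ γ.degree)
    (hM₀ : ∀ γ, |M 0 γ - μ₀ γ| ≤ γ.degree.factorial * ε₀)
    (hMs : ∀ k < n, ∀ γ, |M (k + 1) γ - M k γ -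
      h * functional (M k) (genPoly pb pσ (MvPolynomial.monomial γ 1))| ≤
        γ.degree.factorial * (h * ε))
    (hτ0 : 0 ≤ τ)
    (hτ : ∑ γ ∈ (idxLE d (2 * L + 2 * S)).filter (fun γ => 2 * L + S < γ.degree),
      (R ^ γ.degree + Cδ * √(γ.degree.factorial : ℝ)) / (γ.degree.factorial : ℝ) ≤ τ)
    {k : ℕ} (hk : k ≤ n) :
    momentDist (2 * L + S) (M k) (computed L S s (mrpc L S s pb pσ h μ₀ k)) ≤
      Real.exp (A * (k * h)) * ((idxLE d (2 * L + S)).card * ε₀ +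
        k * h * (A * τ + (idxLE d (2 * L + S)).card * ε)) := by
  set μ := mrpc L S s pb pσ h μ₀ with hμ
  set J := 2 * L + S with hJ
  set N : ℝ := ((idxLE d J).card : ℝ) with hN
  refine discrete_gronwall (D := fun k => momentDist J (M k) (computed L S s (μ k)))
    h0 hA (by positivity) (by positivity) ?_ ?_ hk
  · calc momentDist J (M 0) (computed L S s (μ 0)) ≤ ∑ _γ ∈ idxLE d J, ε₀ := by
          refine Finset.sum_le_sum fun γ hγ => ?_
          rw [mem_idxLE] at hγ
          rw [computed, if_pos hγ, hμ, mrpc, if_pos hγ, div_le_iff₀ (by positivity), mul_comm]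
          exact hM₀ γ
      _ = N * ε₀ := by rw [Finset.sum_const, nsmul_eq_mul]
  · intro k hk
    set e : Idx d → ℝ := fun γ => M k γ - computed L S s (μ k) γ with he
    have hpt : ∀ γ ∈ idxLE d J, |M (k + 1) γ - computed L S s (μ (k + 1)) γ| /
        (γ.degree.factorial : ℝ) ≤ h * ε + |e γ| / (γ.degree.factorial : ℝ) +
        h * (|functional e (genPoly pb pσ (MvPolynomial.monomial γ 1))| /
          (γ.degree.factorial : ℝ)) := by
      intro γ hγ
      rw [mem_idxLE] at hγ
      -- Exactness of ℰ up to order 2L+S is used here: ℰ agrees with the computed moments at every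
      -- order, so mRPC has no local defect.
      have hc1 : computed L S s (μ (k + 1)) γ = computed L S s (μ k) γ +
          h * functional (computed L S s (μ k)) (genPoly pb pσ (MvPolynomial.monomial γ 1)) := by
        rw [← approxExp_eq_computed hs (hst.posDef k hk.le) hSL,
          approxExp_eq hs (hst.posDef k hk.le) hSL hγ, computed, if_pos hγ]
        exact mrpc_succ L S s pb pσ h μ₀ k hγ
      have hF : (0 : ℝ) < γ.degree.factorial := by positivity
      have h1 : M (k + 1) γ - computed L S s (μ (k + 1)) γ =
          (M (k + 1) γ - M k γ - h * functional (M k) (genPoly pb pσ (MvPolynomial.monomial γ 1))) +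
          e γ + h * functional e (genPoly pb pσ (MvPolynomial.monomial γ 1)) := by
        rw [hc1, he, ← functional_sub_left]
        ring
      rw [h1]
      refine (div_le_div_of_nonneg_right (abs_add_three _ _ _) hF.le).trans ?_
      rw [add_div, add_div, abs_mul, abs_of_nonneg h0, mul_div_assoc]
      refine add_le_add (add_le_add ?_ le_rfl) le_rfl
      rw [div_le_iff₀ hF, mul_comm (h * ε)]
      exact hMs k hk γ
    refine (Finset.sum_le_sum hpt).trans ?_
    rw [Finset.sum_add_distrib, Finset.sum_add_distrib, Finset.sum_const, nsmul_eq_mul,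
      ← Finset.mul_sum]
    have h2 := sum_functional_genPoly_le (L := L) hb hσ e
    have h3 : ∑ γ ∈ idxLE d (2 * L + 2 * S), |e γ| / (γ.degree.factorial : ℝ) ≤
        momentDist J (M k) (computed L S s (μ k)) + τ := by
      rw [← Finset.sum_filter_add_sum_filter_not (idxLE d (2 * L + 2 * S))
        (fun γ => J < γ.degree), add_comm]
      refine add_le_add (le_of_eq ?_) ((Finset.sum_le_sum fun γ hγ => ?_).trans hτ)
      · rw [momentDist]
        refine Finset.sum_congr ?_ fun γ _ => rfl
        ext γ
        simp only [Finset.mem_filter, mem_idxLE, not_lt]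
        omega
      · rw [Finset.mem_filter, mem_idxLE] at hγ
        refine div_le_div_of_nonneg_right ?_ (by positivity)
        exact (abs_sub _ _).trans (add_le_add (hM k hk.le γ) (hst.bound k hk.le γ hγ.1))
    have h4 : 0 ≤ ∑ γ ∈ idxLE d (2 * L + 2 * S), |e γ| / (γ.degree.factorial : ℝ) :=
      Finset.sum_nonneg fun _ _ => by positivity
    have h5 := h2.trans ((mul_le_mul_of_nonneg_right hcoef h4).trans
      (mul_le_mul_of_nonneg_left h3 hA))
    have h6 := mul_le_mul_of_nonneg_left h5 h0
    have h7 : ∑ γ ∈ idxLE d J, |e γ| / (γ.degree.factorial : ℝ) =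
        momentDist J (M k) (computed L S s (μ k)) := rfl
    rw [h7]
    linarith

end Propagation

/-! ### Asymptotics in the truncation radius -/

section Asymptotics

open Filter Topology

theorem eventually_mul_le_rpow_sub_one {η lam : ℝ} (hη : 1 < η) (hlam : 0 < lam) (ρ : ℝ) :
    ∀ᶠ R : ℝ in atTop, ρ * R ≤ lam * R ^ η - 1 := by
  have h1 := (tendsto_rpow_atTop (sub_pos.2 hη)).eventually_ge_atTop ((ρ + 1) / lam)
  filter_upwards [h1, eventually_ge_atTop 1] with R hR hR1
  have hR0 : 0 < R := by linarith
  rw [div_le_iff₀ hlam] at hR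
  have h2 : R ^ η = R ^ (η - 1) * R := by
    rw [← Real.rpow_add_one hR0.ne', sub_add_cancel]
  rw [h2]
  nlinarith

theorem eventually_rpow_sub_sq_le {η δ : ℝ} (hη : η < 2) (hδ : 0 < δ) (c : ℝ) :
    ∀ᶠ R : ℝ in atTop, c * R ^ η - δ / 4 * R ^ 2 ≤ -R := by
  have h1 := (tendsto_rpow_atTop (sub_pos.2 hη)).eventually_ge_atTop (8 * c / δ)
  filter_upwards [h1, eventually_ge_atTop 1, eventually_ge_atTop (8 / δ)] with R hR hR1 hRδ
  have hR0 : 0 < R := by linarith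
  rw [div_le_iff₀ hδ] at hR hRδ
  have h2 : R ^ 2 = R ^ (2 - η) * R ^ η := by
    rw [← Real.rpow_add hR0, sub_add_cancel, Real.rpow_two]
  have h3 : 0 < R ^ η := Real.rpow_pos_of_pos hR0 η
  nlinarith [mul_le_mul_of_nonneg_right hR h3.le]

theorem eventually_exp_neg_le_rpow (N : ℝ) :
    ∀ᶠ R : ℝ in atTop, Real.exp (-R) ≤ R ^ (-(2 * N)) := by
  have h1 := tendsto_rpow_mul_exp_neg_mul_atTop_nhds_zero (2 * N) 1 one_pos
  filter_upwards [h1.eventually_le_const one_pos, eventually_gt_atTop 0] with R hR hR0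
  rw [Real.rpow_neg hR0.le, ← one_div, le_div_iff₀ (Real.rpow_pos_of_pos hR0 _), mul_comm]
  simpa using hR

/-- The bound j! ≥ (j/e)^j, applied with j/e ≥ x e^t. -/
theorem exp_mul_le_pow_self {j : ℕ} {x t : ℝ} (hx : 0 ≤ x) (hj : x * Real.exp (1 + t) ≤ j) :
    x ^ j * Real.exp (t * j) ≤ j.factorial := by
  have h1 := Real.pow_div_factorial_le_exp (j : ℝ) (Nat.cast_nonneg j) j
  rw [div_le_iff₀ (by positivity)] at h1
  have h2 := pow_le_pow_left₀ (by positivity) hj j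
  rw [mul_pow, ← Real.exp_nat_mul, show (j : ℝ) * (1 + t) = j + t * j by ring, Real.exp_add] at h2
  have h3 : Real.exp j * (x ^ j * Real.exp (t * j)) ≤ Real.exp j * j.factorial := by linarith
  exact le_of_mul_le_mul_left h3 (Real.exp_pos _)

/-- R^j/j! needs only rate q, but 1/√j! halves the rate, so j! must exceed e^{2qj}; hence 1 + 2q in
the hypothesis. -/
theorem tail_term_le {j : ℕ} {R q c : ℝ} (hR : 1 ≤ R) (hq : 0 ≤ q)
    (hj : Real.exp (1 + 2 * q) * R ≤ j) :
    (R ^ j + c * √(j.factorial : ℝ)) / (j.factorial : ℝ) ≤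
      (1 + |c|) * Real.exp (-(q * j)) := by
  have hF : (0 : ℝ) < j.factorial := by positivity
  have h1 : R ^ j * Real.exp (q * j) ≤ j.factorial := by
    refine exp_mul_le_pow_self (by linarith) (le_trans ?_ hj)
    rw [mul_comm]
    gcongr
    linarith
  have h2 : Real.exp (q * j) ≤ √(j.factorial : ℝ) := by
    refine Real.le_sqrt_of_sq_le ?_
    have := exp_mul_le_pow_self (j := j) (x := 1) (t := 2 * q) zero_le_one
      ((by nlinarith [Real.exp_pos (1 + 2 * q)] : 1 * Real.exp (1 + 2 * q) ≤
        Real.exp (1 + 2 * q) * R).trans hj)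
    rw [one_pow, one_mul] at this
    rw [← Real.exp_nat_mul]
    convert this using 2
    push_cast
    ring
  have hE := Real.exp_pos (q * j)
  rw [div_le_iff₀ hF, Real.exp_neg, add_mul, add_mul, one_mul]
  refine add_le_add ?_ ?_
  · rw [inv_mul_eq_div, le_div_iff₀ hE]
    exact h1
  · have h3 : √(j.factorial : ℝ) ≤ (Real.exp (q * j))⁻¹ * j.factorial := by
      rw [inv_mul_eq_div, le_div_iff₀ hE]
      calc _ ≤ √(j.factorial : ℝ) * √(j.factorial : ℝ) := by gcongr
        _ = _ := Real.mul_self_sqrt hF.le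
    calc c * √(j.factorial : ℝ) ≤ |c| * √(j.factorial : ℝ) := by
          gcongr
          exact le_abs_self c
      _ ≤ |c| * ((Real.exp (q * j))⁻¹ * j.factorial) := by gcongr
      _ = _ := by ring

theorem card_idxLE_le (d n : ℕ) : ((idxLE d n).card : ℝ) ≤ Real.exp (d * n) := by
  classical
  have h1 : (idxLE d n).card ≤ (n + 1) ^ d := by
    calc (idxLE d n).card ≤ (Fintype.piFinset fun _ : Fin d => Finset.range (n + 1)).card := by
          refine Finset.card_le_card_of_injOn (fun γ => ⇑γ) (fun γ hγ => ?_)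
            (DFunLike.coe_injective.injOn)
          simp only [Finset.mem_coe, Fintype.mem_piFinset, Finset.mem_range]
          rw [Finset.mem_coe, mem_idxLE] at hγ
          exact fun i => Nat.lt_succ_of_le ((apply_le_degree γ i).trans hγ)
      _ = _ := by simp
  calc ((idxLE d n).card : ℝ) ≤ ((n : ℝ) + 1) ^ d := by exact_mod_cast h1
    _ ≤ Real.exp n ^ d := by gcongr; exact Real.add_one_le_exp _
    _ = _ := (Real.exp_nat_mul _ _).symm

theorem tail_sum_le {d J w : ℕ} {R q c y : ℝ} (hR : 1 ≤ R) (hq : 0 ≤ q) (hy : y ≤ J)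
    (hRy : Real.exp (1 + 2 * q) * R ≤ y) :
    ∑ γ ∈ (idxLE d w).filter (fun γ => J < γ.degree),
      (R ^ γ.degree + c * √(γ.degree.factorial : ℝ)) / (γ.degree.factorial : ℝ) ≤
      Real.exp (d * w) * ((1 + |c|) * Real.exp (-(q * y))) := by
  calc _ ≤ ∑ γ ∈ (idxLE d w).filter (fun γ => J < γ.degree),
        (1 + |c|) * Real.exp (-(q * y)) := by
        refine Finset.sum_le_sum fun γ hγ => ?_
        rw [Finset.mem_filter] at hγ
        have h1 : y ≤ γ.degree := hy.trans (by exact_mod_cast hγ.2.le)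
        refine (tail_term_le hR hq (hRy.trans h1)).trans ?_
        gcongr
    _ = ((idxLE d w).filter (fun γ => J < γ.degree)).card * ((1 + |c|) * Real.exp (-(q * y))) := by
        rw [Finset.sum_const, nsmul_eq_mul]
    _ ≤ _ := by
        refine mul_le_mul_of_nonneg_right (le_trans ?_ (card_idxLE_le d w)) (by positivity)
        exact_mod_cast Finset.card_filter_le _ _

/-- Here X stands for R^η. The local errors carry e^{-δR²/4}, which `hexp` sets against all factors
exponential in X. For the tail, `hq` makes q·lam·X pay T·cA·X twice (once for the Gronwall factor,
once for T·cA·X ≤ e^{T·cA·X}) and 4d·lam·X for the count of multi-indices, leaving e^{-X} ≤ e^{-R}.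
-/
theorem total_error_le {d J w : ℕ} {K T R X lam δ cA Q₀ c q : ℝ} (hK : 0 < K) (hT : 0 < T)
    (hR : 1 ≤ R) (hRX : R ≤ X) (hQ₀ : 0 ≤ Q₀)
    (hJ : (J : ℝ) ≤ 3 * lam * X) (hw : (w : ℝ) ≤ 4 * lam * X)
    (hq : q * lam = 2 * (T * cA) + 4 * d * lam + 1)
    (hexp : (T * cA + 3 * d * lam + 2 * (d + 1 + K * d)) * X - δ / 4 * R ^ 2 ≤ -R) :
    Real.exp (cA * X * T) * ((1 + T) * ((idxLE d J).card *
        (Real.exp (-(δ / 4 * R ^ 2)) * (Q₀ * Real.exp (2 * stepExponent d K R)))) +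
      T * (cA * X * (Real.exp (d * w) * ((1 + |c|) * Real.exp (-(q * (lam * X - 1))))))) ≤
    ((1 + T) * Q₀ * Real.exp (2 * stepExponent d K 0) + (1 + |c|) * Real.exp q) *
      Real.exp (-R) := by
  have hX : 0 ≤ X := by linarith
  rw [mul_add (Real.exp (cA * X * T)),
    add_mul ((1 + T) * Q₀ * Real.exp (2 * stepExponent d K 0))]
  refine add_le_add ?_ ?_
  · have hB : 2 * stepExponent d K R ≤ 2 * stepExponent d K 0 + 2 * (d + 1 + K * d) * X := by
      have : stepExponent d K R = stepExponent d K 0 + (d + 1 + K * d) * R := by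
        rw [stepExponent, stepExponent]; ring
      have h2 : (d + 1 + K * d) * R ≤ (d + 1 + K * d) * X := by gcongr
      linarith
    have hN : ((idxLE d J).card : ℝ) ≤ Real.exp (3 * d * lam * X) := by
      refine (card_idxLE_le d J).trans (Real.exp_le_exp.2 ?_)
      calc (d : ℝ) * J ≤ d * (3 * lam * X) := by gcongr
        _ = _ := by ring
    calc _ ≤ Real.exp (cA * X * T) * ((1 + T) * (Real.exp (3 * d * lam * X) *
          (Real.exp (-(δ / 4 * R ^ 2)) *
            (Q₀ * Real.exp (2 * stepExponent d K 0 + 2 * (d + 1 + K * d) * X))))) := by gcongr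
      _ = (1 + T) * Q₀ * Real.exp (2 * stepExponent d K 0) *
          Real.exp ((T * cA + 3 * d * lam + 2 * (d + 1 + K * d)) * X - δ / 4 * R ^ 2) := by
          rw [show (T * cA + 3 * d * lam + 2 * (d + 1 + K * d)) * X - δ / 4 * R ^ 2 =
            cA * X * T + 3 * d * lam * X + -(δ / 4 * R ^ 2) + 2 * (d + 1 + K * d) * X by ring]
          simp only [Real.exp_add]
          ring
      _ ≤ _ := by gcongr
  · have h1 : T * (cA * X) ≤ Real.exp (cA * X * T) := by
      have := Real.add_one_le_exp (cA * X * T)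
      linarith
    have h2 : Real.exp (d * w) ≤ Real.exp (4 * d * lam * X) := by
      refine Real.exp_le_exp.2 ?_
      calc (d : ℝ) * w ≤ d * (4 * lam * X) := by gcongr
        _ = _ := by ring
    calc _ = Real.exp (cA * X * T) * (T * (cA * X) * (Real.exp (d * w) *
          ((1 + |c|) * Real.exp (-(q * (lam * X - 1)))))) := by ring
      _ ≤ Real.exp (cA * X * T) * (Real.exp (cA * X * T) * (Real.exp (4 * d * lam * X) *
          ((1 + |c|) * Real.exp (-(q * (lam * X - 1)))))) := by gcongr
      _ = (1 + |c|) * Real.exp q * Real.exp (-X) := by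
          rw [show -(q * (lam * X - 1)) = q + -X - cA * X * T - cA * X * T - 4 * d * lam * X by
            linear_combination (-X) * hq, Real.exp_sub, Real.exp_sub, Real.exp_sub, Real.exp_add q]
          field_simp
      _ ≤ _ := by gcongr

end Asymptotics

/-! ### Bounds on the polynomial coefficients -/

section Coefficients

variable {d m : ℕ} {K C r η Cbσ Rs R : ℝ} {L S : ℕ} {b : Vec d → Vec d}
  {σ : Vec d → Matrix (Fin d) (Fin m) ℝ} {pb : Fin d → MvPolynomial (Fin d) ℝ}
  {pσ : Matrix (Fin d) (Fin m) (MvPolynomial (Fin d) ℝ)}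

/-- Since S/R grows, the approximation error C (R/S)^r drops below K. On I_R the polynomial
coefficients then inherit linear growth and boundedness; outside I_R nothing is known about them. -/
theorem mul_rpow_le_of_le {ρ : ℝ} (hK : 0 < K) (hC : 0 < C) (hr : 0 < r) (hR : 0 ≤ R)
    (hρ : (C / K) ^ r⁻¹ ≤ ρ) (hS : ρ * R ≤ S) : C * R ^ r ≤ K * (S : ℝ) ^ r := by
  have h1 : ((C / K) ^ r⁻¹ * R) ^ r ≤ (S : ℝ) ^ r :=
    Real.rpow_le_rpow (by positivity) ((mul_le_mul_of_nonneg_right hρ hR).trans hS) hr.le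
  rw [Real.mul_rpow (by positivity) hR, Real.rpow_inv_rpow (by positivity) hr.ne',
    div_mul_eq_mul_div, div_le_iff₀ hK] at h1
  linarith

theorem DriftDiffusion.norm_evalVec_le (hD : DriftDiffusion K C r η Cbσ Rs R L S b σ pb pσ)
    (hS : 0 < S) (hCS : C * R ^ r ≤ K * (S : ℝ) ^ r) {x : Vec d} (hx : x ∈ cube d R) :
    ‖evalVec pb x‖ ≤ K * (‖x‖ + 2) := by
  have hSr : (0 : ℝ) < (S : ℝ) ^ r := Real.rpow_pos_of_pos (by exact_mod_cast hS) r
  have h1 : ‖b x - evalVec pb x‖ ≤ K := by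
    have := (hD.approx_drift x hx).trans hCS
    rw [mul_comm K] at this
    exact le_of_mul_le_mul_left this hSr
  have h2 : ‖evalVec pb x‖ ≤ ‖b x‖ + ‖b x - evalVec pb x‖ := by
    have := norm_sub_norm_le (evalVec pb x) (b x)
    rw [norm_sub_rev] at this
    linarith
  linarith [hD.growth x]

theorem DriftDiffusion.sum_evalMat_sq_le (hD : DriftDiffusion K C r η Cbσ Rs R L S b σ pb pσ)
    (hK : 0 < K) (hS : 0 < S) (hCS : C * R ^ r ≤ K * (S : ℝ) ^ r) {x : Vec d}
    (hx : x ∈ cube d R) : ∑ i, ∑ j, evalMat pσ x i j ^ 2 ≤ 4 * K ^ 2 := by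
  have hSr : (0 : ℝ) < (S : ℝ) ^ r := Real.rpow_pos_of_pos (by exact_mod_cast hS) r
  have h1 : frob (σ x - evalMat pσ x) ≤ K := by
    have := (hD.approx_diffusion x hx).trans hCS
    rw [mul_comm K] at this
    exact le_of_mul_le_mul_left this hSr
  have hsq : ∀ A : Matrix (Fin d) (Fin m) ℝ, frob A ≤ K → ∑ i, ∑ j, A i j ^ 2 ≤ K ^ 2 := by
    intro A hA
    exact (Real.sqrt_le_left hK.le).1 hA
  have h2 := hsq _ (hD.bounded x).le
  have h3 := hsq _ h1
  calc ∑ i, ∑ j, evalMat pσ x i j ^ 2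
      ≤ ∑ i, ∑ j, (2 * σ x i j ^ 2 + 2 * (σ x - evalMat pσ x) i j ^ 2) := by
        refine Finset.sum_le_sum fun i _ => Finset.sum_le_sum fun j _ => ?_
        rw [Matrix.sub_apply]
        nlinarith [sq_nonneg (2 * σ x i j - evalMat pσ x i j)]
    _ = 2 * ∑ i, ∑ j, σ x i j ^ 2 + 2 * ∑ i, ∑ j, (σ x - evalMat pσ x) i j ^ 2 := by
        simp only [Finset.sum_add_distrib, Finset.mul_sum]
    _ ≤ _ := by linarith

end Coefficients

/-! ### The convergence estimate for a fixed truncation radius -/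

theorem momentDist_refScheme_mrpc_le {d m : ℕ} {Ω : Type*} [MeasurableSpace Ω] {P : Measure Ω}
    [IsProbabilityMeasure P] {K T δ₀ δ C r η lam₁ lam₂ Cbσ Rs M₀ Cδ h R q : ℝ} {n L S : ℕ}
    {b : Vec d → Vec d} {σ : Vec d → Matrix (Fin d) (Fin m) ℝ}
    {pb : Fin d → MvPolynomial (Fin d) ℝ} {pσ : Matrix (Fin d) (Fin m) (MvPolynomial (Fin d) ℝ)}
    {χ : Vec d → Vec d} {s : Idx d → Fin 4 → Idx d} {u₀ : Ω → Vec d} {z : ℕ → Ω → Fin m → ℝ}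
    (hK : 0 < K) (hT : 0 < T) (hδ₀ : 0 < δ₀)
    (hδs : δ ≤ δ₀ * Real.exp (-(expRate K δ₀ * T)) / 18) (hδ : 0 < δ) (hC : 0 < C) (hr : 0 < r)
    (hη : 1 < η) (hlam₂ : 0 < lam₂) (hlam : lam₂ ≤ lam₁) (hCbσ : 0 < Cbσ) (hM₀ : 0 ≤ M₀)
    (h0 : 0 < h) (h1 : h ≤ 1) (hnT : n * h = T) (hKh : K * h ≤ 1)
    (hdh : 8 * δ₀ * h * d * K ^ 2 ≤ 1 / 4) (hhR : h = Real.exp (-(δ / 2 * R ^ 2)))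
    (hL : L = ⌊lam₁ * R ^ η⌋₊) (hS : S = ⌊lam₂ * R ^ η⌋₊)
    (hR1 : 1 ≤ R) (hRs : Rs < R) (hq0 : 0 ≤ q)
    (hq : q * lam₁ = 2 * (T * ((d : ℝ) ^ 2 * Cbσ)) + 4 * d * lam₁ + 1)
    (hρ : ((C / K) ^ r⁻¹ + 1) * R ≤ lam₂ * R ^ η - 1)
    (hqR : Real.exp (1 + 2 * q) * R ≤ lam₁ * R ^ η - 1)
    (hexp : (T * ((d : ℝ) ^ 2 * Cbσ) + 3 * d * lam₁ + 2 * (d + 1 + K * d)) * R ^ η -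
      δ / 4 * R ^ 2 ≤ -R)
    (hD : DriftDiffusion K C r η Cbσ Rs R L S b σ pb pσ) (hu : InitialCondition δ₀ M₀ P u₀)
    (hz : GaussianNoise P u₀ z) (hχ : IsTruncation R χ) (hs : IsSplitting L S s)
    (hst : Stable Cδ L S n s (mrpc L S s pb pσ h (moment P u₀))) {k : ℕ} (hk : k ≤ n) :
    momentDist (2 * L + S) (moment P (refScheme χ pb pσ h u₀ z k))
      (computed L S s (mrpc L S s pb pσ h (moment P u₀) k)) ≤
    ((1 + T) * (Real.exp (expGrowth d K δ₀ * T) * M₀ + M₀ * (1 + 2 * Real.exp δ₀⁻¹) + 5) *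
      Real.exp (2 * stepExponent d K 0) + (1 + |Cδ|) * Real.exp q) * Real.exp (-R) := by
  have hR0 : 0 ≤ R := by linarith
  set X := R ^ η with hX
  have hRX : R ≤ X := by
    simpa using Real.rpow_le_rpow_of_exponent_le hR1 hη.le
  have hX0 : 0 < X := by linarith
  have hlam₁ : 0 < lam₁ := hlam₂.trans_le hlam
  have hLle : (L : ℝ) ≤ lam₁ * X := hL ▸ Nat.floor_le (by positivity)
  have hLge : lam₁ * X - 1 ≤ L := by
    have := Nat.lt_floor_add_one (lam₁ * X)
    rw [← hL] at this
    linarith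
  have hSle : (S : ℝ) ≤ lam₂ * X := hS ▸ Nat.floor_le (by positivity)
  have hSge : lam₂ * X - 1 ≤ S := by
    have := Nat.lt_floor_add_one (lam₂ * X)
    rw [← hS] at this
    linarith
  have hSL : S ≤ L := by
    rw [hL, hS]
    exact Nat.floor_le_floor (mul_le_mul_of_nonneg_right hlam hX0.le)
  have hSle' : (S : ℝ) ≤ lam₁ * X := hSle.trans (mul_le_mul_of_nonneg_right hlam hX0.le)
  have hρ0 : 0 ≤ (C / K) ^ r⁻¹ := by positivity
  have hSpos : 0 < S := by
    have : (0 : ℝ) < S := by linarith [mul_nonneg hρ0 hR0]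
    exact_mod_cast this
  have hCS : C * R ^ r ≤ K * (S : ℝ) ^ r :=
    mul_rpow_le_of_le hK hC hr hR0 (by linarith) (hρ.trans hSge)
  have hb : ∀ x ∈ cube d R, ‖evalVec pb x‖ ≤ K * (‖x‖ + 2) := fun x hx =>
    hD.norm_evalVec_le hSpos hCS hx
  have hσ : ∀ x ∈ cube d R, ∑ i, ∑ j, evalMat pσ x i j ^ 2 ≤ 4 * K ^ 2 := fun x hx =>
    hD.sum_evalMat_sq_le hK hSpos hCS hx
  set g := Real.exp (-(δ / 4 * R ^ 2)) with hg
  have hg0 : 0 < g := Real.exp_pos _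
  have hg1 : g ≤ 1 := Real.exp_le_one_iff.2 (by rw [neg_nonpos]; positivity)
  have hgh : g ^ 2 = h := by
    rw [hg, hhR, ← Real.exp_nat_mul]
    congr 1
    push_cast
    ring
  have hsqrt : √h = g := by rw [← hgh, Real.sqrt_sq hg0.le]
  set B := stepExponent d K R with hB
  have hRB : R ≤ B := by
    rw [hB, stepExponent]
    have : 0 ≤ d * R + K * (d * R + 2) + (4 * (d * (4 * K ^ 2) + 1) + 1) := by positivity
    linarith
  have hB0 : 0 ≤ B := hR0.trans hRB
  set M := Real.exp (expGrowth d K δ₀ * T) * M₀ with hM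
  have hM0' : 0 ≤ M := by positivity
  -- One prefactor for both errors: M and the M₀ terms come from the exponential moments along the
  -- scheme and at time 0, and 5 = 2 + 2 + 1 covers 2e^{2R}, 2e^{2B} and e^B.
  set Q₀ := M + M₀ * (1 + 2 * Real.exp δ₀⁻¹) + 5 with hQ₀
  have hQ0 : 0 ≤ Q₀ := by positivity
  have hE1 : 1 ≤ Real.exp (2 * B) := Real.one_le_exp (by linarith)
  have hE2 : Real.exp (2 * R) ≤ Real.exp (2 * B) := Real.exp_le_exp.2 (by linarith)
  have hE3 : Real.exp B ≤ Real.exp (2 * B) := Real.exp_le_exp.2 (by linarith)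
  set E := Real.exp (2 * B) with hE
  -- The smallness of δ enters here: the truncation factor is at most e^{-δR²} = h², hence at most
  -- h√h, the order of the Taylor error.
  have htail : Real.exp (-(δ₀ * Real.exp (-(expRate K δ₀ * T)) * R ^ 2 / 18)) ≤ h * g := by
    calc _ ≤ Real.exp (-(δ * R ^ 2)) := by
          rw [Real.exp_le_exp, neg_le_neg_iff]
          linarith [mul_le_mul_of_nonneg_right hδs (sq_nonneg R)]
      _ = h * g * g := by
          rw [← hgh, hg, ← Real.exp_nat_mul, ← Real.exp_add, ← Real.exp_add]
          congr 1
          push_cast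
          ring
      _ ≤ h * g := mul_le_of_le_one_right (by positivity) hg1
  have hMe : 0 ≤ M₀ * Real.exp δ₀⁻¹ := by positivity
  have hlocal : ∀ k < n, ∀ γ, |moment P (refScheme χ pb pσ h u₀ z (k + 1)) γ -
      moment P (refScheme χ pb pσ h u₀ z k) γ -
      h * functional (moment P (refScheme χ pb pσ h u₀ z k))
        (genPoly pb pσ (MvPolynomial.monomial γ 1))| ≤
      γ.degree.factorial * (h * (g * (Q₀ * E))) := by
    intro k hk γ
    refine (abs_moment_refScheme_succ_sub_le hK hδ₀ hnT h0 h1 hKh hdh hR0 hb hσ hu hz hχ hk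
      γ).trans (mul_le_mul_of_nonneg_left ?_ (Nat.cast_nonneg _))
    rw [hsqrt]
    calc _ ≤ h * g * (M + 2 * Real.exp (2 * R) + 2 * E) + g ^ 3 * Real.exp B := by gcongr
      _ = h * g * (M + 2 * Real.exp (2 * R) + 2 * E + Real.exp B) := by rw [← hgh]; ring
      _ ≤ h * g * (Q₀ * E) := by
          refine mul_le_mul_of_nonneg_left ?_ (by positivity)
          rw [hQ₀]
          linarith [mul_le_mul_of_nonneg_left hE1 hM0', mul_nonneg hM₀ (Real.exp_pos (2 * B)).le,
            mul_nonneg hMe (Real.exp_pos (2 * B)).le]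
      _ = _ := by ring
  have hinit : ∀ γ, |moment P (refScheme χ pb pσ h u₀ z 0) γ - moment P u₀ γ| ≤
      γ.degree.factorial * (g * (Q₀ * E)) := by
    intro γ
    refine (abs_moment_refScheme_zero_sub_le hK hT hδ₀ hR0 hu hχ γ).trans
      (mul_le_mul_of_nonneg_left ?_ (Nat.cast_nonneg _))
    have hinner : M₀ + 2 * Real.exp (2 * R) + 2 * (Real.exp δ₀⁻¹ * M₀) ≤ Q₀ * E := by
      rw [hQ₀]
      linarith [mul_le_mul_of_nonneg_left hE1 hM₀, mul_nonneg hM0' (Real.exp_pos (2 * B)).le,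
        mul_le_mul_of_nonneg_left hE1 hMe]
    exact mul_le_mul (htail.trans (mul_le_of_le_one_left hg0.le h1)) hinner (by positivity) hg0.le
  have hvm := fun k => (hz.indepFun_chain hu.measurable hχ.measurable
    (g := fun v y => χ (eulerStep pb pσ h v y)) (hχ.measurable.comp (measurable_eulerStep h))
    (X := refScheme χ pb pσ h u₀ z) (fun ω => rfl) (fun k ω => rfl) k).1
  set τ := Real.exp (d * (2 * L + 2 * S : ℕ)) * ((1 + |Cδ|) * Real.exp (-(q * (lam₁ * X - 1))))
    with hτ
  have hcoef : (d : ℝ) ^ 2 *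
      (driftSum S (2 * L + 2 * S) pb + 1 / 2 * diffusionSum S (2 * L + 2 * S) pσ) ≤
      (d : ℝ) ^ 2 * Cbσ * X := by
    rw [mul_assoc]
    exact mul_le_mul_of_nonneg_left (hD.coeff_bound hRs) (by positivity)
  have hy : lam₁ * X - 1 ≤ ((2 * L + S : ℕ) : ℝ) := by
    push_cast
    linarith [Nat.cast_nonneg (α := ℝ) L, Nat.cast_nonneg (α := ℝ) S]
  have main := momentDist_mrpc_le (A := (d : ℝ) ^ 2 * Cbσ * X) (ε := g * (Q₀ * E))
    (ε₀ := g * (Q₀ * E)) (τ := τ) (M := fun k => moment P (refScheme χ pb pσ h u₀ z k)) h0.le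
    (by positivity) (by positivity) (by positivity) hSL hs hst hD.degree_drift
    hD.degree_diffusion hcoef
    (fun k _ γ => abs_moment_le (hvm k) (refScheme_mem_cube hχ hR0 h u₀ z k) γ) hinit hlocal
    (by positivity) (tail_sum_le hR1 hq0 hy hqR) hk
  refine main.trans ?_
  have hkT : k * h ≤ T := by
    rw [← hnT]
    exact mul_le_mul_of_nonneg_right (by exact_mod_cast hk) h0.le
  have htot := total_error_le (d := d) (J := 2 * L + S) (w := 2 * L + 2 * S) (cA := d ^ 2 * Cbσ)
    (Q₀ := Q₀) (c := Cδ) (lam := lam₁) hK hT hR1 hRX hQ0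
    (by push_cast; linarith) (by push_cast; linarith) hq hexp
  refine le_trans ?_ htot
  calc _ ≤ Real.exp ((d : ℝ) ^ 2 * Cbσ * X * T) * ((idxLE d (2 * L + S)).card * (g * (Q₀ * E)) +
        T * ((d : ℝ) ^ 2 * Cbσ * X * τ + (idxLE d (2 * L + S)).card * (g * (Q₀ * E)))) := by
        gcongr
    _ = _ := by rw [hτ]; ring

end MRPC

end

/-! ### Choice of the constants and conclusion. -/

open MRPC in
theorem mainTheorem2 (K T δ₀ : ℝ) (hK : 0 < K) (hT : 0 < T) (hδ₀ : 0 < δ₀) :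
    ∃ δs : ℝ, 0 < δs ∧
    ∀ δ : ℝ, 0 < δ → δ ≤ δs →
    ∀ (d : ℕ) (C r η lam₁ lam₂ Cbσ Rs M₀ Cδ : ℝ),
      0 < C → 0 < r → 1 < η → η < 2 → 0 < lam₂ → lam₂ ≤ lam₁ → 0 < Cbσ →
    ∀ N : ℝ, 0 ≤ N →
    ∃ CN hN : ℝ, 0 < CN ∧ 0 < hN ∧ hN < 1 ∧
    ∀ (h : ℝ) (n : ℕ), 0 < h → h < hN → n * h = T →
    ∀ (R : ℝ) (L S : ℕ),
      R = δ ^ (-(1 / 2) : ℝ) * (-2 * Real.log h) ^ (1 / 2 : ℝ) →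
      L = ⌊lam₁ * R ^ η⌋₊ → S = ⌊lam₂ * R ^ η⌋₊ →
    ∀ (m : ℕ) (b : Vec d → Vec d) (σ : Vec d → Matrix (Fin d) (Fin m) ℝ)
      (pb : Fin d → MvPolynomial (Fin d) ℝ)
      (pσ : Matrix (Fin d) (Fin m) (MvPolynomial (Fin d) ℝ))
      (χ : Vec d → Vec d) (s : Idx d → Fin 4 → Idx d)
      (Ω : Type*) [MeasurableSpace Ω] (P : MeasureTheory.Measure Ω)
      [MeasureTheory.IsProbabilityMeasure P]
      (u₀ : Ω → Vec d) (z : ℕ → Ω → Fin m → ℝ),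
      DriftDiffusion K C r η Cbσ Rs R L S b σ pb pσ →
      InitialCondition δ₀ M₀ P u₀ →
      GaussianNoise P u₀ z →
      IsTruncation R χ →
      IsSplitting L S s →
      Stable Cδ L S n s (mrpc L S s pb pσ h (moment P u₀)) →
    ∀ k ≤ n,
      momentDist (2 * L + S)
        (moment P (refScheme χ pb pσ h u₀ z k))
        (computed L S s (mrpc L S s pb pσ h (moment P u₀) k))
      ≤ CN * (-Real.log h) ^ (-N) := by
  refine ⟨δ₀ * Real.exp (-(expRate K δ₀ * T)) / 18, by positivity, ?_⟩
  intro δ hδ hδs d C r η lam₁ lam₂ Cbσ Rs M₀ Cδ hC hr hη hη2 hlam₂ hlam hCbσ N hN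
  have hlam₁ : 0 < lam₁ := hlam₂.trans_le hlam
  obtain ⟨q, hq0, hq⟩ : ∃ q : ℝ, 0 ≤ q ∧
      q * lam₁ = 2 * (T * ((d : ℝ) ^ 2 * Cbσ)) + 4 * d * lam₁ + 1 :=
    ⟨(2 * (T * ((d : ℝ) ^ 2 * Cbσ)) + 4 * d * lam₁ + 1) / lam₁, by positivity,
      div_mul_cancel₀ _ hlam₁.ne'⟩
  -- Every largeness condition on R depends only on the fixed constants, so one threshold R₀ serves
  -- all data, all m and all h.
  obtain ⟨R₀, hR₀⟩ := Filter.eventually_atTop.1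
    ((((((Filter.eventually_ge_atTop (1 : ℝ)).and (Filter.eventually_gt_atTop Rs)).and
      (eventually_mul_le_rpow_sub_one hη hlam₂ ((C / K) ^ r⁻¹ + 1))).and
      (eventually_mul_le_rpow_sub_one hη hlam₁ (Real.exp (1 + 2 * q)))).and
      (eventually_rpow_sub_sq_le hη2 hδ
        (T * ((d : ℝ) ^ 2 * Cbσ) + 3 * d * lam₁ + 2 * (d + 1 + K * d)))).and
      (eventually_exp_neg_le_rpow N))
  -- The constants are fixed before any data, when M₀ ≥ 0 is not yet known; hence |M₀|.
  set C₁ := (1 + T) * (Real.exp (expGrowth d K δ₀ * T) * |M₀| +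
      |M₀| * (1 + 2 * Real.exp δ₀⁻¹) + 5) *
      Real.exp (2 * stepExponent d K 0) + (1 + |Cδ|) * Real.exp q with hC₁
  have hC₁0 : 0 < C₁ := by positivity
  -- The factor (δ/2)^N converts R^{-2N} into (-log h)^{-N}. The four bounds on h give h < 1, Kh ≤
  -- 1, the smallness needed for the quadratic exponential moment (with +1 to allow d = 0), and R ≥
  -- R₀.
  refine ⟨C₁ * (δ / 2) ^ N, min (min (1 / 2) K⁻¹) (min (1 / 4 / (8 * δ₀ * d * K ^ 2 + 1))
    (Real.exp (-(δ / 2 * R₀ ^ 2)))), by positivity, by positivity, ?_, ?_⟩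
  · exact (min_le_left _ _).trans_lt ((min_le_left _ _).trans_lt (by norm_num))
  intro h n h0 hlt hnT R L S hR hL hS m b σ pb pσ χ s Ω _ P _ u₀ z hD hu hz hχ hs hst k hk
  simp only [lt_min_iff] at hlt
  obtain ⟨⟨hh1, hhK⟩, hhd, hhR⟩ := hlt
  have h1 : h ≤ 1 := by linarith
  have hlog : Real.log h < -(δ / 2 * R₀ ^ 2) := (Real.log_lt_iff_lt_exp h0).2 hhR
  have hlog0 : 0 ≤ -2 * Real.log h := by
    have : 0 ≤ δ / 2 * R₀ ^ 2 := by positivity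
    linarith
  have hRnn : 0 ≤ R := by rw [hR]; positivity
  have hR2 : δ * R ^ 2 = -2 * Real.log h := by
    rw [hR, mul_pow, ← Real.rpow_natCast, ← Real.rpow_natCast, ← Real.rpow_mul hδ.le,
      ← Real.rpow_mul hlog0]
    norm_num
    rw [Real.rpow_neg_one, mul_inv_cancel_left₀ hδ.ne']
  have hlogR : -Real.log h = δ / 2 * R ^ 2 := by linarith
  have hRge : R₀ ≤ R := by
    by_contra! hcon
    have : R ^ 2 ≤ R₀ ^ 2 := pow_le_pow_left₀ hRnn hcon.le 2
    nlinarith [mul_le_mul_of_nonneg_left this (by positivity : 0 ≤ δ / 2)]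
  obtain ⟨⟨⟨⟨⟨hR1, hRs⟩, hρ⟩, hqR⟩, hexp⟩, hexpN⟩ := hR₀ R hRge
  have hu' : InitialCondition δ₀ |M₀| P u₀ := ⟨hu.measurable, hu.integrable,
    hu.bound.trans (le_abs_self M₀)⟩
  have hKh : K * h ≤ 1 := by
    have := mul_le_mul_of_nonneg_left hhK.le hK.le
    rwa [mul_inv_cancel₀ hK.ne'] at this
  have hdh : 8 * δ₀ * h * d * K ^ 2 ≤ 1 / 4 := by
    rw [lt_div_iff₀ (by positivity)] at hhd
    linarith
  have hhR' : h = Real.exp (-(δ / 2 * R ^ 2)) := by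
    rw [← hlogR, neg_neg, Real.exp_log h0]
  refine (momentDist_refScheme_mrpc_le hK hT hδ₀ hδs hδ hC hr hη hlam₂ hlam hCbσ (abs_nonneg M₀)
    h0 h1 hnT hKh hdh hhR' hL hS hR1 hRs hq0 hq hρ hqR hexp hD hu' hz hχ hs hst hk).trans ?_
  have hR0 : 0 < R := by linarith
  have hδ2 : (δ / 2) ^ N * (δ / 2) ^ (-N) = 1 := by
    rw [← Real.rpow_add (by positivity), add_neg_cancel, Real.rpow_zero]
  have hpow : (δ / 2) ^ N * (-Real.log h) ^ (-N) = R ^ (-(2 * N)) := by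
    rw [hlogR, Real.mul_rpow (by positivity) (sq_nonneg R), ← mul_assoc, hδ2, one_mul,
      ← Real.rpow_two, ← Real.rpow_mul hR0.le, mul_neg]
  rw [mul_assoc C₁, hpow]
  exact mul_le_mul_of_nonneg_left hexpN hC₁0.le
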